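/- Conventions. For a finite set $P\subset\mathbb C$ a *geometric basis* of $\pi_1(\mathbb C-P,y_0)$ is a free basis whose elements are simultaneously represented by simple closed curves based at $y_0$, pairwise disjoint except for $y_0$, each of which is isotopic in $\mathbb C-P$ (through simple closed curves) to the positively oriented boundary of a small disc about one point of $P$, to which the element is then said to be associated. Let $D\subset\mathbb C$ be an open disc centred at $0$ and $D^*=D-\{0\}$. A (closed complex analytic) curve $C\subset D\times\mathbb C$ is an *asymptotic germ* of fibre degree $k$ and pole order $n$ if (i) over $D^*$ the projection $D\times\mathbb C-C\to D$ is a locally trivial fibration with fibre a $k$-punctured complex line, and (ii) the closure of $C$ in $D\times\mathbb P^1$ is a topological cover of $D$ of degree $k$, which intersects the line at infinity $D\times\{\infty\}$ (necessarily only at $(0,\infty)$) with multiplicity $n$. **Proposition.** Let $m\ge 0$, $n\ge 1$ and let $C\subset D\times\mathbb C$ be an asymptotic germ of fibre degree $m+1$ and pole order $n$. Then for every sufficiently small disc $D'\subset D$ centred at $0$ and every $x_0\in D'-\{0\}$ there are a base point $y_0$ and a geometric basis $b_0,b_1,\dots,b_m$ of the fundamental group of the vertical fibre $\{x_0\}\times\mathbb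 C-C$, with $b_0$ associated to the point of $C$ on the branch going to infinity at $x=0$, such that the images of the $b_i$ give a presentation $$\pi_1(D'\times\mathbb C-C)\;\cong\;\langle b_0,b_1,\dots,b_m\mid (b_1\cdots b_m)^n\,b_0=b_0\,(b_1\cdots b_m)^n\rangle .$$ **Model case.** Let $n\ge1$, let $C_n\subset\mathbb C^2$ be the curve $y(yx^n-1)=0$, and let $x_0\neq0$. For a suitable base point the vertical fibre $\{x_0\}\times\mathbb C-C_n$ has a geometric basis $b_0,b$ with $b_0$ associated to the branch $yx^n=1$ and $b$ to $y=0$; and for every base point and every such geometric basis, the images of $b_0,b$ give a presentation $$\pi_1(\mathbb C^2-C_n)\;\cong\;\langle b_0,b\mid b^n b_0=b_0 b^n\rangle .$$ -/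

import Mathlib

open Set Filter Topology

noncomputable section

namespace AsymptoticGerm

/-! ### Curves in `B × ℂ`, their vertical fibres and their complements -/

/-- The part of `C` in the vertical line over `x`, as a set of points of `ℂ`. -/
def fibre (C : Set (ℂ × ℂ)) (x : ℂ) : Set ℂ := {y | (x, y) ∈ C}

/-- The complement `B × ℂ - C`. -/
def complementOver (B : Set ℂ) (C : Set (ℂ × ℂ)) : Set (ℂ × ℂ) := {p | p.1 ∈ B ∧ p ∉ C}

/-- The projection `B × ℂ - C → B`. -/
def projection (B : Set ℂ) (C : Set (ℂ × ℂ)) : ↥(complementOver B C) → ↥B :=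
  fun p => ⟨p.1.1, p.2.1⟩

/-- The inclusion of the punctured vertical line over `x` in the complement `B × ℂ - C`. -/
def fibreInclusion (B : Set ℂ) (C : Set (ℂ × ℂ)) (x : ℂ) (hx : x ∈ B) :
    C(↥(fibre C x)ᶜ, ↥(complementOver B C)) where
  toFun y := ⟨(x, y.1), hx, y.2⟩
  continuous_toFun := by fun_prop

/-- `C` is a (closed complex analytic) curve in `U × ℂ`: a subset which near every point of
`U × ℂ` is the zero set of a holomorphic function with nonzero germ at that point. -/
def IsCurveIn (U : Set ℂ) (C : Set (ℂ × ℂ)) : Prop :=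
  (∀ p ∈ C, p.1 ∈ U) ∧
  ∀ p : ℂ × ℂ, p.1 ∈ U → ∃ f : ℂ × ℂ → ℂ,
    AnalyticAt ℂ f p ∧ ¬ (f =ᶠ[𝓝 p] 0) ∧ ∀ᶠ q in 𝓝 p, q ∈ C ↔ f q = 0

/-! ### The closure in `D × ℙ¹` and the intersection with the line at infinity -/

/-- The projective closure of `C` in `U × ℙ¹`; here `ℙ¹` is `ℂ ∪ {∞}`. -/
def projectiveClosure (U : Set ℂ) (C : Set (ℂ × ℂ)) : Set (ℂ × OnePoint ℂ) :=
  closure ((fun p : ℂ × ℂ => (p.1, (p.2 : OnePoint ℂ))) '' C) ∩ {p | p.1 ∈ U}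

/-- The affine coordinate `z = 1 / y` of `ℙ¹` near `∞`, as a map `ℂ → ℙ¹`. -/
def chartAtInfinity (z : ℂ) : OnePoint ℂ :=
  open Classical in if z = 0 then OnePoint.infty else ((z⁻¹ : ℂ) : OnePoint ℂ)

/-- `f` is a reduced local equation at `p` of the set `S`: its zero set is `S` near `p`, and it
generates the ideal of the germs of holomorphic functions at `p` that vanish on `S`. -/
def IsReducedEquationAt (S : Set (ℂ × ℂ)) (p : ℂ × ℂ) (f : ℂ × ℂ → ℂ) : Prop :=
  AnalyticAt ℂ f p ∧ (∀ᶠ q in 𝓝 p, q ∈ S ↔ f q = 0) ∧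
  ∀ g : ℂ × ℂ → ℂ, AnalyticAt ℂ g p → (∀ᶠ q in 𝓝 p, q ∈ S → g q = 0) →
    ∃ k : ℂ × ℂ → ℂ, AnalyticAt ℂ k p ∧ g =ᶠ[𝓝 p] f * k

/-- The curve `S` in `U × ℙ¹` has intersection multiplicity `n` at `(x, ∞)` with the line at
infinity `y = ∞`, that is `z = 0`: the restriction to this line of a reduced local equation of `S`
vanishes at `x` to order `n`. -/
def MeetsInfinityWithMultiplicity (S : Set (ℂ × OnePoint ℂ)) (x : ℂ) (n : ℕ) : Prop :=
  ∃ f : ℂ × ℂ → ℂ,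
    IsReducedEquationAt {q | (q.1, chartAtInfinity q.2) ∈ S} (x, 0) f ∧
    analyticOrderAt (fun t : ℂ => f (t, 0)) x = (n : ℕ∞)

/-! ### Asymptotic germs -/

/-- `C ⊂ D × ℂ`, with `D` the disc of radius `R` about `0`, is an asymptotic germ of fibre degree
`k` and pole order `n`. Over a point of the punctured disc all `k` points of the projective closure
are points of `C`, so `(0, ∞)` is the only possible intersection with the line at infinity. -/
structure IsAsymptoticGerm (R : ℝ) (k n : ℕ) (C : Set (ℂ × ℂ)) : Prop where
  radius_pos : 0 < R
  curve : IsCurveIn (Metric.ball 0 R) C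
  /-- the fibres over the punctured disc are `k`-punctured complex lines ... -/
  fibre_card : ∀ x ∈ Metric.ball (0 : ℂ) R \ {0}, (fibre C x).Finite ∧ (fibre C x).ncard = k
  /-- ... and the projection of the complement is locally trivial there -/
  locally_trivial : ∃ P : Finset ℂ, P.card = k ∧
    ∀ x : ↥(Metric.ball (0 : ℂ) R \ {0}),
      ∃ e : Bundle.Trivialization ↥((P : Set ℂ)ᶜ) (projection (Metric.ball (0 : ℂ) R \ {0}) C),
        x ∈ e.baseSet
  /-- the projective closure is a topological cover of the disc ... -/
  covering : IsCoveringMap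
    (fun p : ↥(projectiveClosure (Metric.ball 0 R) C) =>
      (⟨p.1.1, p.2.2⟩ : ↥(Metric.ball (0 : ℂ) R)))
  /-- ... of degree `k` ... -/
  degree : ∀ x ∈ Metric.ball (0 : ℂ) R,
    {w : OnePoint ℂ | (x, w) ∈ projectiveClosure (Metric.ball 0 R) C}.Finite ∧
    {w : OnePoint ℂ | (x, w) ∈ projectiveClosure (Metric.ball 0 R) C}.ncard = k
  /-- ... and it meets the line at infinity with multiplicity `n` -/
  pole_order : MeetsInfinityWithMultiplicity (projectiveClosure (Metric.ball 0 R) C) 0 n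

/-- The puncture `a` of the vertical line over `x` lies on a branch of `C` over the punctured disc
of radius `r` which goes to infinity at `0`. -/
def OnBranchToInfinity (C : Set (ℂ × ℂ)) (r : ℝ) (x a : ℂ) : Prop :=
  ∃ s : ℂ → ℂ, ContinuousOn s (Metric.ball 0 r \ {0}) ∧
    (∀ t ∈ Metric.ball (0 : ℂ) r \ {0}, (t, s t) ∈ C) ∧
    Tendsto s (𝓝[≠] 0) (cocompact ℂ) ∧ s x = a

/-! ### Geometric bases -/

/-- A simple closed curve. -/
def IsSimpleLoop (γ : unitInterval → ℂ) : Prop :=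
  γ 0 = γ 1 ∧ ∀ s t, γ s = γ t → s = t ∨ (s = 0 ∧ t = 1) ∨ (s = 1 ∧ t = 0)

/-- `γ` is isotopic in `ℂ - P`, through simple closed curves, to the positively oriented boundary
of a small disc about the puncture `a`. -/
def IsIsotopicToSmallCircle (P : Set ℂ) (a : ℂ) (γ : unitInterval → ℂ) : Prop :=
  ∃ ε : ℝ, 0 < ε ∧ Metric.closedBall a ε ∩ P = {a} ∧
  ∃ H : unitInterval × unitInterval → ℂ, Continuous H ∧
    (∀ s t, H (s, t) ∉ P) ∧ (∀ s, IsSimpleLoop fun t => H (s, t)) ∧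
    (∀ t, H (0, t) = γ t) ∧ ∀ t, H (1, t) = circleMap a ε (2 * Real.pi * t)

/-- `b` is a geometric basis of the fundamental group of the punctured line `ℂ - P`, its element
`b i` being associated to the puncture `a i`: it is a free basis, consisting of geometric elements
that are simultaneously represented by simple loops disjoint except for the base point. -/
def IsGeometricBasis {ι : Type} (P : Set ℂ) (y₀ : ↥Pᶜ) (a : ι → ℂ)
    (b : ι → FundamentalGroup ↥Pᶜ y₀) : Prop :=
  Function.Bijective (FreeGroup.lift b) ∧
  ∃ γ : ι → Path y₀ y₀,
    (∀ i, b i = FundamentalGroup.fromPath (Path.Homotopic.Quotient.mk (γ i))) ∧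
    (∀ i, IsIsotopicToSmallCircle P (a i) fun t => (γ i t : ℂ)) ∧
    ∀ i j, i ≠ j → ∀ s t, γ i s = γ j t → γ i s = y₀

/-! ### Presentations -/

/-- The images in `π₁(B × ℂ - C)` of the elements `b i` of the fundamental group of the vertical
fibre over `x₀` generate, with the defining relations `rels`. -/
def IsPresentedBy {ι : Type} (B : Set ℂ) (C : Set (ℂ × ℂ)) (x₀ : ℂ) (hx : x₀ ∈ B)
    (y₀ : ↥(fibre C x₀)ᶜ) (b : ι → FundamentalGroup ↥(fibre C x₀)ᶜ y₀)
    (rels : Set (FreeGroup ι)) : Prop :=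
  ∃ φ : PresentedGroup rels ≃*
      FundamentalGroup ↥(complementOver B C) (fibreInclusion B C x₀ hx y₀),
    ∀ i, φ (PresentedGroup.of i) = FundamentalGroup.map (fibreInclusion B C x₀ hx) y₀ (b i)

/-- The relation `(b₁ ⋯ bₘ)ⁿ b₀ = b₀ (b₁ ⋯ bₘ)ⁿ`, written as `u v⁻¹` for `u = v`. -/
def asymptoticRelator (m n : ℕ) : FreeGroup (Fin (m + 1)) :=
  let b : FreeGroup (Fin (m + 1)) := (List.ofFn fun i : Fin m => FreeGroup.of i.succ).prod
  (b ^ n * FreeGroup.of 0) * (FreeGroup.of 0 * b ^ n)⁻¹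

/-- The plane curve `y (y xⁿ - 1) = 0`. -/
def asymptoticCurve (n : ℕ) : Set (ℂ × ℂ) := {p | p.2 * (p.2 * p.1 ^ n - 1) = 0}

/-- The relation `bⁿ b₀ = b₀ bⁿ`, where `b₀` and `b` are the generators `0` and `1`. -/
def modelRelator (n : ℕ) : FreeGroup (Fin 2) :=
  (FreeGroup.of 1 ^ n * FreeGroup.of 0) * (FreeGroup.of 0 * FreeGroup.of 1 ^ n)⁻¹

end AsymptoticGerm

end

/-! Near `x = 0` the germ is, up to a homeomorphism preserving the vertical lines, a union of `m`
constant branches `y = c i` and of one branch `q(x) y = 1` with `q(x) = xⁿ exp (ℓ x)`. The covering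
property gives `m + 1` continuous branches, the multiplicity `n` at infinity gives the factor `xⁿ`
(`IsReducedEquationAt.exists_tendsto_div_pow`, `IsAsymptoticGerm.exists_normalForm`), and a shear
straightens the finite branches (`exists_hasKitePresentation_of_branches`).

For this normal form the complement is covered by `A`, where `q(x) y` is off the ray `[1, ∞)`, and
`W`, where `Re (q(x) y) > 1`. The part `A` can be pushed into the fibre over `x₀`, onto a plane
without the points `c i`; its group is free on `b₁, …, bₘ`. In the coordinates `(q(x) y, x)` the
part `W` is a half-plane times a punctured disc, so its group is infinite cyclic, generated by the
loop `turn` on which `q(x) y` is constant while `x` goes once around `0`. The intersection of `A`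
and `W` has two pieces, above and below the ray, each carrying the same cyclic group. Hence the
group of the complement is an HNN extension of the free group, whose stable letter `b₀` commutes
with the class of `turn`. Along `turn` the coordinate `y` is a constant divided by `q(x)` and winds
`-n` times around all the `c i`, so that this class is `(b₁ ⋯ bₘ)⁻ⁿ`: this is the relation.

The two halves of the statement are proved by hand. Every loop can be moved into the fibre
(`exists_fibre_loop`). That there are no further relations is shown by a functional on path classes
(`Holonomy`) with values in the presented group, which sends each `bᵢ` to the corresponding
generator (`exists_extension`); it is the monodromy of a covering glued from local frames
(`exists_holonomy`). The same device, applied to the planes slit downwards and upwards from the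
punctures, shows that the group of the punctured line is free (`planar_free`) and computes the
exponent `-n` (`val_circle`, `exists_turn_eq`). The geometric basis consists of thin kites with a
common vertex high above the punctures (`exists_kites`).

In the model case a radial homeomorphism leads to the normal form with one constant branch. An
arbitrary geometric basis is related to the kites by one conjugation for each element. In a free
group of rank two, conjugates of the two basis elements which generate are simultaneously conjugate
to the basis (`exists_simultaneous_conj`), and a common conjugation does not affect the
presentation. -/

open Set Filter Topology

noncomputable section

namespace AsymptoticGerm

/-! ### Path classes -/

section PathClasses

variable {X : Type*} [TopologicalSpace X]

/-- The homotopy class of a path. -/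
notation "hc(" γ ")" => Path.Homotopic.Quotient.mk γ

open Path.Homotopic

/-- The two ways around a singular square agree. -/
theorem square_trans (H : unitInterval × unitInterval → X) (hH : Continuous H) {p q p' q' : X}
    (b : Path p q) (t : Path p' q') (l : Path p p') (r : Path q q')
    (hb : ∀ s, b s = H (0, s)) (ht : ∀ s, t s = H (1, s))
    (hl : ∀ s, l s = H (s, 0)) (hr : ∀ s, r s = H (s, 1)) :
    hc(b).trans hc(r) = hc(l).trans hc(t) := by
  let B : Path ((0, 0) : unitInterval × unitInterval) (0, 1) :=
    { toFun := fun s => (0, s), continuous_toFun := by fun_prop, source' := rfl, target' := rfl }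
  let T : Path ((1, 0) : unitInterval × unitInterval) (1, 1) :=
    { toFun := fun s => (1, s), continuous_toFun := by fun_prop, source' := rfl, target' := rfl }
  let L : Path ((0, 0) : unitInterval × unitInterval) (1, 0) :=
    { toFun := fun s => (s, 0), continuous_toFun := by fun_prop, source' := rfl, target' := rfl }
  let R : Path ((0, 1) : unitInterval × unitInterval) (1, 1) :=
    { toFun := fun s => (s, 1), continuous_toFun := by fun_prop, source' := rfl, target' := rfl }
  have key : (B.trans R).Homotopic (L.trans T) := by
    have : ContractibleSpace unitInterval :=
      (convex_Icc (0 : ℝ) 1).contractibleSpace ⟨0, by simp⟩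
    exact SimplyConnectedSpace.paths_homotopic _ _
  have key2 := key.map ⟨H, hH⟩
  obtain rfl : p = H (0, 0) := by rw [← hb, b.source]
  obtain rfl : q = H (0, 1) := by rw [← hb, b.target]
  obtain rfl : p' = H (1, 0) := by rw [← ht, t.source]
  obtain rfl : q' = H (1, 1) := by rw [← ht, t.target]
  obtain rfl : b = B.map hH := Path.ext (funext hb)
  obtain rfl : t = T.map hH := Path.ext (funext ht)
  obtain rfl : l = L.map hH := Path.ext (funext hl)
  obtain rfl : r = R.map hH := Path.ext (funext hr)
  rw [← Quotient.mk_trans, ← Quotient.mk_trans, Path.Homotopic.Quotient.eq]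
  simpa using key2

theorem mk_subpath_trans {p q : X} (γ : Path p q) (a b c : unitInterval) :
    hc(γ.subpath a b).trans hc(γ.subpath b c) =
      hc(γ.subpath a c) := by
  rw [← Quotient.mk_trans, Path.Homotopic.Quotient.eq]
  exact ⟨Path.Homotopy.subpathTransSubpath γ a b c⟩

/-- A property of path classes which is stable under concatenation holds for all path classes if it
holds for the paths that lie in one member of an open cover. -/
theorem pathClass_induction {ι : Type*} {U : ι → Set X} (hU : ∀ i, IsOpen (U i))
    (hcov : ∀ x, ∃ i, x ∈ U i) {Q : ∀ {p q : X}, Path.Homotopic.Quotient p q → Prop}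
    (hmul : ∀ {p q r : X} (α : Path.Homotopic.Quotient p q) (β : Path.Homotopic.Quotient q r),
      Q α → Q β → Q (α.trans β))
    (hbase : ∀ (i : ι) {p q : X} (γ : Path p q), (∀ t, γ t ∈ U i) → Q hc(γ))
    {p q : X} (α : Path.Homotopic.Quotient p q) : Q α := by
  induction α using Path.Homotopic.Quotient.ind with | mk γ =>
  obtain ⟨t, t0, tmono, ⟨m, hm⟩, ht⟩ := exists_monotone_Icc_subset_open_cover_unitInterval
    (c := fun i => γ ⁻¹' U i) (fun i => (hU i).preimage γ.continuous)
    (fun s _ => by simpa using hcov (γ s))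
  have key : ∀ k, Q hc(γ.subpath (t 0) (t k)) := by
    intro k
    induction k with
    | zero =>
      obtain ⟨i, hi⟩ := hcov (γ (t 0))
      refine hbase i _ fun s => ?_
      simpa using hi
    | succ k ih =>
      rw [← mk_subpath_trans γ (t 0) (t k) (t (k + 1))]
      refine hmul _ _ ih ?_
      obtain ⟨i, hi⟩ := ht k
      refine hbase i _ fun s => ?_
      have : (γ.subpath (t k) (t (k + 1))) s ∈ range (γ.subpath (t k) (t (k + 1))) := ⟨s, rfl⟩
      rw [Path.range_subpath_of_le _ _ _ (tmono (Nat.le_succ k))] at this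
      obtain ⟨u, hu, hu'⟩ := this
      rw [← hu']
      exact hi hu
  have h1 := key m
  rw [t0, hm m le_rfl, Path.subpath_zero_one] at h1
  have gen : ∀ (p' q' : X) (hp : p' = p) (hq : q' = q), Q hc(γ.cast hp hq) →
      Q hc(γ) := by
    rintro _ _ rfl rfl h
    simpa using h
  exact gen _ _ _ _ h1

/-- A functional on path classes with values in a group, multiplicative for the order of
composition used in `FundamentalGroup`. -/
structure Holonomy (X : Type*) [TopologicalSpace X] (H : Type*) [Group H] where
  /-- the value on a path class -/
  val : ∀ {p q : X}, Path.Homotopic.Quotient p q → H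
  val_trans : ∀ {p q r : X} (α : Path.Homotopic.Quotient p q) (β : Path.Homotopic.Quotient q r),
    val (α.trans β) = val β * val α

namespace Holonomy

variable {H : Type*} [Group H] (φ : Holonomy X H)

@[simp] theorem val_refl (p : X) : φ.val (Quotient.refl p) = 1 := by
  have := φ.val_trans (Quotient.refl p) (Quotient.refl p)
  rw [Quotient.refl_trans] at this
  simpa using this

@[simp] theorem val_symm {p q : X} (α : Path.Homotopic.Quotient p q) :
    φ.val α.symm = (φ.val α)⁻¹ := by
  have := φ.val_trans α α.symm
  rw [Quotient.trans_symm, val_refl] at this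
  exact (inv_eq_of_mul_eq_one_left this.symm).symm

/-- The induced homomorphism on the fundamental group. -/
def toHom (p : X) : FundamentalGroup X p →* H where
  toFun α := φ.val α
  map_one' := φ.val_refl p
  map_mul' α β := φ.val_trans β α

/-- The pull-back of a functional under a continuous map. -/
def pullback {Y : Type*} [TopologicalSpace Y] (f : C(Y, X)) : Holonomy Y H where
  val α := φ.val (α.map f)
  val_trans α β := by
    induction α using Path.Homotopic.Quotient.ind with | mk α =>
    induction β using Path.Homotopic.Quotient.ind with | mk β =>
    rw [← φ.val_trans, ← Quotient.mk_trans, ← Quotient.mk_map, Path.map_trans]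
    rfl

end Holonomy

/-! ### Holonomy glued from local frames -/

section Frames

variable {H : Type*} [Group H] {ι : Type*} (U : ι → Set X) (f : ι → X → H)

/-- The covering with fibre `H` glued from local frames with locally constant transitions. -/
def frameCore [TopologicalSpace H] [DiscreteTopology H] (hU : ∀ i, IsOpen (U i))
    (idx : X → ι) (hidx : ∀ x, x ∈ U (idx x))
    (hf : ∀ i j, ∀ x ∈ U i ∩ U j, ∀ᶠ y in 𝓝 x, (f i y)⁻¹ * f j y = (f i x)⁻¹ * f j x) :
    FiberBundleCore ι X H where
  baseSet := U
  isOpen_baseSet := hU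
  indexAt := idx
  mem_baseSet_at := hidx
  coordChange i j x v := (f j x)⁻¹ * f i x * v
  coordChange_self i x _ v := by simp
  continuousOn_coordChange i j := by
    rintro ⟨x, v⟩ ⟨hx, -⟩
    apply ContinuousAt.continuousWithinAt
    have h1 : ∀ᶠ y in 𝓝 (x, v), (f j y.1)⁻¹ * f i y.1 * y.2 = (f j x)⁻¹ * f i x * y.2 := by
      filter_upwards [continuousAt_fst.eventually (hf j i x hx.symm)] with y hy
      rw [hy]
    refine ContinuousAt.congr ?_ (h1.mono fun y hy => hy.symm)
    exact (continuous_of_discreteTopology (f := fun w : H => (f j x)⁻¹ * f i x * w)).continuousAt.comp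
      continuousAt_snd
  coordChange_comp i j k x _ v := by group

/-- Local frames with locally constant transitions define a functional on path classes. -/
theorem exists_holonomy (hU : ∀ i, IsOpen (U i)) (hcov : ∀ x, ∃ i, x ∈ U i)
    (hf : ∀ i j, ∀ x ∈ U i ∩ U j, ∀ᶠ y in 𝓝 x, (f i y)⁻¹ * f j y = (f i x)⁻¹ * f j x) :
    ∃ φ : Holonomy X H, ∀ (i : ι) {p q : X} (γ : Path p q), (∀ t, γ t ∈ U i) →
      φ.val hc(γ) = f i q * (f i p)⁻¹ := by
  let _ : TopologicalSpace H := ⊥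
  have : DiscreteTopology H := ⟨rfl⟩
  choose idx hidx using hcov
  let Z := frameCore U f hU idx hidx hf
  have cov : IsCoveringMap (Bundle.TotalSpace.proj : Bundle.TotalSpace H Z.Fiber → X) :=
    FiberBundle.isCoveringMap
  let elt : X → H → Bundle.TotalSpace H Z.Fiber := fun p h => ⟨p, ((f (idx p) p)⁻¹ * h : H)⟩
  -- The product `f i x * v` is the same in all charts `i`, because of the form of the coordinate
  -- changes. It labels the points of the covering over `x` by elements of `H`.
  let height : Bundle.TotalSpace H Z.Fiber → H := fun e => @HMul.hMul H H H _ (f (idx e.1) e.1) e.2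
  have height_elt : ∀ p h, height (elt p h) = h := fun p h => by simp [height, elt]
  have elt_height : ∀ e, elt e.1 (height e) = e := by
    rintro ⟨p, v⟩
    change (⟨p, _⟩ : Bundle.TotalSpace H Z.Fiber) = ⟨p, v⟩
    congr 1
    exact inv_mul_cancel_left (f (idx p) p) (v : H)
  let T : ∀ {p q : X}, Path.Homotopic.Quotient p q → H → H := fun {p q} α h =>
    height (cov.monodromy α ⟨elt p h, rfl⟩).1
  have T_trans : ∀ {p q r : X} (α : Path.Homotopic.Quotient p q)
      (β : Path.Homotopic.Quotient q r) (h : H), T (α.trans β) h = T β (T α h) := by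
    intro p q r α β h
    simp only [T]
    rw [cov.monodromy_trans_apply]
    congr 3
    apply Subtype.ext
    have h1 := (cov.monodromy α ⟨elt p h, rfl⟩).2
    have h2 := elt_height (cov.monodromy α ⟨elt p h, rfl⟩).1
    rw [← h2]
    simp only [height_elt]
    congr 1
  have T_base : ∀ (i : ι) {p q : X} (γ : Path p q), (∀ t, γ t ∈ U i) → ∀ h,
      T hc(γ) h = f i q * (f i p)⁻¹ * h := by
    intro i p q γ hγ h
    -- In the chart `i` a lift has constant coordinate `(f i p)⁻¹ * h`, so its height at `q` is `f i
    -- q * (f i p)⁻¹ * h`.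
    let Γ : unitInterval → Bundle.TotalSpace H Z.Fiber := fun t =>
      (Z.localTriv i).toOpenPartialHomeomorph.symm (γ t, (f i p)⁻¹ * h)
    have Γ_apply : ∀ t, Γ t = elt (γ t) (f i (γ t) * ((f i p)⁻¹ * h)) := by
      intro t
      change (Z.localTriv i).toOpenPartialHomeomorph.symm (γ t, (f i p)⁻¹ * h) = _
      rw [Z.localTriv_symm_apply]
      simp only [elt]
      congr 1
      exact mul_assoc (G := H) _ _ _
    have hΓ : Γ = cov.liftPath γ (elt p h) (by simp [elt]) := by
      rw [cov.eq_liftPath_iff]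
      refine ⟨?_, ?_, ?_⟩
      · refine (Z.localTriv i).toOpenPartialHomeomorph.continuousOn_symm.comp_continuous
          (by fun_prop) fun t => ?_
        rw [Z.mem_localTriv_target]
        exact hγ t
      · funext t
        simp [Γ_apply, elt]
      · rw [Γ_apply]
        simp
    have h1 : (cov.monodromy hc(γ) ⟨elt p h, rfl⟩).1 = Γ 1 := by
      rw [hΓ]
      rfl
    simp only [T]
    rw [h1, Γ_apply, height_elt, γ.target, mul_assoc]
  -- Transport of heights commutes with right multiplication, so it is left multiplication by its
  -- value at `1`; this makes the value of a concatenation a product.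
  have T_mul : ∀ {p q : X} (α : Path.Homotopic.Quotient p q), ∀ h, T α h = T α 1 * h := by
    intro p q α
    refine pathClass_induction (Q := fun α => ∀ h, T α h = T α 1 * h) hU
      (fun x => ⟨idx x, hidx x⟩) ?_ ?_ α
    · intro p q r α β hα hβ h
      rw [T_trans, T_trans, hβ, hα, hβ (T α 1), mul_assoc]
    · intro i p q γ hγ h
      rw [T_base i γ hγ, T_base i γ hγ, mul_one]
  refine ⟨⟨fun α => T α 1, fun α β => ?_⟩, fun i p q γ hγ => ?_⟩
  · rw [T_trans, T_mul]
  · exact (T_base i γ hγ 1).trans (mul_one _)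

end Frames
end PathClasses

/-! ### Paths in subsets -/

section SubsetPaths

variable {E : Type*} [TopologicalSpace E] {S : Set E}

/-- A path in a subset, given by a map to the ambient space. -/
def subsetPath (f : unitInterval → E) (hf : Continuous f) (hS : ∀ t, f t ∈ S) {p q : ↥S}
    (h0 : f 0 = p) (h1 : f 1 = q) : Path p q where
  toFun t := ⟨f t, hS t⟩
  continuous_toFun := by fun_prop
  source' := Subtype.ext h0
  target' := Subtype.ext h1

@[simp] theorem subsetPath_apply (f : unitInterval → E) (hf : Continuous f) (hS : ∀ t, f t ∈ S)
    {p q : ↥S} (h0 : f 0 = p) (h1 : f 1 = q) (t : unitInterval) :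
    ((subsetPath f hf hS h0 h1 t : ↥S) : E) = f t := rfl

/-- The square relation for a singular square in a subset. -/
theorem square_trans_subset (H : unitInterval × unitInterval → E) (hH : Continuous H)
    (hS : ∀ x, H x ∈ S) {p q p' q' : ↥S}
    (b : Path p q) (t : Path p' q') (l : Path p p') (r : Path q q')
    (hb : ∀ s, (b s : E) = H (0, s)) (ht : ∀ s, (t s : E) = H (1, s))
    (hl : ∀ s, (l s : E) = H (s, 0)) (hr : ∀ s, (r s : E) = H (s, 1)) :
    hc(b).trans hc(r) = hc(l).trans hc(t) :=
  square_trans (fun x => (⟨H x, hS x⟩ : ↥S)) (by fun_prop) b t l r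
    (fun s => Subtype.ext (hb s)) (fun s => Subtype.ext (ht s))
    (fun s => Subtype.ext (hl s)) (fun s => Subtype.ext (hr s))

/-- Two paths with common ends are homotopic if they are joined by a singular square with constant
sides. -/
theorem hc_eq_of_square (H : unitInterval × unitInterval → E) (hH : Continuous H)
    (hS : ∀ x, H x ∈ S) {p q : ↥S} (b t : Path p q)
    (hb : ∀ s, (b s : E) = H (0, s)) (ht : ∀ s, (t s : E) = H (1, s))
    (hl : ∀ s, H (s, 0) = p) (hr : ∀ s, H (s, 1) = q) : hc(b) = hc(t) := by
  have := square_trans_subset H hH hS b t (Path.refl p) (Path.refl q) hb ht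
    (fun s => (hl s).symm) (fun s => (hr s).symm)
  simpa using this

theorem hc_eq_of_segment {E : Type*} [NormedAddCommGroup E] [NormedSpace ℝ E] {S : Set E}
    {p q : ↥S} (b t : Path p q)
    (h : ∀ s u : unitInterval, (1 - (s : ℝ)) • (b u : E) + (s : ℝ) • (t u : E) ∈ S) :
    hc(b) = hc(t) := by
  refine hc_eq_of_square (fun x : unitInterval × unitInterval =>
    (1 - (x.1 : ℝ)) • (b x.2 : E) + (x.1 : ℝ) • (t x.2 : E)) (by fun_prop) (fun x => h _ _) b t
    (fun s => by simp) (fun s => by simp) (fun s => ?_) fun s => ?_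
  · simp [← add_smul]
  · simp [← add_smul]

/-- The straight path between two points. -/
def segmentPath {E : Type*} [NormedAddCommGroup E] [NormedSpace ℝ E] {S : Set E}
    (p q : ↥S) (h : ∀ s : unitInterval, (1 - (s : ℝ)) • (p : E) + (s : ℝ) • (q : E) ∈ S) :
    Path p q :=
  subsetPath (fun s => (1 - (s : ℝ)) • (p : E) + (s : ℝ) • (q : E)) (by fun_prop) h
    (by simp) (by simp)

theorem hc_eq_of_isSimplyConnected {U : Set E} (hU : IsSimplyConnected U)
    {p q : ↥S} (γ γ' : Path p q) (h : ∀ t, (γ t : E) ∈ U) (h' : ∀ t, (γ' t : E) ∈ U)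
    (hUS : U ⊆ S) : hc(γ) = hc(γ') := by
  have := hU.simplyConnectedSpace
  let p' : ↥U := ⟨p, by simpa using h 0⟩
  let q' : ↥U := ⟨q, by simpa using h 1⟩
  let δ : Path p' q' := subsetPath (fun t => (γ t : E)) (by fun_prop) h (by simp [p']) (by simp [q'])
  let δ' : Path p' q' :=
    subsetPath (fun t => (γ' t : E)) (by fun_prop) h' (by simp [p']) (by simp [q'])
  have h1 := (SimplyConnectedSpace.paths_homotopic δ δ').map
    (⟨inclusion hUS, continuous_inclusion hUS⟩ : C(↥U, ↥S))
  exact Path.Homotopic.Quotient.eq.mpr h1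

theorem exists_path_of_isSimplyConnected {U : Set E} (hU : IsSimplyConnected U) (hUS : U ⊆ S)
    {p q : ↥S} (hp : (p : E) ∈ U) (hq : (q : E) ∈ U) : ∃ γ : Path p q, ∀ t, (γ t : E) ∈ U := by
  have := hU.simplyConnectedSpace
  let δ := PathConnectedSpace.somePath (⟨p, hp⟩ : ↥U) ⟨q, hq⟩
  exact ⟨δ.map (continuous_inclusion hUS), fun t => (δ t).2⟩

end SubsetPaths

/-! ### Slit planes -/

open ComplexConjugate in
/-- A set which is stable under translation in a direction and contains a half-plane in this
direction is simply connected. -/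
theorem isSimplyConnected_of_translation {U : Set ℂ} {d : ℂ} (hd : ‖d‖ = 1)
    (push : ∀ y ∈ U, ∀ s : ℝ, 0 ≤ s → y + s * d ∈ U)
    {c : ℝ} (far : ∀ y : ℂ, c < (y * conj d).re → y ∈ U) : IsSimplyConnected U := by
  have hdd : ∀ (y : ℂ) (s : ℝ), ((y + s * d) * conj d).re = (y * conj d).re + s := by
    intro y s
    have : (y + s * d) * conj d = y * conj d + s * (d * conj d) := by ring
    rw [this, Complex.mul_conj, Complex.normSq_eq_norm_sq, hd]
    simp
  have conv : ∀ (y y' : ℂ) (s : unitInterval), c < (y * conj d).re → c < (y' * conj d).re →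
      (1 - (s : ℝ)) • y + (s : ℝ) • y' ∈ U := by
    intro y y' s hy hy'
    apply far
    have : (((1 - (s : ℝ)) • y + (s : ℝ) • y') * conj d).re =
        (1 - s) * (y * conj d).re + s * (y' * conj d).re := by
      simp only [Complex.real_smul, add_mul, Complex.add_re, mul_assoc, Complex.re_ofReal_mul]
    rw [this]
    rcases eq_or_lt_of_le s.2.1 with h | h
    · rw [← h]; linarith
    · have h1 : (0 : ℝ) ≤ 1 - s := by linarith [s.2.2]
      nlinarith [mul_le_mul_of_nonneg_left hy.le h1, mul_lt_mul_of_pos_left hy' h]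
  have up : ∀ (p : ↥U) (L : ℝ), 0 ≤ L → ∀ s : unitInterval, (p : ℂ) + ((s : ℝ) * L : ℝ) * d ∈ U :=
    fun p L hL s => push _ p.2 _ (mul_nonneg s.2.1 hL)
  rw [IsSimplyConnected, simply_connected_iff_paths_homotopic']
  refine ⟨⟨⟨⟨((|c| + 1 : ℝ) : ℂ) * d, far _ ?_⟩⟩, fun p q => ?_⟩, fun {p q} γ γ' => ?_⟩
  · have := hdd 0 (|c| + 1)
    rw [zero_add] at this
    rw [this]
    simp
    linarith [le_abs_self c]
  · obtain ⟨L, hL0, hLp, hLq⟩ : ∃ L : ℝ, 0 ≤ L ∧ c < ((p : ℂ) * conj d).re + L ∧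
        c < ((q : ℂ) * conj d).re + L := by
      refine ⟨|c - ((p : ℂ) * conj d).re| + |c - ((q : ℂ) * conj d).re| + 1, by positivity, ?_, ?_⟩
      · linarith [le_abs_self (c - ((p : ℂ) * conj d).re), abs_nonneg (c - ((q : ℂ) * conj d).re)]
      · linarith [le_abs_self (c - ((q : ℂ) * conj d).re), abs_nonneg (c - ((p : ℂ) * conj d).re)]
    have vert : ∀ p : ↥U, Joined p ⟨(p : ℂ) + L * d, push _ p.2 _ hL0⟩ := fun p =>
      ⟨subsetPath (fun s => (p : ℂ) + ((s : ℝ) * L : ℝ) * d) (by fun_prop) (up p L hL0)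
        (by simp) (by simp)⟩
    refine (vert p).trans (Joined.trans ?_ (vert q).symm)
    refine ⟨segmentPath _ _ fun s => conv _ _ s ?_ ?_⟩
    · rw [hdd]; exact hLp
    · rw [hdd]; exact hLq
  · rw [← Path.Homotopic.Quotient.eq]
    -- By compactness one translation length carries both paths into the convex half-plane, where
    -- the segment homotopy is available.
    obtain ⟨L, hL0, hL⟩ : ∃ L : ℝ, 0 ≤ L ∧ ∀ t, c < ((γ t : ℂ) * conj d).re + L ∧
        c < ((γ' t : ℂ) * conj d).re + L := by
      obtain ⟨m, hm⟩ := (isCompact_range (f := fun t => ((γ t : ℂ) * conj d).re)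
        (by fun_prop)).bddBelow
      obtain ⟨m', hm'⟩ := (isCompact_range (f := fun t => ((γ' t : ℂ) * conj d).re)
        (by fun_prop)).bddBelow
      refine ⟨|c - m| + |c - m'| + 1, by positivity, fun t => ⟨?_, ?_⟩⟩
      · have := hm ⟨t, rfl⟩
        simp only at this
        linarith [le_abs_self (c - m), abs_nonneg (c - m')]
      · have := hm' ⟨t, rfl⟩
        simp only at this
        linarith [le_abs_self (c - m'), abs_nonneg (c - m)]
    let v : ∀ p : ↥U, Path p ⟨(p : ℂ) + L * d, push _ p.2 _ hL0⟩ := fun p =>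
      subsetPath (fun s => (p : ℂ) + ((s : ℝ) * L : ℝ) * d) (by fun_prop) (up p L hL0)
        (by simp) (by simp)
    let w : ∀ {p q : ↥U} (γ : Path p q), Path (⟨(p : ℂ) + L * d, push _ p.2 _ hL0⟩ : ↥U)
        ⟨(q : ℂ) + L * d, push _ q.2 _ hL0⟩ := fun {p q} γ =>
      subsetPath (fun t => (γ t : ℂ) + L * d) (by fun_prop) (fun t => push _ (γ t).2 _ hL0)
        (by simp) (by simp)
    have sq : ∀ γ : Path p q, hc(γ).trans hc(v q) = hc(v p).trans hc(w γ) := fun γ =>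
      square_trans_subset
        (fun x : unitInterval × unitInterval => (γ x.2 : ℂ) + ((x.1 : ℝ) * L : ℝ) * d)
        (by fun_prop) (fun x => up _ L hL0 _) γ (w γ) (v p) (v q) (fun s => by simp)
        (fun s => by simp [w]) (fun s => by simp [v]) (fun s => by simp [v])
    have eqw : hc(w γ) = hc(w γ') := hc_eq_of_segment _ _ fun s u => by
      refine conv _ _ s ?_ ?_
      · simp only [w, subsetPath_apply]; rw [hdd]; exact (hL u).1
      · simp only [w, subsetPath_apply]; rw [hdd]; exact (hL u).2
    have h1 := sq γ
    rw [eqw, ← sq γ'] at h1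
    have h2 := congrArg (fun α => Path.Homotopic.Quotient.trans α hc(v q).symm) h1
    simpa using h2

section Slits

variable {k : ℕ} (a : Fin k → ℂ)

/-- The plane slit along the closed downward rays from the points `a i`. -/
def slitDown : Set ℂ := {y | ∀ i, ¬ (y.re = (a i).re ∧ y.im ≤ (a i).im)}

/-- The plane slit along the closed upward rays from the points `a i`. -/
def slitUp : Set ℂ := {y | ∀ i, ¬ (y.re = (a i).re ∧ (a i).im ≤ y.im)}

theorem slitDown_subset : slitDown a ⊆ (range a)ᶜ := by
  rintro _ hy ⟨i, rfl⟩
  exact hy i ⟨rfl, le_rfl⟩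

theorem slitUp_subset : slitUp a ⊆ (range a)ᶜ := by
  rintro _ hy ⟨i, rfl⟩
  exact hy i ⟨rfl, le_rfl⟩

theorem exists_abs_bound (g : Fin k → ℝ) : ∃ c : ℝ, 0 ≤ c ∧ ∀ i, |g i| ≤ c :=
  ⟨∑ i, |g i|, by positivity,
    fun i => Finset.single_le_sum (f := fun i => |g i|) (fun _ _ => abs_nonneg _)
      (Finset.mem_univ i)⟩

theorem isSimplyConnected_slitDown : IsSimplyConnected (slitDown a) := by
  obtain ⟨c, -, hc⟩ := exists_abs_bound fun i => (a i).im
  refine isSimplyConnected_of_translation (d := Complex.I) (by simp) ?_ (c := c) ?_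
  · intro y hy s hs i hi
    refine hy i ⟨by simpa using hi.1, ?_⟩
    have := hi.2
    simp at this
    linarith
  · intro y hy i hi
    have : c < y.im := by simpa using hy
    linarith [hi.2, le_abs_self (a i).im, hc i]

theorem isSimplyConnected_slitUp : IsSimplyConnected (slitUp a) := by
  obtain ⟨c, -, hc⟩ := exists_abs_bound fun i => (a i).im
  refine isSimplyConnected_of_translation (d := -Complex.I) (by simp) ?_ (c := c) ?_
  · intro y hy s hs i hi
    refine hy i ⟨by simpa using hi.1, ?_⟩
    have := hi.2
    simp at this
    linarith
  · intro y hy i hi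
    have : c < -y.im := by simpa using hy
    linarith [hi.2, neg_abs_le (a i).im, hc i]

/-- No point `a i` lies, as to its real part, between `y` and `y'`. -/
def SameStrip (y y' : ℂ) : Prop :=
  ∀ i, ((a i).re < y.re ∧ (a i).re < y'.re) ∨ (y.re < (a i).re ∧ y'.re < (a i).re)

variable {a}

theorem SameStrip.segment {y y' : ℂ} (h : SameStrip a y y') (s : unitInterval) (i : Fin k) :
    ((1 - (s : ℝ)) • y + (s : ℝ) • y').re ≠ (a i).re := by
  have h1 : ((1 - (s : ℝ)) • y + (s : ℝ) • y').re = (1 - s) * y.re + s * y'.re := by simp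
  rw [h1]
  have h0 := s.2.1
  have h2 := s.2.2
  rcases h i with ⟨h3, h4⟩ | ⟨h3, h4⟩
  · rcases eq_or_lt_of_le h0 with h | h
    · rw [← h]; simp; linarith
    · nlinarith [mul_le_mul_of_nonneg_left h3.le (by linarith : (0 : ℝ) ≤ 1 - s),
        mul_lt_mul_of_pos_left h4 h]
  · rcases eq_or_lt_of_le h0 with h | h
    · rw [← h]; simp; linarith
    · nlinarith [mul_le_mul_of_nonneg_left h3.le (by linarith : (0 : ℝ) ≤ 1 - s),
        mul_lt_mul_of_pos_left h4 h]

variable {H : Type*} [Group H]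

/-- The ordered product of the labels of the points to the left of `y`. -/
def leftProduct (a : Fin k → ℂ) (h : Fin k → H) (y : ℂ) : H :=
  (List.ofFn fun i => open Classical in if (a i).re < y.re then h i else 1).prod

theorem SameStrip.leftProduct_eq {y y' : ℂ} (hs : SameStrip a y y') (h : Fin k → H) :
    leftProduct a h y = leftProduct a h y' := by
  unfold leftProduct
  congr 2
  funext i
  have := hs i
  by_cases h1 : (a i).re < y.re
  · have h2 : (a i).re < y'.re := by rcases this with h | h <;> linarith [h.1, h.2]
    simp [h1, h2]
  · have h2 : ¬ (a i).re < y'.re := by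
      rcases this with h | h
      · exact absurd h.1 h1
      · linarith [h.2]
    simp [h1, h2]

/-- Only the `i`-th factors differ and all earlier ones are trivial, so `g i` can be taken out in
front. -/
theorem prod_ofFn_eq_mul {k : ℕ} (g g' : Fin k → H) (i : Fin k) (hlt : ∀ j < i, g j = 1)
    (hi : g' i = 1) (hne : ∀ j ≠ i, g j = g' j) :
    (List.ofFn g).prod = g i * (List.ofFn g').prod := by
  induction k with
  | zero => exact i.elim0
  | succ k ih =>
    rw [List.ofFn_succ, List.ofFn_succ, List.prod_cons, List.prod_cons]
    induction i using Fin.cases with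
    | zero =>
      rw [hi, one_mul]
      congr 3
      funext j
      exact hne _ (Fin.succ_ne_zero j)
    | succ i =>
      rw [hlt 0 (Fin.succ_pos i), ← hne 0 (Fin.succ_ne_zero i).symm, hlt 0 (Fin.succ_pos i),
        one_mul, one_mul]
      exact ih (fun j => g j.succ) (fun j => g' j.succ) i
        (fun j hj => hlt _ (Fin.succ_lt_succ_iff.mpr hj)) hi
        (fun j hj => hne _ (by simpa using hj))

/-- `y` and `y'` lie on the left and on the right of `a i`, and of no other of the points. -/
def StraddlesOnly (a : Fin k → ℂ) (i : Fin k) (y y' : ℂ) : Prop :=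
  y.re < (a i).re ∧ (a i).re < y'.re ∧
    ∀ j ≠ i, ((a j).re < y.re ∧ (a j).re < y'.re) ∨ (y.re < (a j).re ∧ y'.re < (a j).re)

/-- Indices below `i` belong to points further to the right, which count neither for `y` nor for
`y'`. The product for `y'` therefore begins with `h i` and continues as the product for `y`. -/
theorem StraddlesOnly.leftProduct_eq (ha : StrictAnti fun i => (a i).re) {i : Fin k} {y y' : ℂ}
    (hs : StraddlesOnly a i y y') (h : Fin k → H) :
    leftProduct a h y' = h i * leftProduct a h y := by
  unfold leftProduct
  rw [prod_ofFn_eq_mul _ (fun i => open Classical in if (a i).re < y.re then h i else 1) i]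
  · rw [if_pos hs.2.1]
  · intro j hj
    have h1 := ha hj
    simp only at h1
    rw [if_neg]
    rcases hs.2.2 j hj.ne with h2 | h2
    · linarith [h2.1, h2.2, hs.1, hs.2.1]
    · linarith [h2.1, h2.2, hs.1, hs.2.1]
  · rw [if_neg]
    linarith [hs.1]
  · intro j hj
    rcases hs.2.2 j hj with h2 | h2
    · rw [if_pos h2.1, if_pos h2.2]
    · rw [if_neg (by linarith [h2.2]), if_neg (by linarith [h2.1])]

theorem sameStrip_self_eventually {y : ℂ} (hy : ∀ i, y.re ≠ (a i).re) :
    ∀ᶠ y' in 𝓝 y, SameStrip a y' y := by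
  unfold SameStrip
  rw [eventually_all]
  intro i
  rcases lt_or_gt_of_ne (hy i) with h | h
  · filter_upwards [Complex.continuous_re.continuousAt.eventually (gt_mem_nhds h)] with y' h'
    exact Or.inr ⟨h', h⟩
  · filter_upwards [Complex.continuous_re.continuousAt.eventually (lt_mem_nhds h)] with y' h'
    exact Or.inl ⟨h', h⟩

theorem isOpen_slitDown : IsOpen (slitDown a) := by
  have : slitDown a = ⋂ i, {y : ℂ | y.re = (a i).re ∧ y.im ≤ (a i).im}ᶜ := by
    ext y; simp [slitDown]
  rw [this]
  refine isOpen_iInter_of_finite fun i => IsClosed.isOpen_compl (self := ?_)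
  exact (isClosed_eq Complex.continuous_re continuous_const).inter
    (isClosed_le Complex.continuous_im continuous_const)

theorem isOpen_slitUp : IsOpen (slitUp a) := by
  have : slitUp a = ⋂ i, {y : ℂ | y.re = (a i).re ∧ (a i).im ≤ y.im}ᶜ := by
    ext y; simp [slitUp]
  rw [this]
  refine isOpen_iInter_of_finite fun i => IsClosed.isOpen_compl (self := ?_)
  exact (isClosed_eq Complex.continuous_re continuous_const).inter
    (isClosed_le continuous_const Complex.continuous_im)

theorem re_ne_of_mem_slits {y : ℂ} (h : y ∈ slitDown a) (h' : y ∈ slitUp a) (i : Fin k) :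
    y.re ≠ (a i).re := by
  intro hi
  rcases le_total y.im (a i).im with h1 | h1
  · exact h i ⟨hi, h1⟩
  · exact h' i ⟨hi, h1⟩

theorem mem_slits_of_re_ne {y : ℂ} (h : ∀ i, y.re ≠ (a i).re) :
    y ∈ slitDown a ∧ y ∈ slitUp a :=
  ⟨fun i hi => h i hi.1, fun i hi => h i hi.1⟩

theorem mem_slitUp_of_notMem_slitDown (ha : StrictAnti fun i => (a i).re) {y : ℂ}
    (hy : y ∈ (range a)ᶜ) (h : y ∉ slitDown a) : y ∈ slitUp a := by
  simp only [slitDown, mem_ofPred_eq, not_forall, not_not] at h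
  obtain ⟨i, hi, hi'⟩ := h
  intro j hj
  obtain rfl : i = j := ha.injective (hi.symm.trans hj.1)
  exact hy ⟨i, (Complex.ext hi (le_antisymm hi' hj.2)).symm⟩

/-- The frames are `1` on `slitDown a` and `leftProduct a h` on `slitUp a`. The two slit planes meet
in the open vertical strips between the points, where `leftProduct` is locally constant. In this
holonomy passing below `a i` from left to right contributes `h i`, and passing above contributes
nothing. -/
theorem exists_planar_holonomy (ha : StrictAnti fun i => (a i).re) (h : Fin k → H) :
    ∃ φ : Holonomy ↥(range a)ᶜ H,
      (∀ {p q : ↥(range a)ᶜ} (γ : Path p q), (∀ t, (γ t : ℂ) ∈ slitDown a) → φ.val hc(γ) = 1) ∧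
      ∀ {p q : ↥(range a)ᶜ} (γ : Path p q), (∀ t, (γ t : ℂ) ∈ slitUp a) →
        φ.val hc(γ) = leftProduct a h q * (leftProduct a h p)⁻¹ := by
  have key : ∀ y : ↥(range a)ᶜ, (y : ℂ) ∈ slitDown a → (y : ℂ) ∈ slitUp a →
      ∀ᶠ y' : ↥(range a)ᶜ in 𝓝 y, leftProduct a h y' = leftProduct a h y := by
    intro y h1 h2
    filter_upwards [continuous_subtype_val.continuousAt.eventually
      (sameStrip_self_eventually (re_ne_of_mem_slits h1 h2))] with y' hy'
    exact hy'.leftProduct_eq h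
  have main := exists_holonomy
    (fun b : Bool => ((↑) : ↥(range a)ᶜ → ℂ) ⁻¹' (if b then slitDown a else slitUp a))
    (fun b y => if b then 1 else leftProduct a h y)
    (by
      rintro (b | b)
      · exact isOpen_slitUp.preimage continuous_subtype_val
      · exact isOpen_slitDown.preimage continuous_subtype_val)
    (by
      intro y
      by_cases hy : (y : ℂ) ∈ slitDown a
      · exact ⟨true, hy⟩
      · exact ⟨false, mem_slitUp_of_notMem_slitDown ha y.2 hy⟩)
    (by
      rintro (b | b) (b' | b') y ⟨hy, hy'⟩
      · simp
      · filter_upwards [key y hy' hy] with y' h'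
        simp [h']
      · filter_upwards [key y hy hy'] with y' h'
        simp [h']
      · simp)
  obtain ⟨φ, hφ⟩ := main
  refine ⟨φ, fun γ hγ => ?_, fun γ hγ => ?_⟩
  · simpa using hφ true γ hγ
  · simpa using hφ false γ hγ

end Slits

/-! ### Splitting paths -/

section Splitting

variable {X : Type*} [TopologicalSpace X] {p q : X}

/-- The part of a path before a parameter. -/
def initialPart (γ : Path p q) (s : unitInterval) : Path p (γ s) :=
  (γ.subpath 0 s).cast γ.source.symm rfl

/-- The part of a path after a parameter. -/
def finalPart (γ : Path p q) (s : unitInterval) : Path (γ s) q :=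
  (γ.subpath s 1).cast rfl γ.target.symm

theorem hc_split (γ : Path p q) (s : unitInterval) :
    hc(γ) = hc(initialPart γ s).trans hc(finalPart γ s) := by
  have gen : ∀ (p' q' : X) (hp : p' = p) (hq : q' = q) (m : X) (α : Path p' m) (β : Path m q')
      (_ : hc(α).trans hc(β) = hc(γ.cast hp hq)),
      hc(γ) = hc(α.cast hp.symm rfl).trans hc(β.cast rfl hq.symm) := by
    rintro _ _ rfl rfl m α β h
    simpa using h.symm
  refine gen _ _ γ.source γ.target _ (γ.subpath 0 s) (γ.subpath s 1) ?_
  rw [mk_subpath_trans, Path.subpath_zero_one]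

theorem hc_split₂ (γ : Path p q) (s t : unitInterval) :
    hc(γ) = hc(initialPart γ s).trans (hc(γ.subpath s t).trans hc(finalPart γ t)) := by
  have gen : ∀ (q' : X) (hq : q' = q) (m m' : X) (α : Path m q') (β : Path m m') (δ : Path m' q')
      (_ : hc(β).trans hc(δ) = hc(α)),
      hc(α.cast rfl hq.symm) = hc(β).trans hc(δ.cast rfl hq.symm) := by
    rintro _ rfl m m' α β δ h
    simpa using h.symm
  rw [hc_split γ s]
  congr 1
  exact gen _ γ.target _ _ (γ.subpath s 1) (γ.subpath s t) (γ.subpath t 1)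
    (mk_subpath_trans _ _ _ _)

theorem subpath_mem {V : Set X} (γ : Path p q) {s t : unitInterval} (hst : s ≤ t)
    (h : ∀ u, s ≤ u → u ≤ t → γ u ∈ V) (u : unitInterval) : γ.subpath s t u ∈ V := by
  have : (γ.subpath s t) u ∈ range (γ.subpath s t) := ⟨u, rfl⟩
  rw [Path.range_subpath_of_le _ _ _ hst] at this
  obtain ⟨v, hv, hv'⟩ := this
  rw [← hv']
  exact h v hv.1 hv.2

theorem initialPart_mem {V : Set X} (γ : Path p q) {s : unitInterval}
    (h : ∀ u, u ≤ s → γ u ∈ V) (u : unitInterval) : initialPart γ s u ∈ V :=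
  subpath_mem γ unitInterval.nonneg' (fun u _ hu => h u hu) u

theorem finalPart_mem {V : Set X} (γ : Path p q) {s : unitInterval}
    (h : ∀ u, s ≤ u → γ u ∈ V) (u : unitInterval) : finalPart γ s u ∈ V :=
  subpath_mem γ unitInterval.le_one' (fun u hu _ => h u hu) u

end Splitting

/-! ### The fundamental group of the plane without finitely many points -/

section PlanarGroup

variable {k : ℕ} {a : Fin k → ℂ} {H : Type*} [Group H]

/-- The path crosses the vertical line through `a i` once, below `a i` and from left to right,
and is otherwise in the plane slit downwards. -/
def CrossesBelow (a : Fin k → ℂ) {p q : ↥(range a)ᶜ} (γ : Path p q) (s t : unitInterval) : Prop :=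
  s ≤ t ∧ (∀ u, u ≤ s → (γ u : ℂ) ∈ slitDown a) ∧ (∀ u, s ≤ u → u ≤ t → (γ u : ℂ) ∈ slitUp a) ∧
    ∀ u, t ≤ u → (γ u : ℂ) ∈ slitDown a

theorem CrossesBelow.val_eq {p q : ↥(range a)ᶜ} {γ : Path p q} {s t : unitInterval}
    (hγ : CrossesBelow a γ s t) (h : Fin k → H) (φ : Holonomy ↥(range a)ᶜ H)
    (hφ : ∀ {p q : ↥(range a)ᶜ} (γ : Path p q), (∀ t, (γ t : ℂ) ∈ slitDown a) → φ.val hc(γ) = 1)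
    (hφ' : ∀ {p q : ↥(range a)ᶜ} (γ : Path p q), (∀ t, (γ t : ℂ) ∈ slitUp a) →
      φ.val hc(γ) = leftProduct a h q * (leftProduct a h p)⁻¹) :
    φ.val hc(γ) = leftProduct a h (γ t) * (leftProduct a h (γ s))⁻¹ := by
  obtain ⟨hst, h1, h2, h3⟩ := hγ
  rw [hc_split₂ γ s t, φ.val_trans, φ.val_trans,
    hφ _ (initialPart_mem (V := Subtype.val ⁻¹' slitDown a) γ h1),
    hφ _ (finalPart_mem (V := Subtype.val ⁻¹' slitDown a) γ h3),
    hφ' _ (subpath_mem (V := Subtype.val ⁻¹' slitUp a) γ hst h2)]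
  simp

theorem sameStrip_joined {p q : ↥(range a)ᶜ} (h : SameStrip a p q) :
    ∃ γ : Path p q, (∀ t, (γ t : ℂ) ∈ slitDown a) ∧ ∀ t, (γ t : ℂ) ∈ slitUp a :=
  ⟨segmentPath p q fun s => slitDown_subset a (mem_slits_of_re_ne fun i => h.segment s i).1,
    fun s => (mem_slits_of_re_ne fun i => h.segment s i).1,
    fun s => (mem_slits_of_re_ne fun i => h.segment s i).2⟩

-- The argument of van Kampen for two simply connected slit planes meeting in vertical strips. A
-- path class is closed up to a loop at `y₀` by standard connecting paths. What remains are the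
-- loops which go up to a strip inside `slitUp a` and return inside `slitDown a`; these are products
-- of the given loops, one for each puncture to the left of the strip.
open Path.Homotopic in
theorem planar_generation (ha : StrictAnti fun i => (a i).re) {y₀ : ↥(range a)ᶜ}
    (hy₀ : (y₀ : ℂ) ∈ slitDown a) (γ : Fin k → Path y₀ y₀)
    (hγ : ∀ i, ∃ s t, CrossesBelow a (γ i) s t ∧ StraddlesOnly a i (γ i s) (γ i t))
    (N : Subgroup (FundamentalGroup ↥(range a)ᶜ y₀))
    (hN : ∀ i, FundamentalGroup.fromPath hc(γ i) ∈ N) : N = ⊤ := by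
  have hD := isSimplyConnected_slitDown a
  have hU := isSimplyConnected_slitUp a
  have joinD : ∀ p q : ↥(range a)ᶜ, (p : ℂ) ∈ slitDown a → (q : ℂ) ∈ slitDown a →
      ∃ γ : Path p q, ∀ t, (γ t : ℂ) ∈ slitDown a := fun p q hp hq =>
    exists_path_of_isSimplyConnected hD (slitDown_subset a) hp hq
  have joinU : ∀ p q : ↥(range a)ᶜ, (p : ℂ) ∈ slitUp a → (q : ℂ) ∈ slitUp a →
      ∃ γ : Path p q, ∀ t, (γ t : ℂ) ∈ slitUp a := fun p q hp hq =>
    exists_path_of_isSimplyConnected hU (slitUp_subset a) hp hq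
  obtain ⟨c, -, hc⟩ := exists_abs_bound fun i => (a i).re
  have hleft : ∀ i, ((-(c + 1) : ℝ) : ℂ).re < (a i).re := fun i => by
    rw [Complex.ofReal_re]
    linarith [hc i, neg_abs_le (a i).re]
  have hsD := (mem_slits_of_re_ne fun i => (hleft i).ne)
  let s : ↥(range a)ᶜ := ⟨((-(c + 1) : ℝ) : ℂ), slitDown_subset a hsD.1⟩
  have s_D : (s : ℂ) ∈ slitDown a := hsD.1
  have s_U : (s : ℂ) ∈ slitUp a := hsD.2
  have inst : ∀ p q : ↥(range a)ᶜ, Nonempty (Path p q) := by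
    have toS : ∀ p : ↥(range a)ᶜ, Nonempty (Path p s) := fun p => by
      by_cases hp : (p : ℂ) ∈ slitDown a
      · exact ⟨(joinD p s hp s_D).choose⟩
      · exact ⟨(joinU p s (mem_slitUp_of_notMem_slitDown ha p.2 hp) s_U).choose⟩
    exact fun p q => ⟨(toS p).some.trans (toS q).some.symm⟩
  choose! D hDmem using joinD
  choose! V hVmem using joinU
  have D_trans : ∀ {p q r : ↥(range a)ᶜ} (_ : (p : ℂ) ∈ slitDown a) (δ : Path q r)
      (_ : ∀ t, (δ t : ℂ) ∈ slitDown a), hc(D p q).trans hc(δ) = hc(D p r) := by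
    intro p q r hp δ hδ
    have hq : (q : ℂ) ∈ slitDown a := by simpa using hδ 0
    have hr : (r : ℂ) ∈ slitDown a := by simpa using hδ 1
    rw [← Quotient.mk_trans]
    refine hc_eq_of_isSimplyConnected hD _ _ (fun t => ?_) (hDmem _ _ hp hr) (slitDown_subset a)
    rw [Path.trans_apply]
    split_ifs
    exacts [hDmem _ _ hp hq _, hδ _]
  have V_trans : ∀ {p q r : ↥(range a)ᶜ} (_ : (p : ℂ) ∈ slitUp a) (δ : Path q r)
      (_ : ∀ t, (δ t : ℂ) ∈ slitUp a), hc(V p q).trans hc(δ) = hc(V p r) := by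
    intro p q r hp δ hδ
    have hq : (q : ℂ) ∈ slitUp a := by simpa using hδ 0
    have hr : (r : ℂ) ∈ slitUp a := by simpa using hδ 1
    rw [← Quotient.mk_trans]
    refine hc_eq_of_isSimplyConnected hU _ _ (fun t => ?_) (hVmem _ _ hp hr) (slitUp_subset a)
    rw [Path.trans_apply]
    split_ifs
    exacts [hVmem _ _ hp hq _, hδ _]
  classical
  -- The connecting path stays in `slitDown a` if the end point allows it; otherwise it goes to the
  -- point `s` to the left of all punctures and continues in `slitUp a`.
  let τ : ∀ p : ↥(range a)ᶜ, Path.Homotopic.Quotient y₀ p := fun p =>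
    if (p : ℂ) ∈ slitDown a then hc(D y₀ p) else hc(D y₀ s).trans hc(V s p)
  have τ_D : ∀ p : ↥(range a)ᶜ, (p : ℂ) ∈ slitDown a → τ p = hc(D y₀ p) := fun p hp => if_pos hp
  let loop : ∀ {p q : ↥(range a)ᶜ}, Path.Homotopic.Quotient p q →
      FundamentalGroup ↥(range a)ᶜ y₀ := fun {p q} α => ((τ p).trans α).trans (τ q).symm
  have loop_trans : ∀ {p q r : ↥(range a)ᶜ} (α : Path.Homotopic.Quotient p q)
      (β : Path.Homotopic.Quotient q r), loop (α.trans β) = loop β * loop α := by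
    intro p q r α β
    rw [FundamentalGroup.mul_def]
    simp only [loop]
    grind
  have loop_symm : ∀ {p q : ↥(range a)ᶜ} (α : Path.Homotopic.Quotient p q),
      loop α.symm = (loop α)⁻¹ := by
    intro p q α
    rw [eq_inv_iff_mul_eq_one, ← loop_trans]
    simp only [loop]
    rw [FundamentalGroup.one_def]
    grind
  have loop_D : ∀ {p q : ↥(range a)ᶜ} (δ : Path p q) (_ : ∀ t, (δ t : ℂ) ∈ slitDown a),
      loop hc(δ) = 1 := by
    intro p q δ hδ
    have hp : (p : ℂ) ∈ slitDown a := by simpa using hδ 0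
    have hq : (q : ℂ) ∈ slitDown a := by simpa using hδ 1
    simp only [loop]
    rw [τ_D p hp, τ_D q hq, D_trans hy₀ δ hδ, Quotient.trans_symm]
    rfl
  -- the classes of the paths from the left that stay in the plane slit upwards
  have step : ∀ {p q : ↥(range a)ᶜ} (δ : Path p q) (_ : ∀ t, (δ t : ℂ) ∈ slitUp a),
      loop hc(V s q) = loop hc(δ) * loop hc(V s p) := by
    intro p q δ hδ
    rw [← loop_trans, V_trans s_U δ hδ]
  -- Induction on the number of punctures to the left of `p`.
  have main : ∀ n : ℕ, ∀ p : ↥(range a)ᶜ, (p : ℂ) ∈ slitUp a →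
      (Finset.univ.filter fun i => (a i).re < (p : ℂ).re).card = n → loop hc(V s p) ∈ N := by
    intro n
    induction n using Nat.strong_induction_on with
    | _ n ih =>
    intro p hp hn
    by_cases hpD : (p : ℂ) ∈ slitDown a
    swap
    · have h1 : loop hc(V s p) = 1 := by
        simp only [loop]
        rw [τ_D s s_D, show τ p = hc(D y₀ s).trans hc(V s p) from if_neg hpD,
          Quotient.trans_symm]
        rfl
      rw [h1]
      exact N.one_mem
    have hne := re_ne_of_mem_slits hpD hp
    have same : ∀ q : ↥(range a)ᶜ, SameStrip a q p → loop hc(V s q) ∈ N →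
        loop hc(V s p) ∈ N := by
      intro q hqp hq
      obtain ⟨δ, hδ, hδ'⟩ := sameStrip_joined hqp
      rw [step δ hδ', loop_D δ hδ, one_mul]
      exact hq
    rcases (Finset.univ.filter fun i => (a i).re < (p : ℂ).re).eq_empty_or_nonempty with he | he
    · refine same s (fun i => Or.inr ⟨hleft i, ?_⟩) ?_
      · have : i ∉ Finset.univ.filter fun i => (a i).re < (p : ℂ).re := by simp [he]
        simp only [Finset.mem_filter, Finset.mem_univ, true_and, not_lt] at this
        exact lt_of_le_of_ne this (hne i)
      · obtain ⟨δ, hδ, hδ'⟩ := sameStrip_joined (p := s) (q := s)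
          (fun i => Or.inr ⟨hleft i, hleft i⟩)
        have h1 := step δ hδ'
        rw [loop_D δ hδ, one_mul] at h1
        have h2 : hc(V s s) = Quotient.refl s := by
          rw [← Quotient.mk_refl]
          exact hc_eq_of_isSimplyConnected hU _ _ (hVmem _ _ s_U s_U) (fun t => s_U)
            (slitUp_subset a)
        rw [h2]
        have h3 := loop_D (Path.refl s) (fun t => s_D)
        rw [Quotient.mk_refl] at h3
        rw [h3]
        exact N.one_mem
    -- The real parts decrease with the index, so the least index gives the puncture immediately to
    -- the left of `p`. The loop `γ i` leads from the strip on the left of this puncture to the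
    -- strip of `p`.
    · set i := (Finset.univ.filter fun i => (a i).re < (p : ℂ).re).min' he with hi
      have hi1 : (a i).re < (p : ℂ).re := by
        have := Finset.min'_mem _ he
        rw [← hi] at this
        simpa using this
      have hi2 : ∀ j, (a j).re < (p : ℂ).re → i ≤ j := fun j hj =>
        Finset.min'_le _ _ (by simpa using hj)
      obtain ⟨u, v, ⟨huv, c1, c2, c3⟩, s1, s2, s3⟩ := hγ i
      have hqU : (γ i v : ℂ) ∈ slitUp a := c2 v huv le_rfl
      have hpU : (γ i u : ℂ) ∈ slitUp a := c2 u le_rfl huv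
      refine same (γ i v) (fun j => ?_) ?_
      · rcases lt_trichotomy j i with hj | hj | hj
        · right
          have h1 : (p : ℂ).re < (a j).re := by
            rcases lt_or_gt_of_ne (hne j) with h | h
            · exact h
            · exact absurd (hi2 j h) (not_le.mpr hj)
          have h2 := ha hj
          simp only at h2
          rcases s3 j hj.ne with h | h
          · linarith [h.1]
          · exact ⟨h.2, h1⟩
        · subst hj
          exact Or.inl ⟨s2, hi1⟩
        · left
          have h2 := ha hj
          simp only at h2
          exact ⟨by linarith, by linarith⟩
      · have hmid := step ((γ i).subpath u v)
          (subpath_mem (V := Subtype.val ⁻¹' slitUp a) (γ i) huv c2)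
        rw [hmid]
        refine N.mul_mem ?_ (ih _ ?_ (γ i u) hpU rfl)
        · have h1 := congrArg loop (hc_split₂ (γ i) u v)
          rw [loop_trans, loop_trans,
            loop_D _ (initialPart_mem (V := Subtype.val ⁻¹' slitDown a) (γ i) c1),
            loop_D _ (finalPart_mem (V := Subtype.val ⁻¹' slitDown a) (γ i) c3), one_mul,
            mul_one] at h1
          rw [← h1]
          have h2 : loop hc(γ i) = FundamentalGroup.fromPath hc(γ i) := by
            simp only [loop]
            have h3 : τ y₀ = Quotient.refl y₀ := by
              rw [τ_D _ hy₀, ← Quotient.mk_refl]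
              exact hc_eq_of_isSimplyConnected hD _ _ (hDmem _ _ hy₀ hy₀) (fun t => hy₀)
                (slitDown_subset a)
            rw [h3]
            have h4 : (Quotient.refl y₀).symm = Quotient.refl y₀ := by
              rw [← Quotient.mk_refl, ← Quotient.mk_symm, Path.refl_symm]
            rw [h4, Quotient.refl_trans, Quotient.trans_refl]
          rw [h2]
          exact hN i
        · rw [← hn]
          apply Finset.card_lt_card
          rw [Finset.ssubset_iff_of_subset]
          · exact ⟨i, by simpa using hi1, by simpa using s1.le⟩
          · intro j
            simp only [Finset.mem_filter, Finset.mem_univ, true_and]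
            intro hj
            linarith
  rw [eq_top_iff]
  intro α _
  have key : ∀ {p q : ↥(range a)ᶜ} (α : Path.Homotopic.Quotient p q), loop α ∈ N := by
    intro p q α
    refine pathClass_induction (Q := fun α => loop α ∈ N)
      (U := fun b : Bool => ((↑) : ↥(range a)ᶜ → ℂ) ⁻¹' (if b then slitDown a else slitUp a))
      ?_ ?_ ?_ ?_ α
    · rintro (b | b)
      · exact isOpen_slitUp.preimage continuous_subtype_val
      · exact isOpen_slitDown.preimage continuous_subtype_val
    · intro y
      by_cases hy : (y : ℂ) ∈ slitDown a
      · exact ⟨true, hy⟩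
      · exact ⟨false, mem_slitUp_of_notMem_slitDown ha y.2 hy⟩
    · intro p q r α β hα hβ
      rw [loop_trans]
      exact N.mul_mem hβ hα
    · rintro (b | b) p q δ hδ
      · have h1 := step δ (by simpa using hδ)
        rw [← mul_inv_eq_iff_eq_mul] at h1
        rw [← h1]
        refine N.mul_mem (main _ q (by simpa using hδ 1) rfl)
          (N.inv_mem (main _ p (by simpa using hδ 0) rfl))
      · rw [loop_D δ (by simpa using hδ)]
        exact N.one_mem
  have h1 := key (p := y₀) (q := y₀) α
  have h3 : τ y₀ = Quotient.refl y₀ := by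
    rw [τ_D _ hy₀, ← Quotient.mk_refl]
    exact hc_eq_of_isSimplyConnected hD _ _ (hDmem _ _ hy₀ hy₀) (fun t => hy₀) (slitDown_subset a)
  have h4 : (Quotient.refl y₀).symm = Quotient.refl y₀ := by
    rw [← Quotient.mk_refl, ← Quotient.mk_symm, Path.refl_symm]
  simp only [loop] at h1
  rw [h3, h4, Quotient.refl_trans, Quotient.trans_refl] at h1
  exact h1

/-- The loops which go once around one of the points each form a free basis. -/
theorem planar_free (ha : StrictAnti fun i => (a i).re) {y₀ : ↥(range a)ᶜ}
    (hy₀ : (y₀ : ℂ) ∈ slitDown a) (γ : Fin k → Path y₀ y₀)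
    (hγ : ∀ i, ∃ s t, CrossesBelow a (γ i) s t ∧ StraddlesOnly a i (γ i s) (γ i t)) :
    Function.Bijective (FreeGroup.lift fun i => FundamentalGroup.fromPath hc(γ i)) := by
  constructor
  -- The holonomy with the free generators as labels is a left inverse.
  · obtain ⟨φ, hφ, hφ'⟩ := exists_planar_holonomy ha (FreeGroup.of : Fin k → FreeGroup (Fin k))
    have h1 : (φ.toHom y₀).comp (FreeGroup.lift fun i => FundamentalGroup.fromPath hc(γ i)) =
        MonoidHom.id _ := by
      ext i
      rw [MonoidHom.comp_apply, FreeGroup.lift_apply_of]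
      obtain ⟨s, t, h1, h2⟩ := hγ i
      change φ.val hc(γ i) = _
      rw [h1.val_eq _ φ hφ hφ', h2.leftProduct_eq ha]
      simp
    exact Function.LeftInverse.injective (g := φ.toHom y₀) fun x => DFunLike.congr_fun h1 x
  · rw [← MonoidHom.range_eq_top]
    refine planar_generation ha hy₀ γ hγ _ fun i => ⟨FreeGroup.of i, ?_⟩
    rw [FreeGroup.lift_apply_of]

end PlanarGroup

/-! ### Kites -/

section Kites

/-- The gauge of the kite with vertices `1`, `i / M`, `-1 / M`, `-i / M`. -/
def kiteGauge (M : ℝ) (z : ℂ) : ℝ := M * |z.im| + max z.re (-(M * z.re))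

/-- The point of the unit circle at the angle `2πt`. -/
def unitPoint (t : ℝ) : ℂ := Complex.exp (2 * Real.pi * t * Complex.I)

/-- The boundary of the kite, starting at the vertex `1`. -/
def kite (M : ℝ) (t : ℝ) : ℂ := ((kiteGauge M (unitPoint t))⁻¹ : ℝ) * unitPoint t

@[fun_prop] theorem continuous_kiteGauge (M : ℝ) : Continuous (kiteGauge M) := by
  unfold kiteGauge; fun_prop

@[fun_prop] theorem continuous_unitPoint : Continuous unitPoint := by
  unfold unitPoint; fun_prop

@[simp] theorem norm_unitPoint (t : ℝ) : ‖unitPoint t‖ = 1 := by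
  have : (2 * Real.pi * t * Complex.I : ℂ) = ((2 * Real.pi * t : ℝ) : ℂ) * Complex.I := by
    push_cast; ring
  rw [unitPoint, this, Complex.norm_exp_ofReal_mul_I]

theorem unitPoint_eq (t : ℝ) :
    unitPoint t = ⟨Real.cos (2 * Real.pi * t), Real.sin (2 * Real.pi * t)⟩ := by
  have : (2 * Real.pi * t * Complex.I : ℂ) = ((2 * Real.pi * t : ℝ) : ℂ) * Complex.I := by
    push_cast; ring
  rw [unitPoint, this]
  apply Complex.ext
  · rw [Complex.exp_ofReal_mul_I_re]
  · rw [Complex.exp_ofReal_mul_I_im]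

theorem unitPoint_ne_zero (t : ℝ) : unitPoint t ≠ 0 := Complex.exp_ne_zero _

theorem unitPoint_add (s t : ℝ) : unitPoint (s + t) = unitPoint s * unitPoint t := by
  rw [unitPoint, unitPoint, unitPoint, ← Complex.exp_add]
  congr 1; push_cast; ring

@[simp] theorem unitPoint_zero : unitPoint 0 = 1 := by simp [unitPoint]

@[simp] theorem unitPoint_one : unitPoint 1 = 1 := by simp [unitPoint]

theorem unitPoint_inj {s t : ℝ} (hs : s ∈ Icc (0 : ℝ) 1) (ht : t ∈ Icc (0 : ℝ) 1)
    (h : unitPoint s = unitPoint t) : s = t ∨ (s = 0 ∧ t = 1) ∨ (s = 1 ∧ t = 0) := by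
  rw [unitPoint, unitPoint, Complex.exp_eq_exp_iff_exists_int] at h
  obtain ⟨n, hn⟩ := h
  have h1 : (s : ℂ) = t + n := by
    have h2 : (2 * Real.pi * Complex.I : ℂ) ≠ 0 := Complex.two_pi_I_ne_zero
    apply mul_left_cancel₀ h2
    linear_combination hn
  have h3 : s = t + n := by exact_mod_cast h1
  have h4 : (n : ℝ) ≤ 1 := by linarith [hs.2, ht.1]
  have h5 : (-1 : ℝ) ≤ n := by linarith [hs.1, ht.2]
  have h6 : n ≤ 1 := by exact_mod_cast h4
  have h7 : -1 ≤ n := by exact_mod_cast h5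
  have h8 : n = -1 ∨ n = 0 ∨ n = 1 := by omega
  rcases h8 with rfl | rfl | rfl
  · right; left
    push_cast at h3
    constructor <;> linarith [hs.1, ht.2]
  · left
    simpa using h3
  · right; right
    push_cast at h3
    constructor <;> linarith [hs.2, ht.1]

variable {M : ℝ}

theorem kiteGauge_smul {r : ℝ} (hr : 0 ≤ r) (z : ℂ) :
    kiteGauge M (r * z) = r * kiteGauge M z := by
  simp only [kiteGauge, Complex.re_ofReal_mul, Complex.im_ofReal_mul, abs_mul, abs_of_nonneg hr]
  rw [mul_add, mul_max_of_nonneg _ _ hr]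
  congr 1
  · ring
  · congr 1; ring

@[simp] theorem kiteGauge_zero : kiteGauge M 0 = 0 := by simp [kiteGauge]

theorem kiteGauge_pos (hM : 1 ≤ M) {z : ℂ} (hz : z ≠ 0) : 0 < kiteGauge M z := by
  unfold kiteGauge
  rcases lt_trichotomy z.re 0 with h | h | h
  · have h1 : 0 < -(M * z.re) := by nlinarith
    have h2 := le_max_right z.re (-(M * z.re))
    have h3 : 0 ≤ M * |z.im| := by positivity
    linarith
  · have h1 : z.im ≠ 0 := fun h' => hz (Complex.ext h h')
    rw [h]
    have := abs_pos.mpr h1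
    simp
    positivity
  · have h2 := le_max_left z.re (-(M * z.re))
    have h3 : 0 ≤ M * |z.im| := by positivity
    linarith

theorem kiteGauge_le (hM : 1 ≤ M) (z : ℂ) : kiteGauge M z ≤ 2 * M * ‖z‖ := by
  have h1 := Complex.abs_im_le_norm z
  have h2 := abs_le.mp (Complex.abs_re_le_norm z)
  unfold kiteGauge
  have h3 : M * |z.im| ≤ M * ‖z‖ := by gcongr
  have h4 : max z.re (-(M * z.re)) ≤ M * ‖z‖ := by
    apply max_le
    · nlinarith [norm_nonneg z]
    · nlinarith [norm_nonneg z]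
  linarith

theorem kite_zero (M : ℝ) (hM : 1 ≤ M) : kite M 0 = 1 := by
  have : max (1 : ℝ) (-M) = 1 := max_eq_left (by linarith)
  simp [kite, kiteGauge, this]

theorem kite_one (M : ℝ) (hM : 1 ≤ M) : kite M 1 = 1 := by
  have : max (1 : ℝ) (-M) = 1 := max_eq_left (by linarith)
  simp [kite, kiteGauge, this]

theorem continuous_kite (hM : 1 ≤ M) : Continuous (kite M) := by
  unfold kite
  have h : ∀ t, kiteGauge M (unitPoint t) ≠ 0 := fun t => (kiteGauge_pos hM (unitPoint_ne_zero t)).ne'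
  fun_prop (disch := exact h)

theorem kiteGauge_kite (hM : 1 ≤ M) (t : ℝ) : kiteGauge M (kite M t) = 1 := by
  have h := kiteGauge_pos hM (unitPoint_ne_zero t)
  rw [kite, kiteGauge_smul (by positivity), inv_mul_cancel₀ h.ne']

theorem kite_ne_zero (hM : 1 ≤ M) (t : ℝ) : kite M t ≠ 0 := by
  intro h
  have := kiteGauge_kite hM t
  rw [h, kiteGauge_zero] at this
  exact zero_ne_one this

/-- Points of the kite lie in the cone with vertex `1`. -/
theorem cone_of_kiteGauge_le {z : ℂ} (hz : kiteGauge M z ≤ 1) :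
    M * |(1 - z).im| ≤ (1 - z).re := by
  unfold kiteGauge at hz
  have := le_max_left z.re (-(M * z.re))
  simp only [Complex.sub_im, Complex.one_im, zero_sub, abs_neg, Complex.sub_re, Complex.one_re]
  linarith

/-- For large `M` the kite is a thin strip around the segment `[0, 1]`; the point `max z.re 0` of
the segment is at distance at most `2 / M`. -/
theorem norm_sub_le_of_kiteGauge_le (hM : 1 ≤ M) {z : ℂ} (hz : kiteGauge M z ≤ 1) :
    max z.re 0 ≤ 1 ∧ ‖z - (max z.re 0 : ℝ)‖ ≤ 2 / M := by
  unfold kiteGauge at hz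
  have hM0 : 0 < M := by linarith
  have h1 := le_max_left z.re (-(M * z.re))
  have h2 := le_max_right z.re (-(M * z.re))
  have h3 : 0 ≤ M * |z.im| := by positivity
  have h0 : 0 ≤ max z.re (-(M * z.re)) := by
    rcases le_total 0 z.re with h | h
    · exact h.trans h1
    · exact le_trans (by nlinarith) h2
  have h4 : |z.im| ≤ 1 / M := by rw [le_div_iff₀ hM0]; linarith
  have h5 : -(1 / M) ≤ z.re := by
    rw [neg_le, le_div_iff₀ hM0]; linarith
  refine ⟨max_le (by linarith) zero_le_one, ?_⟩
  refine (Complex.norm_le_abs_re_add_abs_im _).trans ?_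
  have h6 : |(z - (max z.re 0 : ℝ)).im| ≤ 1 / M := by
    rw [Complex.sub_im, Complex.ofReal_im, sub_zero]; exact h4
  have h7 : |(z - (max z.re 0 : ℝ)).re| ≤ 1 / M := by
    rw [Complex.sub_re, Complex.ofReal_re]
    rcases le_total 0 z.re with h | h
    · rw [max_eq_left h]; simp; positivity
    · rw [max_eq_right h, sub_zero, abs_of_nonpos h]; linarith
  calc _ ≤ 1 / M + 1 / M := add_le_add h7 h6
    _ = 2 / M := by ring

/-- The star-shaped loop about `a` through `a + c`. -/
def kiteLoop (a y₀ : ℂ) (M t : ℝ) : ℂ := a + (y₀ - a) * kite M t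

/-- The region bounded by the loop `kiteLoop`. -/
def kiteRegion (a y₀ : ℂ) (M : ℝ) : Set ℂ := {y | kiteGauge M ((y - a) / (y₀ - a)) ≤ 1}

variable {a y₀ : ℂ}

theorem kiteLoop_mem (hM : 1 ≤ M) (h : y₀ ≠ a) (t : ℝ) :
    kiteLoop a y₀ M t ∈ kiteRegion a y₀ M := by
  have : (kiteLoop a y₀ M t - a) / (y₀ - a) = kite M t := by
    rw [kiteLoop, add_sub_cancel_left, mul_div_cancel_left₀ _ (sub_ne_zero.mpr h)]
  rw [kiteRegion, mem_ofPred_eq, this, kiteGauge_kite hM]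

theorem kiteLoop_ne (hM : 1 ≤ M) (h : y₀ ≠ a) (t : ℝ) : kiteLoop a y₀ M t ≠ a := by
  rw [kiteLoop, Ne, add_eq_left]
  exact mul_ne_zero (sub_ne_zero.mpr h) (kite_ne_zero hM t)

theorem self_mem_kiteRegion : a ∈ kiteRegion a y₀ M := by
  simp [kiteRegion]

theorem closedBall_subset_kiteRegion (hM : 1 ≤ M) (h : y₀ ≠ a) :
    Metric.closedBall a (‖y₀ - a‖ / (2 * M)) ⊆ kiteRegion a y₀ M := by
  intro y hy
  rw [Metric.mem_closedBall, dist_eq_norm] at hy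
  have h0 : 0 < ‖y₀ - a‖ := norm_pos_iff.mpr (sub_ne_zero.mpr h)
  refine (kiteGauge_le hM _).trans ?_
  rw [norm_div]
  have hM0 : 0 < M := by linarith
  rw [le_div_iff₀ (by positivity)] at hy
  rw [← mul_div_assoc, div_le_one h0]
  linarith

/-- The norm of the polar expression gives back the radius, and then the direction gives back the
parameter. -/
theorem isSimpleLoop_star {R : ℝ → ℝ} (hR : ∀ t, 0 < R t) (h01 : R 0 = R 1) {a u : ℂ}
    (hu : u ≠ 0) : IsSimpleLoop fun t : unitInterval => a + R t * unitPoint t * u := by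
  refine ⟨by simp [h01], fun s t hst => ?_⟩
  have h1 : (R s : ℂ) * unitPoint s = R t * unitPoint t := by
    simpa [hu] using hst
  have h2 : R s = R t := by
    have := congrArg norm h1
    simpa [abs_of_pos (hR _)] using this
  rw [h2] at h1
  have h3 : unitPoint s = unitPoint t := by
    refine mul_left_cancel₀ ?_ h1
    exact_mod_cast (hR t).ne'
  rcases unitPoint_inj s.2 t.2 h3 with h | h | h
  · exact Or.inl (Subtype.ext h)
  · exact Or.inr (Or.inl ⟨Subtype.ext h.1, Subtype.ext h.2⟩)
  · exact Or.inr (Or.inr ⟨Subtype.ext h.1, Subtype.ext h.2⟩)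

/-- In the first half of the isotopy the radius is interpolated linearly, in each direction, between
that of the kite and the constant `ε`; all curves are star-shaped about `a` and stay in the kite. In
the second half the circle is rotated until its starting point has argument `0`. -/
theorem isIsotopicToSmallCircle_kiteLoop (hM : 1 ≤ M) (h : y₀ ≠ a) {P : Set ℂ}
    (hP : kiteRegion a y₀ M ∩ P = {a}) :
    IsIsotopicToSmallCircle P a fun t : unitInterval => kiteLoop a y₀ M t := by
  have hM0 : 0 < M := by linarith
  have hc : y₀ - a ≠ 0 := sub_ne_zero.mpr h
  have h0 : 0 < ‖y₀ - a‖ := norm_pos_iff.mpr hc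
  set ε := ‖y₀ - a‖ / (2 * M) with hε
  have hε0 : 0 < ε := by positivity
  have haP : a ∈ P := (hP.symm ▸ mem_singleton a : a ∈ kiteRegion a y₀ M ∩ P).2
  have hball : Metric.closedBall a ε ∩ P = {a} := by
    apply Subset.antisymm
    · rw [← hP]
      exact inter_subset_inter_left _ (closedBall_subset_kiteRegion hM h)
    · rintro _ rfl
      exact ⟨Metric.mem_closedBall_self hε0.le, haP⟩
  set g : ℝ → ℝ := fun t => (kiteGauge M (unitPoint t))⁻¹ with hg
  have hgpos : ∀ t, 0 < g t := fun t => inv_pos.mpr (kiteGauge_pos hM (unitPoint_ne_zero t))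
  have hgc : Continuous g := by
    have h : ∀ t, kiteGauge M (unitPoint t) ≠ 0 :=
      fun t => (kiteGauge_pos hM (unitPoint_ne_zero t)).ne'
    rw [hg]
    fun_prop (disch := exact h)
  set θ := (y₀ - a).arg with hθ
  let σ : ℝ → ℝ := fun s => min (2 * s) 1
  let R : ℝ → ℝ → ℝ := fun s t => (1 - σ s) * (‖y₀ - a‖ * g t) + σ s * ε
  let u : ℝ → ℂ := fun s => Complex.exp ((θ * min 1 (2 - 2 * s) : ℝ) * Complex.I)
  have hu1 : ∀ s, ‖u s‖ = 1 := fun s => Complex.norm_exp_ofReal_mul_I _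
  have hσ : ∀ s ∈ Icc (0 : ℝ) 1, 0 ≤ σ s ∧ σ s ≤ 1 := fun s hs =>
    ⟨le_min (by linarith [hs.1]) zero_le_one, min_le_right _ _⟩
  have hRpos : ∀ s ∈ Icc (0 : ℝ) 1, ∀ t, 0 < R s t := by
    intro s hs t
    obtain ⟨h1, h2⟩ := hσ s hs
    have h3 := hgpos t
    have h4 : 0 < ‖y₀ - a‖ * g t := by positivity
    rcases h2.eq_or_lt with h5 | h5
    · simp only [R, h5]; linarith
    · have h6 : 0 < (1 - σ s) * (‖y₀ - a‖ * g t) := mul_pos (by linarith) h4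
      have h7 : 0 ≤ σ s * ε := by positivity
      simp only [R]; linarith
  have hc_polar : (‖y₀ - a‖ : ℂ) * Complex.exp (θ * Complex.I) = y₀ - a :=
    Complex.norm_mul_exp_arg_mul_I _
  refine ⟨ε, hε0, hball,
    fun x => a + R x.1 x.2 * unitPoint x.2 * u x.1, ?_, ?_, ?_, ?_, ?_⟩
  · simp only [R, u, σ]
    fun_prop
  · intro s t hmem
    have hne : a + R s t * unitPoint t * u s ≠ a := by
      rw [Ne, add_eq_left]
      refine mul_ne_zero (mul_ne_zero ?_ (unitPoint_ne_zero _)) ?_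
      · exact_mod_cast (hRpos s s.2 t).ne'
      · exact Complex.exp_ne_zero _
    apply hne
    rw [← mem_singleton_iff]
    rcases le_total (2 * (s : ℝ)) 1 with hs | hs
    · rw [← hP]
      refine ⟨?_, hmem⟩
      have hus : u s = Complex.exp (θ * Complex.I) := by
        simp only [u]
        rw [min_eq_left (by linarith), mul_one]
      have hz : (a + R s t * unitPoint t * u s - a) / (y₀ - a) =
          ((R s t / ‖y₀ - a‖ : ℝ) : ℂ) * unitPoint t := by
        rw [add_sub_cancel_left, div_eq_iff hc, hus, Complex.ofReal_div]
        nth_rewrite 2 [← hc_polar]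
        have : (‖y₀ - a‖ : ℂ) ≠ 0 := by exact_mod_cast h0.ne'
        field_simp
      rw [kiteRegion, mem_ofPred_eq, hz, kiteGauge_smul (div_nonneg (hRpos s s.2 t).le h0.le)]
      have hN := kiteGauge_pos hM (unitPoint_ne_zero t)
      have hN2 := kiteGauge_le hM (unitPoint t)
      rw [norm_unitPoint, mul_one] at hN2
      have hεg : ε ≤ ‖y₀ - a‖ * g t := by
        rw [hε, div_eq_mul_inv]
        refine mul_le_mul_of_nonneg_left ?_ h0.le
        exact inv_anti₀ hN hN2
      have hR : R s t ≤ ‖y₀ - a‖ * g t := by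
        obtain ⟨h1, h2⟩ := hσ s s.2
        simp only [R]
        nlinarith
      calc R s t / ‖y₀ - a‖ * kiteGauge M (unitPoint t)
          ≤ (‖y₀ - a‖ * g t) / ‖y₀ - a‖ * kiteGauge M (unitPoint t) := by gcongr
        _ = 1 := by
          rw [hg]
          field_simp
    · rw [← hball]
      refine ⟨?_, hmem⟩
      have hR : R s t = ε := by
        simp only [R, σ]
        rw [min_eq_right hs]; ring
      rw [Metric.mem_closedBall, dist_eq_norm, add_sub_cancel_left, norm_mul, norm_mul, hu1,
        norm_unitPoint, hR]
      simp [abs_of_pos hε0]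
  · intro s
    refine isSimpleLoop_star (R := R s) (hRpos s s.2) ?_ (Complex.exp_ne_zero _)
    simp [R, hg]
  · intro t
    have h1 : R 0 t = ‖y₀ - a‖ * g t := by simp [R, σ]
    have h2 : u 0 = Complex.exp (θ * Complex.I) := by simp [u]
    simp only [Set.Icc.coe_zero]
    rw [h1, h2, kiteLoop, kite]
    simp only [hg]
    push_cast
    linear_combination ((kiteGauge M (unitPoint t) : ℂ))⁻¹ * unitPoint t * hc_polar
  · intro t
    have h1 : R 1 t = ε := by simp [R, σ]
    have h2 : u 1 = 1 := by simp [u]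
    simp only [Set.Icc.coe_one]
    rw [h1, h2, circleMap, unitPoint]
    push_cast
    ring_nf

/-- Each kite lies in a cone with vertex `y₀` and slope `1 / M` around the direction of its centre.
The condition `hsep` makes `M` large compared with the angle between the two directions, so that the
cones meet in the vertex only. -/
theorem eq_of_mem_kiteRegions (hM : 1 ≤ M) {a' : ℂ} (h : y₀ ≠ a) (h' : y₀ ≠ a')
    (hsep : 4 * ‖(y₀ - a') / (y₀ - a)‖ < M * |((y₀ - a') / (y₀ - a)).im|) {y : ℂ}
    (hy : y ∈ kiteRegion a y₀ M) (hy' : y ∈ kiteRegion a' y₀ M) : y = y₀ := by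
  have hc : y₀ - a ≠ 0 := sub_ne_zero.mpr h
  have hc' : y₀ - a' ≠ 0 := sub_ne_zero.mpr h'
  have hM0 : 0 < M := by linarith
  have h1 := cone_of_kiteGauge_le hy
  have h2 := cone_of_kiteGauge_le hy'
  set p := 1 - (y - a) / (y₀ - a) with hp
  set q := 1 - (y - a') / (y₀ - a') with hq
  have hpc : p * (y₀ - a) = y₀ - y := by rw [hp]; field_simp; ring
  have hqc : q * (y₀ - a') = y₀ - y := by rw [hq]; field_simp; ring
  by_contra hne
  have hy0 : y₀ - y ≠ 0 := sub_ne_zero.mpr (Ne.symm hne)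
  have hq0 : q ≠ 0 := by rintro h0; rw [h0, zero_mul] at hqc; exact hy0 hqc.symm
  set r := (y₀ - a') / (y₀ - a) with hr
  have hprq : p = q * r := by
    rw [hr, ← mul_div_assoc, hqc, ← hpc, mul_div_cancel_right₀ _ hc]
  have hqre : 0 < q.re := by
    have h3 : 0 ≤ q.re := le_trans (by positivity) h2
    rcases h3.eq_or_lt with h4 | h4
    · exfalso
      rw [← h4] at h2
      have h5 : |q.im| = 0 := by
        have : 0 ≤ |q.im| := abs_nonneg _
        nlinarith
      exact hq0 (Complex.ext h4.symm (abs_eq_zero.mp h5))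
    · exact h4
  -- compare `|q|² |Im r|` with `|q|² |r|`
  have hpre : 0 ≤ p.re := le_trans (by positivity) h1
  have e1 : Complex.normSq q * r.im = p.im * q.re - p.re * q.im := by
    rw [hprq, Complex.normSq_apply, Complex.mul_re, Complex.mul_im]; ring
  have e2 : M * (Complex.normSq q * |r.im|) ≤ 2 * (p.re * q.re) := by
    have : Complex.normSq q * |r.im| = |p.im * q.re - p.re * q.im| := by
      rw [← e1, abs_mul, abs_of_nonneg (Complex.normSq_nonneg q)]
    rw [this]
    have h3 : |p.im * q.re - p.re * q.im| ≤ |p.im| * q.re + p.re * |q.im| := by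
      refine (abs_sub _ _).trans ?_
      rw [abs_mul, abs_mul, abs_of_pos hqre, abs_of_nonneg hpre]
    have h4 : M * |p.im| * q.re ≤ p.re * q.re := by gcongr
    have h5 : p.re * (M * |q.im|) ≤ p.re * q.re := by gcongr
    nlinarith
  have e3 : p.re * q.re ≤ Complex.normSq q * ‖r‖ := by
    have h3 : p.re ≤ ‖q‖ * ‖r‖ := by
      rw [← norm_mul, ← hprq]; exact Complex.re_le_norm p
    have h4 : q.re ≤ ‖q‖ := Complex.re_le_norm q
    calc p.re * q.re ≤ (‖q‖ * ‖r‖) * ‖q‖ := by gcongr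
      _ = Complex.normSq q * ‖r‖ := by rw [Complex.normSq_eq_norm_sq]; ring
  have hnq : 0 < Complex.normSq q := Complex.normSq_pos.mpr hq0
  have e4 : Complex.normSq q * (4 * ‖r‖) < Complex.normSq q * (M * |r.im|) := by gcongr
  nlinarith [norm_nonneg r]

/-- The loop `kiteLoop`, as a path in a subset of the plane. -/
def kitePath {S : Set ℂ} (y₀ : ↥S) (a : ℂ) {M : ℝ} (hM : 1 ≤ M)
    (hS : ∀ t : unitInterval, kiteLoop a y₀ M t ∈ S) : Path y₀ y₀ :=
  subsetPath (fun t => kiteLoop a y₀ M t)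
    (by
      have := continuous_kite hM
      unfold kiteLoop
      fun_prop) hS
    (by simp [kiteLoop, kite_zero M hM]) (by simp [kiteLoop, kite_one M hM])

/-- The kites with common vertex `y₀` about the points `a i` meet in `y₀` only. -/
def KitesSeparated {ι : Type} (a : ι → ℂ) (y₀ : ℂ) (M : ℝ) : Prop :=
  1 ≤ M ∧ (∀ i, y₀ ≠ a i) ∧
    ∀ i j, i ≠ j → 4 * ‖(y₀ - a j) / (y₀ - a i)‖ < M * |((y₀ - a j) / (y₀ - a i)).im|

theorem KitesSeparated.inter_range {ι : Type} {a : ι → ℂ} (h : KitesSeparated a y₀ M) (i : ι) :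
    kiteRegion (a i) y₀ M ∩ range a = {a i} := by
  apply Subset.antisymm
  · rintro _ ⟨hy, j, rfl⟩
    by_contra hne
    have hij : i ≠ j := by rintro rfl; exact hne rfl
    exact h.2.1 j (eq_of_mem_kiteRegions h.1 (h.2.1 i) (h.2.1 j) (h.2.2 i j hij) hy
      self_mem_kiteRegion).symm
  · rintro _ rfl
    exact ⟨self_mem_kiteRegion, i, rfl⟩

theorem KitesSeparated.kiteLoop_mem {ι : Type} {a : ι → ℂ} (h : KitesSeparated a y₀ M) (i : ι)
    (t : ℝ) : kiteLoop (a i) y₀ M t ∈ (range a)ᶜ := by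
  intro hmem
  have : kiteLoop (a i) y₀ M t ∈ kiteRegion (a i) y₀ M ∩ range a :=
    ⟨AsymptoticGerm.kiteLoop_mem h.1 (h.2.1 i) t, hmem⟩
  rw [h.inter_range] at this
  exact kiteLoop_ne h.1 (h.2.1 i) t this

theorem KitesSeparated.isGeometricBasis {ι : Type} {a : ι → ℂ} {P : Set ℂ} (hP : P = range a)
    {y₀ : ↥Pᶜ} (h : KitesSeparated a y₀ M) (hS : ∀ i (t : unitInterval), kiteLoop (a i) y₀ M t ∈ Pᶜ)
    (b : ι → FundamentalGroup ↥Pᶜ y₀)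
    (hb : ∀ i, b i = FundamentalGroup.fromPath hc(kitePath y₀ (a i) h.1 (hS i)))
    (hfree : Function.Bijective (FreeGroup.lift b)) : IsGeometricBasis P y₀ a b := by
  subst hP
  refine ⟨hfree, fun i => kitePath y₀ (a i) h.1 (hS i), hb, fun i => ?_, fun i j hij s t hst => ?_⟩
  · exact isIsotopicToSmallCircle_kiteLoop h.1 (h.2.1 i) (h.inter_range i)
  · apply Subtype.ext
    refine eq_of_mem_kiteRegions h.1 (h.2.1 i) (h.2.1 j) (h.2.2 i j hij)
      (AsymptoticGerm.kiteLoop_mem h.1 (h.2.1 i) _) ?_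
    rw [hst]
    exact AsymptoticGerm.kiteLoop_mem h.1 (h.2.1 j) _

end Kites

/-! ### Kites with a high common vertex -/

section Positions

variable {M : ℝ}

theorem kite_re (M t : ℝ) : (kite M t).re =
    (kiteGauge M (unitPoint t))⁻¹ * Real.cos (2 * Real.pi * t) := by
  rw [kite, Complex.re_ofReal_mul, unitPoint_eq]

theorem kite_re_nonneg (hM : 1 ≤ M) {t : ℝ} (ht : (0 ≤ t ∧ t ≤ 1 / 4) ∨ (3 / 4 ≤ t ∧ t ≤ 1)) :
    0 ≤ (kite M t).re := by
  rw [kite_re]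
  refine mul_nonneg (inv_nonneg.mpr (kiteGauge_pos hM (unitPoint_ne_zero t)).le) ?_
  have hpi := Real.pi_pos
  rcases ht with h | h
  · apply Real.cos_nonneg_of_neg_pi_div_two_le_of_le <;> nlinarith
  · rw [← Real.cos_sub_two_pi]
    apply Real.cos_nonneg_of_neg_pi_div_two_le_of_le <;> nlinarith

theorem kite_re_nonpos (hM : 1 ≤ M) {t : ℝ} (h : 1 / 4 ≤ t) (h' : t ≤ 3 / 4) :
    (kite M t).re ≤ 0 := by
  rw [kite_re]
  refine mul_nonpos_of_nonneg_of_nonpos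
    (inv_nonneg.mpr (kiteGauge_pos hM (unitPoint_ne_zero t)).le) ?_
  have hpi := Real.pi_pos
  apply Real.cos_nonpos_of_pi_div_two_le_of_le <;> nlinarith

theorem unitPoint_quarter : unitPoint (1 / 4) = Complex.I := by
  rw [unitPoint_eq]
  have : 2 * Real.pi * (1 / 4) = Real.pi / 2 := by ring
  rw [this, Real.cos_pi_div_two, Real.sin_pi_div_two]
  rfl

theorem unitPoint_half : unitPoint (1 / 2) = -1 := by
  rw [unitPoint_eq]
  have : 2 * Real.pi * (1 / 2) = Real.pi := by ring
  rw [this, Real.cos_pi, Real.sin_pi]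
  apply Complex.ext <;> simp

theorem unitPoint_three_quarters : unitPoint (3 / 4) = -Complex.I := by
  have : (3 / 4 : ℝ) = 1 / 2 + 1 / 4 := by norm_num
  rw [this, unitPoint_add, unitPoint_half, unitPoint_quarter]; ring

theorem kite_quarter : kite M (1 / 4) = (M⁻¹ : ℝ) * Complex.I := by
  rw [kite, unitPoint_quarter]; simp [kiteGauge]

theorem kite_three_quarters : kite M (3 / 4) = -((M⁻¹ : ℝ) * Complex.I) := by
  rw [kite, unitPoint_three_quarters]; simp [kiteGauge]

/-- As `M` grows the kites shrink to the segment from `a` to `y₀`, which has positive distance from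
`C`. -/
theorem kiteRegion_avoids {a y₀ : ℂ} (h : y₀ ≠ a) {C : Set ℂ} (hC : IsClosed C)
    (hseg : ∀ τ : ℝ, 0 ≤ τ → τ ≤ 1 → a + τ * (y₀ - a) ∉ C) :
    ∀ᶠ M in atTop, ∀ y ∈ kiteRegion a y₀ M, y ∉ C := by
  set K : Set ℂ := (fun τ : ℝ => a + τ * (y₀ - a)) '' Icc 0 1 with hK
  have hKc : IsCompact K := isCompact_Icc.image (by fun_prop)
  have hdisj : Disjoint K C := by
    rw [Set.disjoint_left]
    rintro _ ⟨τ, hτ, rfl⟩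
    exact hseg τ hτ.1 hτ.2
  obtain ⟨δ, hδ, hδ'⟩ := hdisj.exists_thickenings hKc hC
  have hc : 0 < ‖y₀ - a‖ := norm_pos_iff.mpr (sub_ne_zero.mpr h)
  filter_upwards [eventually_ge_atTop 1, eventually_gt_atTop (2 * ‖y₀ - a‖ / δ)] with M hM hM' y hy hyC
  have hM0 : 0 < M := by linarith
  obtain ⟨h1, h2⟩ := norm_sub_le_of_kiteGauge_le hM hy
  set z := (y - a) / (y₀ - a) with hz
  have hyz : y = a + (y₀ - a) * z := by
    rw [hz]; field_simp [sub_ne_zero.mpr h]; ring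
  refine Set.disjoint_left.mp hδ' ?_ (Metric.self_subset_thickening hδ _ hyC)
  rw [Metric.mem_thickening_iff]
  refine ⟨_, ⟨max z.re 0, ⟨le_max_right _ _, h1⟩, rfl⟩, ?_⟩
  rw [dist_eq_norm]
  have : y - (a + (max z.re 0 : ℝ) * (y₀ - a)) = (y₀ - a) * (z - (max z.re 0 : ℝ)) := by
    rw [hyz]; ring
  rw [this, norm_mul]
  rw [div_lt_iff₀ hδ] at hM'
  calc ‖y₀ - a‖ * ‖z - (max z.re 0 : ℝ)‖ ≤ ‖y₀ - a‖ * (2 / M) := by gcongr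
    _ < δ := by
      rw [← mul_div_assoc, div_lt_iff₀ hM0]; linarith

/-- For `c = y₀ - a i`, pointing upwards: the half of the kite towards `y₀` does not meet the
downward ray from its own centre, and the other half does not meet the upward ray. -/
theorem eq_zero_of_ray {c z : ℂ} (hc : 0 < c.im) (h : (c * z).re = 0)
    (h' : 0 ≤ z.re ∧ (c * z).im ≤ 0 ∨ z.re ≤ 0 ∧ 0 ≤ (c * z).im) : z = 0 := by
  rw [Complex.mul_re] at h
  rw [Complex.mul_im] at h'
  have e : z.re * (c.re ^ 2 + c.im ^ 2) = c.im * (c.re * z.im + c.im * z.re) := by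
    have h1 : c.re * z.re = c.im * z.im := by linarith
    calc z.re * (c.re ^ 2 + c.im ^ 2) = c.re * (c.re * z.re) + c.im ^ 2 * z.re := by ring
      _ = _ := by rw [h1]; ring
  have hpos : 0 < c.re ^ 2 + c.im ^ 2 := by positivity
  have hre : z.re = 0 := by
    rcases h' with ⟨h1, h2⟩ | ⟨h1, h2⟩
    · have : z.re * (c.re ^ 2 + c.im ^ 2) ≤ 0 := by
        rw [e]; exact mul_nonpos_of_nonneg_of_nonpos hc.le h2
      nlinarith
    · have : 0 ≤ z.re * (c.re ^ 2 + c.im ^ 2) := by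
        rw [e]; exact mul_nonneg hc.le h2
      nlinarith
  have him : z.im = 0 := by
    rw [hre] at h
    have : c.im * z.im = 0 := by linarith
    exact (mul_eq_zero.mp this).resolve_left hc.ne'
  exact Complex.ext hre him

variable {m : ℕ} {a : Fin (m + 1) → ℂ}

/-- The common vertex at height `L` above the first point. -/
def highPoint (a : Fin (m + 1) → ℂ) (L : ℝ) : ℂ := a 0 + L * Complex.I

@[simp] theorem highPoint_re (a : Fin (m + 1) → ℂ) (L : ℝ) : (highPoint a L).re = (a 0).re := by
  simp [highPoint]

@[simp] theorem highPoint_im (a : Fin (m + 1) → ℂ) (L : ℝ) :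
    (highPoint a L).im = (a 0).im + L := by
  simp [highPoint]

theorem eventually_highPoint_above (i : Fin (m + 1)) :
    ∀ᶠ L in atTop, 0 < (highPoint a L - a i).im := by
  filter_upwards [eventually_gt_atTop ((a i).im - (a 0).im)] with L hL
  rw [Complex.sub_im, highPoint_im]
  linarith

/-- The numerator of the imaginary part is affine in `L`, with slope the difference of two real
parts; it vanishes for a single value of `L`. -/
theorem eventually_not_collinear (ha : StrictAnti fun i => (a i).re) {i j : Fin (m + 1)}
    (hij : i ≠ j) : ∀ᶠ L in atTop, ((highPoint a L - a j) / (highPoint a L - a i)).im ≠ 0 := by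
  have hne : (a j).re - (a i).re ≠ 0 := by
    intro h
    exact hij (ha.injective (sub_eq_zero.mp h).symm)
  set r := ((a 0).re - (a i).re) * ((a 0).im - (a j).im) -
    ((a 0).re - (a j).re) * ((a 0).im - (a i).im) with hr
  filter_upwards [eventually_ne_atTop (-r / ((a j).re - (a i).re)), eventually_highPoint_above i]
    with L hL hpos
  have hc : highPoint a L - a i ≠ 0 := fun h => by rw [h] at hpos; simp at hpos
  have hn : 0 < Complex.normSq (highPoint a L - a i) := Complex.normSq_pos.mpr hc
  rw [Complex.div_im]
  intro h
  rw [← sub_div, div_eq_zero_iff] at h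
  rcases h with h | h
  · apply hL
    rw [eq_div_iff hne]
    simp only [Complex.sub_re, Complex.sub_im, highPoint_re, highPoint_im] at h
    rw [hr]
    linarith
  · exact hn.ne' h

/-- If the segment meets the vertical line through `a j`, it does so at the parameter `g / p`, which
does not depend on `L`, and its height there grows linearly with `L`. -/
theorem eventually_segment_avoids (ha : StrictAnti fun i => (a i).re) {i j : Fin (m + 1)}
    (hij : i ≠ j) : ∀ᶠ L in atTop, ∀ τ : ℝ, 0 ≤ τ → τ ≤ 1 →
      a i + τ * (highPoint a L - a i) ∉ {y : ℂ | y.re = (a j).re ∧ y.im ≤ (a j).im} := by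
  have hne : (a j).re - (a i).re ≠ 0 := by
    intro h
    exact hij (ha.injective (sub_eq_zero.mp h).symm)
  set p := (a 0).re - (a i).re with hp
  set g := (a j).re - (a i).re with hg
  filter_upwards [eventually_gt_atTop (((a j).im - (a i).im) / (g / p) + (a i).im - (a 0).im)]
    with L hL τ h0 h1 hmem
  obtain ⟨h2, h3⟩ := hmem
  simp only [Complex.add_re, Complex.add_im, Complex.re_ofReal_mul, Complex.im_ofReal_mul,
    Complex.sub_re, Complex.sub_im, highPoint_re, highPoint_im] at h2 h3
  have h4 : τ * p = g := by rw [hp, hg]; linarith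
  have hp0 : p ≠ 0 := by rintro h; rw [h, mul_zero] at h4; exact hne h4.symm
  have h5 : τ = g / p := by rw [← h4, mul_div_cancel_right₀ _ hp0]
  have h6 : 0 < τ := lt_of_le_of_ne h0 (by rintro h; rw [← h, zero_mul] at h4; exact hne h4.symm)
  rw [← h5] at hL
  have h7 : ((a j).im - (a i).im) / τ < L - (a i).im + (a 0).im := by linarith
  rw [div_lt_iff₀ h6] at h7
  nlinarith

/-- First `L` is chosen, so that the segments from the common vertex to the punctures are in general
position, then `M`, so that the kites cling to these segments. For the normal form `a 0` is the
puncture on the branch to infinity, and the ray of the points `t * a 0` with `1 ≤ t` is the set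
where `q(x₀) y` is in `[1, ∞)`. Thus the kites about the other punctures will lie in `A`, and the
kite about `a 0` far from the constant branches. -/
theorem exists_kites (ha : StrictAnti fun i => (a i).re) {R₀ : ℝ} (hR₀ : R₀ < (a 0).re)
    (h0 : 0 < (a 0).re) (hnorm : ‖a 0‖ < 2 * (a 0).re) :
    ∃ L : ℝ, 0 < L ∧ ∃ M : ℝ, KitesSeparated a (highPoint a L) M ∧
      highPoint a L ∈ slitDown a ∧
      (∀ i t, (0 ≤ t ∧ t ≤ 1 / 4) ∨ (3 / 4 ≤ t ∧ t ≤ 1) →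
        kiteLoop (a i) (highPoint a L) M t ∈ slitDown a) ∧
      (∀ i t, 1 / 4 ≤ t → t ≤ 3 / 4 → kiteLoop (a i) (highPoint a L) M t ∈ slitUp a) ∧
      (∀ i, StraddlesOnly a i (kiteLoop (a i) (highPoint a L) M (1 / 4))
        (kiteLoop (a i) (highPoint a L) M (3 / 4))) ∧
      (∀ i, i ≠ 0 → ∀ y ∈ kiteRegion (a i) (highPoint a L) M, ∀ t : ℝ, 1 ≤ t → y ≠ t * a 0) ∧
      ∀ y ∈ kiteRegion (a 0) (highPoint a L) M, R₀ < y.re ∧ ‖a 0‖ < 2 * ‖y‖ := by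
  have hle : ∀ i, (a i).re ≤ (a 0).re := fun i => ha.antitone (Fin.zero_le i)
  have e1 : ∀ᶠ L in atTop, ∀ i, 0 < (highPoint a L - a i).im :=
    eventually_all.mpr fun i => eventually_highPoint_above i
  have e2 : ∀ᶠ L in atTop, ∀ i j, i ≠ j →
      ((highPoint a L - a j) / (highPoint a L - a i)).im ≠ 0 := by
    simp only [eventually_all]
    exact fun i j hij => eventually_not_collinear ha hij
  have e3 : ∀ᶠ L in atTop, ∀ i j, i ≠ j → ∀ τ : ℝ, 0 ≤ τ → τ ≤ 1 →
      a i + τ * (highPoint a L - a i) ∉ {y : ℂ | y.re = (a j).re ∧ y.im ≤ (a j).im} := by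
    simp only [eventually_all] at *
    intro i j hij
    have := eventually_segment_avoids ha hij
    exact this
  obtain ⟨L, hL1, hL2, hL3, hL⟩ := (e1.and (e2.and (e3.and (eventually_gt_atTop 0)))).exists
  set y₀ := highPoint a L with hy₀
  have hy₀re : y₀.re = (a 0).re := highPoint_re a L
  have hne : ∀ i, y₀ ≠ a i := fun i h => by
    have := hL1 i
    rw [h, sub_self] at this
    simp at this
  have f1 : ∀ᶠ M in atTop, ∀ i j, i ≠ j → 4 * ‖(y₀ - a j) / (y₀ - a i)‖ <
      M * |((y₀ - a j) / (y₀ - a i)).im| := by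
    simp only [eventually_all]
    intro i j hij
    have h := abs_pos.mpr (hL2 i j hij)
    filter_upwards [eventually_gt_atTop (4 * ‖(y₀ - a j) / (y₀ - a i)‖ /
      |((y₀ - a j) / (y₀ - a i)).im|)] with M hM
    rwa [div_lt_iff₀ h] at hM
  have f2 : ∀ᶠ M in atTop, ∀ i j, i ≠ j → ∀ y ∈ kiteRegion (a i) y₀ M,
      y ∉ {y : ℂ | y.re = (a j).re ∧ y.im ≤ (a j).im} := by
    simp only [eventually_all]
    intro i j hij
    have hcl : IsClosed {y : ℂ | y.re = (a j).re ∧ y.im ≤ (a j).im} :=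
      (isClosed_eq Complex.continuous_re continuous_const).inter
        (isClosed_le Complex.continuous_im continuous_const)
    simpa only [eventually_all] using kiteRegion_avoids (hne i) hcl (hL3 i j hij)
  have f3 : ∀ᶠ M in atTop, ∀ i, i ≠ 0 → ∀ y ∈ kiteRegion (a i) y₀ M,
      y ∉ (fun t : ℝ => (t : ℂ) * a 0) '' Ici 1 := by
    simp only [eventually_all]
    intro i hi
    have ha0 : a 0 ≠ 0 := fun h => by rw [h] at h0; simp at h0
    have hcl : IsClosed ((fun t : ℝ => (t : ℂ) * a 0) '' Ici 1) := by
      have : Topology.IsClosedEmbedding fun t : ℝ => (t : ℂ) * a 0 :=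
        (Homeomorph.mulRight₀ (a 0) ha0).isClosedEmbedding.comp Complex.isometry_ofReal.isClosedEmbedding
      exact this.isClosedMap _ isClosed_Ici
    simpa only [eventually_all] using kiteRegion_avoids (hne i) hcl (by
      rintro τ hτ0 hτ1 ⟨t, ht, hteq⟩
      have ht1 : (1 : ℝ) ≤ t := ht
      have hre := congrArg Complex.re hteq
      have him := congrArg Complex.im hteq
      have hi' : (a i).re < (a 0).re := ha (Fin.pos_of_ne_zero hi)
      simp only [Complex.add_re, Complex.add_im, Complex.re_ofReal_mul, Complex.im_ofReal_mul,
        Complex.sub_re, Complex.sub_im, hy₀re] at hre him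
      have h1 : (1 - τ) * ((a 0).re - (a i).re) + (t - 1) * (a 0).re = 0 := by linarith
      have h2 : 0 ≤ (1 - τ) * ((a 0).re - (a i).re) := mul_nonneg (by linarith) (by linarith)
      have h3 : 0 ≤ (t - 1) * (a 0).re := mul_nonneg (by linarith) h0.le
      have h4 : (t - 1) * (a 0).re = 0 := by linarith
      have h5 : (1 - τ) * ((a 0).re - (a i).re) = 0 := by linarith
      have ht : t = 1 := by
        rcases mul_eq_zero.mp h4 with h | h <;> linarith
      have hτ : τ = 1 := by
        rcases mul_eq_zero.mp h5 with h | h <;> linarith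
      rw [ht, hτ, hy₀, highPoint_im] at him
      linarith)
  -- The segment from `a 0` to the vertex is vertical, so its real part is constantly `(a 0).re`,
  -- which exceeds both bounds.
  have f4 : ∀ᶠ M in atTop, ∀ y ∈ kiteRegion (a 0) y₀ M,
      y ∉ {y : ℂ | y.re ≤ max R₀ (‖a 0‖ / 2)} := by
    refine kiteRegion_avoids (hne 0) (isClosed_le Complex.continuous_re continuous_const) ?_
    intro τ _ _ h
    simp only [mem_ofPred_eq, Complex.add_re, Complex.re_ofReal_mul, Complex.sub_re, hy₀re,
      sub_self, mul_zero, add_zero, le_max_iff] at h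
    rcases h with h | h <;> linarith
  -- This makes the part of each kite around its centre narrower than the distances between the real
  -- parts of the punctures.
  have f5 : ∀ᶠ M in atTop, ∀ i j, i ≠ j → 2 * ‖y₀ - a i‖ < M * |(a j).re - (a i).re| := by
    simp only [eventually_all]
    intro i j hij
    have h : 0 < |(a j).re - (a i).re| := abs_pos.mpr fun h =>
      hij (ha.injective (sub_eq_zero.mp h).symm)
    filter_upwards [eventually_gt_atTop (2 * ‖y₀ - a i‖ / |(a j).re - (a i).re|)] with M hM
    rwa [div_lt_iff₀ h] at hM
  obtain ⟨M, g1, g2, g3, g4, g5, hM⟩ := (f1.and (f2.and (f3.and (f4.and (f5.and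
    (eventually_ge_atTop 1)))))).exists
  have hM0 : 0 < M := by linarith
  -- points of the lower half of a kite are close to its centre
  have close : ∀ i j, i ≠ j → ∀ t, 1 / 4 ≤ t → t ≤ 3 / 4 →
      |(kiteLoop (a i) y₀ M t).re - (a i).re| < |(a j).re - (a i).re| := by
    intro i j hij t ht ht'
    have h1 := kite_re_nonpos hM ht ht'
    have h2 := (norm_sub_le_of_kiteGauge_le hM (kiteGauge_kite hM t).le).2
    rw [max_eq_right h1, Complex.ofReal_zero, sub_zero] at h2
    have h3 : kiteLoop (a i) y₀ M t - a i = (y₀ - a i) * kite M t := by rw [kiteLoop]; ring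
    rw [← Complex.sub_re, h3]
    refine (Complex.abs_re_le_norm _).trans_lt ?_
    rw [norm_mul]
    have h4 : ‖y₀ - a i‖ * ‖kite M t‖ ≤ ‖y₀ - a i‖ * (2 / M) := by gcongr
    refine h4.trans_lt ?_
    rw [← mul_div_assoc, div_lt_iff₀ hM0]
    have := g5 i j hij
    linarith
  refine ⟨L, hL, M, ⟨hM, hne, g1⟩, ?_, ?_, ?_, ?_, ?_, ?_⟩
  · intro i hi
    have h1 := hL1 i
    rw [Complex.sub_im] at h1
    linarith [hi.2]
  · intro i t ht j hj
    by_cases hij : i = j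
    · subst hij
      have h3 : kiteLoop (a i) y₀ M t - a i = (y₀ - a i) * kite M t := by rw [kiteLoop]; ring
      refine kite_ne_zero hM t (eq_zero_of_ray (hL1 i) ?_ (Or.inl ⟨kite_re_nonneg hM ht, ?_⟩))
      · rw [← h3, Complex.sub_re, hj.1, sub_self]
      · rw [← h3, Complex.sub_im]; linarith [hj.2]
    · exact g2 i j hij _ (kiteLoop_mem hM (hne i) t) hj
  · intro i t ht ht' j hj
    by_cases hij : i = j
    · subst hij
      have h3 : kiteLoop (a i) y₀ M t - a i = (y₀ - a i) * kite M t := by rw [kiteLoop]; ring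
      refine kite_ne_zero hM t (eq_zero_of_ray (hL1 i) ?_ (Or.inr ⟨kite_re_nonpos hM ht ht', ?_⟩))
      · rw [← h3, Complex.sub_re, hj.1, sub_self]
      · rw [← h3, Complex.sub_im]; linarith [hj.2]
    · have := close i j hij t ht ht'
      rw [hj.1] at this
      exact lt_irrefl _ this
  · intro i
    have hpos : 0 < M⁻¹ * (y₀ - a i).im := mul_pos (inv_pos.mpr hM0) (hL1 i)
    have hl : (kiteLoop (a i) y₀ M (1 / 4)).re = (a i).re - M⁻¹ * (y₀ - a i).im := by
      rw [kiteLoop, kite_quarter]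
      simp only [Complex.add_re, Complex.mul_re, Complex.im_ofReal_mul,
        Complex.I_re, Complex.I_im, Complex.ofReal_re, Complex.ofReal_im]
      ring
    have hr : (kiteLoop (a i) y₀ M (3 / 4)).re = (a i).re + M⁻¹ * (y₀ - a i).im := by
      rw [kiteLoop, kite_three_quarters]
      simp only [Complex.add_re, Complex.mul_re, Complex.neg_re, Complex.neg_im,
        Complex.im_ofReal_mul, Complex.I_re, Complex.I_im, Complex.ofReal_re,
        Complex.ofReal_im]
      ring
    refine ⟨by linarith, by linarith, fun j hj => ?_⟩
    have c1 := close i j hj.symm (1 / 4) le_rfl (by norm_num)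
    have c2 := close i j hj.symm (3 / 4) (by norm_num) le_rfl
    rw [abs_lt] at c1 c2
    rcases le_total ((a j).re - (a i).re) 0 with h | h
    · rw [abs_of_nonpos h] at c1 c2
      left
      constructor <;> linarith [c1.1, c2.1]
    · rw [abs_of_nonneg h] at c1 c2
      right
      constructor <;> linarith [c1.2, c2.2]
  · intro i hi y hy t ht hyt
    exact g3 i hi y hy ⟨t, ht, hyt.symm⟩
  · intro y hy
    have := g4 y hy
    rw [mem_ofPred_eq, not_le, max_lt_iff] at this
    refine ⟨this.1, ?_⟩
    have h1 := Complex.re_le_norm y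
    linarith [this.2]

end Positions

/-! ### Images of convex sets -/

section ConvexPaths

variable {V : Type*} [NormedAddCommGroup V] [NormedSpace ℝ V] {E : Type*} [TopologicalSpace E]
  {S : Set E} {K : Set V} {g : V → E}

theorem Convex.segment_mem {η η' : V} (hK : Convex ℝ K) (h : η ∈ K) (h' : η' ∈ K)
    (s : unitInterval) : (1 - (s : ℝ)) • η + (s : ℝ) • η' ∈ K :=
  hK h h' (by linarith [s.2.2]) s.2.1 (by ring)

/-- The image of the segment from `η` to `η'`. -/
def convexPath (hK : Convex ℝ K) (hg : ContinuousOn g K) (hS : ∀ x ∈ K, g x ∈ S) {η η' : V}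
    (h : η ∈ K) (h' : η' ∈ K) {p q : ↥S} (hp : g η = p) (hq : g η' = q) : Path p q :=
  subsetPath (fun s => g ((1 - (s : ℝ)) • η + (s : ℝ) • η'))
    (hg.comp_continuous (by fun_prop) (Convex.segment_mem hK h h'))
    (fun s => hS _ (Convex.segment_mem hK h h' s)) (by simpa using hp) (by simpa using hq)

@[simp] theorem convexPath_apply (hK : Convex ℝ K) (hg : ContinuousOn g K)
    (hS : ∀ x ∈ K, g x ∈ S) {η η' : V} (h : η ∈ K) (h' : η' ∈ K) {p q : ↥S} (hp : g η = p)
    (hq : g η' = q) (s : unitInterval) :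
    (convexPath hK hg hS h h' hp hq s : E) = g ((1 - (s : ℝ)) • η + (s : ℝ) • η') := rfl

/-- Straight-line homotopy in the parameters. A class of paths that lift to the convex set is thus
determined by the parameters of its ends; this is applied to the angle on a circle and to `log x` on
`W`. -/
theorem hc_eq_convexPath (hK : Convex ℝ K) (hg : ContinuousOn g K) (hS : ∀ x ∈ K, g x ∈ S)
    {η η' : V} (h : η ∈ K) (h' : η' ∈ K) {p q : ↥S} (hp : g η = p) (hq : g η' = q)
    (γ : Path p q) (α : unitInterval → V) (hα : Continuous α) (hαK : ∀ t, α t ∈ K)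
    (h0 : α 0 = η) (h1 : α 1 = η') (hγ : ∀ t, (γ t : E) = g (α t)) :
    hc(γ) = hc(convexPath hK hg hS h h' hp hq) := by
  have hmem : ∀ x : unitInterval × unitInterval,
      (1 - (x.1 : ℝ)) • α x.2 + (x.1 : ℝ) • ((1 - (x.2 : ℝ)) • η + (x.2 : ℝ) • η') ∈ K :=
    fun x => Convex.segment_mem hK (hαK _) (Convex.segment_mem hK h h' _) _
  refine hc_eq_of_square (fun x : unitInterval × unitInterval =>
      g ((1 - (x.1 : ℝ)) • α x.2 + (x.1 : ℝ) • ((1 - (x.2 : ℝ)) • η + (x.2 : ℝ) • η')))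
    (hg.comp_continuous (by fun_prop) hmem) (fun x => hS _ (hmem x)) _ _
    (fun s => by simp [hγ]) (fun s => by simp) (fun s => ?_) fun s => ?_
  · rw [← hp]; simp [h0, ← add_smul]
  · rw [← hq]; simp [h1, ← add_smul]

theorem convexPath_trans (hK : Convex ℝ K) (hg : ContinuousOn g K) (hS : ∀ x ∈ K, g x ∈ S)
    {η η' η'' : V} (h : η ∈ K) (h' : η' ∈ K) (h'' : η'' ∈ K) {p q r : ↥S} (hp : g η = p)
    (hq : g η' = q) (hr : g η'' = r) :
    hc(convexPath hK hg hS h h' hp hq).trans hc(convexPath hK hg hS h' h'' hq hr) =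
      hc(convexPath hK hg hS h h'' hp hr) := by
  rw [← Path.Homotopic.Quotient.mk_trans]
  let α : Path η η' :=
    { toFun := fun s => (1 - (s : ℝ)) • η + (s : ℝ) • η', continuous_toFun := by fun_prop,
      source' := by simp, target' := by simp }
  let β : Path η' η'' :=
    { toFun := fun s => (1 - (s : ℝ)) • η' + (s : ℝ) • η'', continuous_toFun := by fun_prop,
      source' := by simp, target' := by simp }
  have hmem : ∀ t, α.trans β t ∈ K := by
    intro t
    rw [Path.trans_apply]
    split_ifs
    · exact Convex.segment_mem hK h h' _
    · exact Convex.segment_mem hK h' h'' _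
  refine hc_eq_convexPath hK hg hS h h'' hp hr _ (α.trans β) (α.trans β).continuous hmem
    (α.trans β).source (α.trans β).target fun t => ?_
  rw [Path.trans_apply, Path.trans_apply]
  split_ifs <;> rfl

/-- Here `v` is a period of `g`, such as `2π` for the angle or `2πi` for the logarithm. -/
theorem convexPath_translate (hK : Convex ℝ K) (hg : ContinuousOn g K) (hS : ∀ x ∈ K, g x ∈ S)
    {η η' v : V} (h : η ∈ K) (h' : η' ∈ K) (hv : η + v ∈ K) (hv' : η' + v ∈ K)
    (per : ∀ x ∈ K, g (x + v) = g x) {p q : ↥S} (hp : g η = p) (hq : g η' = q)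
    (hp' : g (η + v) = p) (hq' : g (η' + v) = q) :
    convexPath hK hg hS hv hv' hp' hq' = convexPath hK hg hS h h' hp hq := by
  apply Path.ext
  funext s
  apply Subtype.ext
  rw [convexPath_apply, convexPath_apply, ← per _ (Convex.segment_mem hK h h' s)]
  congr 1
  module

end ConvexPaths

/-! ### Circles around several punctures -/

section Circles

variable {k : ℕ} {a : Fin k → ℂ} {H : Type*} [Group H] {ρ : ℝ}

/-- On a common vertical line a point inside the circle has the smaller absolute imaginary part, so
a point of the upper half circle lies above it. The punctures outside lie to the right of the whole
circle. -/
theorem circle_mem_slitDown (h : ∀ i, ‖a i‖ < ρ ∨ ρ < (a i).re) {y : ℂ}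
    (hy : ‖y‖ = ρ) (hy' : 0 ≤ y.im) : y ∈ slitDown a := by
  rintro i ⟨h1, h2⟩
  rcases h i with h3 | h3
  · have h4 : ‖a i‖ ^ 2 < ‖y‖ ^ 2 := by rw [hy]; gcongr
    rw [← Complex.normSq_eq_norm_sq, ← Complex.normSq_eq_norm_sq, Complex.normSq_apply,
      Complex.normSq_apply, h1] at h4
    nlinarith
  · linarith [Complex.re_le_norm y]

theorem circle_mem_slitUp (h : ∀ i, ‖a i‖ < ρ ∨ ρ < (a i).re) {y : ℂ}
    (hy : ‖y‖ = ρ) (hy' : y.im ≤ 0) : y ∈ slitUp a := by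
  rintro i ⟨h1, h2⟩
  rcases h i with h3 | h3
  · have h4 : ‖a i‖ ^ 2 < ‖y‖ ^ 2 := by rw [hy]; gcongr
    rw [← Complex.normSq_eq_norm_sq, ← Complex.normSq_eq_norm_sq, Complex.normSq_apply,
      Complex.normSq_apply, h1] at h4
    nlinarith
  · linarith [Complex.re_le_norm y]

theorem circle_subset (h : ∀ i, ‖a i‖ < ρ ∨ ρ < (a i).re) {y : ℂ}
    (hy : ‖y‖ = ρ) : y ∈ (range a)ᶜ := by
  rcases le_total 0 y.im with h' | h'
  · exact slitDown_subset a (circle_mem_slitDown h hy h')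
  · exact slitUp_subset a (circle_mem_slitUp h hy h')

/-- The point at the angle `θ` of the circle of radius `ρ`. -/
def anglePoint (ρ θ : ℝ) : ℂ := ρ * Complex.exp (θ * Complex.I)

theorem continuous_anglePoint (ρ : ℝ) : Continuous (anglePoint ρ) := by
  unfold anglePoint; fun_prop

theorem norm_anglePoint (hρ : 0 < ρ) (θ : ℝ) : ‖anglePoint ρ θ‖ = ρ := by
  rw [anglePoint, norm_mul, Complex.norm_exp_ofReal_mul_I, mul_one, Complex.norm_real,
    Real.norm_of_nonneg hρ.le]

theorem anglePoint_im (ρ θ : ℝ) : (anglePoint ρ θ).im = ρ * Real.sin θ := by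
  rw [anglePoint, Complex.im_ofReal_mul, Complex.exp_ofReal_mul_I_im]

theorem anglePoint_add (ρ θ : ℝ) (j : ℤ) :
    anglePoint ρ (θ + 2 * Real.pi * j) = anglePoint ρ θ := by
  rw [anglePoint, anglePoint, Complex.exp_eq_exp_iff_exists_int.mpr ⟨j, ?_⟩]
  push_cast; ring

/-- The holonomy along a path on a circle which contains some of the punctures, while the other
ones lie to the right of it. -/
theorem val_circle (hρ : 0 < ρ) (ha : ∀ i, ‖a i‖ < ρ ∨ ρ < (a i).re) (h : Fin k → H)
    (φ : Holonomy ↥(range a)ᶜ H)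
    (hφ : ∀ {p q : ↥(range a)ᶜ} (γ : Path p q), (∀ t, (γ t : ℂ) ∈ slitDown a) → φ.val hc(γ) = 1)
    (hφ' : ∀ {p q : ↥(range a)ᶜ} (γ : Path p q), (∀ t, (γ t : ℂ) ∈ slitUp a) →
      φ.val hc(γ) = leftProduct a h q * (leftProduct a h p)⁻¹)
    {p q : ↥(range a)ᶜ} (γ : Path p q) (θ : unitInterval → ℝ) (hθ : Continuous θ)
    (hγ : ∀ t, (γ t : ℂ) = anglePoint ρ (θ t)) (j : ℤ) (h1 : θ 1 = θ 0 + 2 * Real.pi * j)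
    (h0 : θ 0 ∈ Icc 0 Real.pi) : φ.val hc(γ) = leftProduct a h ρ ^ j := by
  have hpi := Real.pi_pos
  have hS : ∀ x ∈ (univ : Set ℝ), anglePoint ρ x ∈ (range a)ᶜ := fun x _ =>
    circle_subset ha (norm_anglePoint hρ x)
  have hg := (continuous_anglePoint ρ).continuousOn (s := univ)
  let pt : ℝ → ↥(range a)ᶜ := fun x => ⟨anglePoint ρ x, hS x (mem_univ x)⟩
  let P : ∀ x y : ℝ, Path (pt x) (pt y) := fun x y =>
    convexPath convex_univ hg hS (mem_univ x) (mem_univ y) rfl rfl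
  let κ : ℝ → ℝ → H := fun x y => φ.val hc(P x y)
  have κ_trans : ∀ x y z, κ x z = κ y z * κ x y := by
    intro x y z
    simp only [κ, P]
    rw [← φ.val_trans, convexPath_trans]
  have pt_add : ∀ x (i : ℤ), pt (x + 2 * Real.pi * i) = pt x := fun x i =>
    Subtype.ext (anglePoint_add ρ x i)
  have gen : ∀ {x y x' y' : ℝ} (hx : anglePoint ρ x' = pt x) (hy : anglePoint ρ y' = pt y),
      κ x' y' = φ.val hc(convexPath convex_univ hg hS (mem_univ x') (mem_univ y') hx hy) := by
    intro x y x' y' hx hy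
    have : ∀ (u v : ↥(range a)ᶜ) (hu : pt x' = u) (hv : pt y' = v), κ x' y' =
        φ.val hc(convexPath convex_univ hg hS (mem_univ x') (mem_univ y')
          (congrArg Subtype.val hu) (congrArg Subtype.val hv)) := by
      rintro _ _ rfl rfl
      rfl
    exact this (pt x) (pt y) (Subtype.ext hx) (Subtype.ext hy)
  have κ_add : ∀ x y (i : ℤ), κ (x + 2 * Real.pi * i) (y + 2 * Real.pi * i) = κ x y := by
    intro x y i
    rw [gen (anglePoint_add ρ x i) (anglePoint_add ρ y i)]
    simp only [κ, P]
    rw [convexPath_translate convex_univ hg hS (mem_univ x) (mem_univ y) _ _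
      (fun x _ => anglePoint_add ρ x i) rfl rfl]
  have up : ∀ x y, x ∈ Icc 0 Real.pi → y ∈ Icc 0 Real.pi → κ x y = 1 := by
    intro x y hx hy
    refine hφ _ fun t => circle_mem_slitDown ha (norm_anglePoint hρ _) ?_
    simp only [P, convexPath_apply, anglePoint_im]
    have := Convex.segment_mem (convex_Icc 0 Real.pi) hx hy t
    exact mul_nonneg hρ.le (Real.sin_nonneg_of_nonneg_of_le_pi this.1 this.2)
  -- The lower half circle lies in `slitUp a` and runs from `-ρ`, which has no puncture on its left,
  -- to `ρ`; it carries the whole value of a full turn.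
  have down : κ Real.pi (2 * Real.pi) = leftProduct a h ρ := by
    have e1 : anglePoint ρ Real.pi = -ρ := by simp [anglePoint]
    have e2 : anglePoint ρ (2 * Real.pi) = ρ := by simp [anglePoint]
    simp only [κ]
    rw [hφ' _ fun t => circle_mem_slitUp ha (norm_anglePoint hρ _) ?_]
    · simp only [pt]
      rw [e1, e2]
      have : leftProduct a h (-ρ : ℂ) = 1 := by
        unfold leftProduct
        apply List.prod_eq_one
        intro x hx
        rw [List.mem_ofFn] at hx
        obtain ⟨i, rfl⟩ := hx
        rw [if_neg]
        rw [Complex.neg_re, Complex.ofReal_re, not_lt]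
        rcases ha i with h | h
        · linarith [(abs_le.mp (Complex.abs_re_le_norm (a i))).1]
        · linarith
      rw [this, inv_one, mul_one]
    · simp only [P, convexPath_apply, anglePoint_im]
      have := Convex.segment_mem (convex_Icc Real.pi (2 * Real.pi))
        (left_mem_Icc.mpr (by linarith)) (right_mem_Icc.mpr (by linarith)) t
      refine mul_nonpos_of_nonneg_of_nonpos hρ.le ?_
      rw [← Real.sin_sub_two_pi]
      exact Real.sin_nonpos_of_nonpos_of_neg_pi_le (by linarith [this.2]) (by linarith [this.1])
  have z0 : (0 : ℝ) ∈ Icc 0 Real.pi := ⟨le_rfl, hpi.le⟩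
  have zp : Real.pi ∈ Icc 0 Real.pi := ⟨hpi.le, le_rfl⟩
  have once : κ 0 (2 * Real.pi) = leftProduct a h ρ := by
    rw [κ_trans 0 Real.pi, down, up _ _ z0 zp, mul_one]
  have pow : ∀ i : ℤ, κ 0 (2 * Real.pi * i) = leftProduct a h ρ ^ i := by
    have step : ∀ i : ℤ, κ 0 (2 * Real.pi * (i + 1 : ℤ)) =
        leftProduct a h ρ * κ 0 (2 * Real.pi * i) := by
      intro i
      rw [κ_trans 0 (2 * Real.pi * i)]
      congr 1
      rw [← once, ← κ_add 0 (2 * Real.pi) i]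
      congr 1
      · ring
      · push_cast; ring
    intro i
    induction i using Int.induction_on with
    | zero => simpa using up 0 0 z0 z0
    | succ i ih => rw [step, ih, ← zpow_one_add, add_comm]
    | pred i ih =>
      have := step (-i - 1)
      rw [sub_add_cancel, ih] at this
      apply mul_left_cancel (a := leftProduct a h ρ)
      rw [← this, ← zpow_one_add, add_sub_cancel]
  have hp : anglePoint ρ (θ 0) = p := by rw [← hγ, γ.source]
  have hq : anglePoint ρ (θ 1) = q := by rw [← hγ, γ.target]
  have e : φ.val hc(γ) = κ (θ 0) (θ 1) := by
    rw [hc_eq_convexPath convex_univ hg hS (mem_univ (θ 0)) (mem_univ (θ 1)) hp hq γ θ hθ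
      (fun t => mem_univ _) rfl rfl hγ]
    obtain rfl : pt (θ 0) = p := Subtype.ext hp
    obtain rfl : pt (θ 1) = q := Subtype.ext hq
    rfl
  -- Both ends are moved along the upper half circle to angles which are multiples of `2π`, at no
  -- cost.
  rw [e, h1, κ_trans _ (0 + 2 * Real.pi * j), κ_add, κ_trans (θ 0) 0 (0 + 2 * Real.pi * j), up _ _ h0 z0, zero_add, pow,
    up _ _ z0 h0, one_mul, mul_one]

end Circles

/-! ### The normal form: constant branches and one branch going to infinity -/

/-- The data of `m` constant branches `y = c i` and of the branch `q(x) y = 1`, where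
`q(x) = xⁿ exp (ℓ x)`, over the disc of radius `r`, in a position adapted to the fibre over `x₀`. -/
structure NormalForm (m n : ℕ) where
  /-- radius of the disc -/
  r : ℝ
  /-- the constant branches -/
  c : Fin m → ℂ
  /-- the logarithm of the unit factor -/
  ℓ : ℂ → ℂ
  /-- a bound for the constant branches -/
  R : ℝ
  /-- the base point of the disc -/
  x₀ : ℂ
  n_pos : 1 ≤ n
  continuous_ℓ : Continuous ℓ
  R_pos : 0 < R
  norm_c_lt : ∀ i, ‖c i‖ < R
  small : ∀ x ∈ Metric.ball (0 : ℂ) r, ‖x ^ n * Complex.exp (ℓ x)‖ * (4 * R) < 1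
  x₀_mem : x₀ ∈ Metric.ball (0 : ℂ) r
  x₀_ne : x₀ ≠ 0
  strictAnti : StrictAnti fun i : Fin (m + 1) =>
    ((Fin.cons (x₀ ^ n * Complex.exp (ℓ x₀))⁻¹ c : Fin (m + 1) → ℂ) i).re
  im_pos : 0 < (x₀ ^ n * Complex.exp (ℓ x₀))⁻¹.im
  im_lt_re : (x₀ ^ n * Complex.exp (ℓ x₀))⁻¹.im < (x₀ ^ n * Complex.exp (ℓ x₀))⁻¹.re

namespace NormalForm

variable {m n : ℕ} (N : NormalForm m n)

def q (x : ℂ) : ℂ := x ^ n * Complex.exp (N.ℓ x)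

/-- The punctures of the fibre over `x₀`. -/
def a : Fin (m + 1) → ℂ := Fin.cons (N.q N.x₀)⁻¹ N.c

/-- The union of the branches. -/
def curve : Set (ℂ × ℂ) := {p | p.2 ∈ range N.c ∨ N.q p.1 * p.2 = 1}

abbrev E : Set (ℂ × ℂ) := complementOver (Metric.ball 0 N.r) N.curve

abbrev F : Set ℂ := (range N.a)ᶜ

@[fun_prop] theorem continuous_q : Continuous N.q := by
  have := N.continuous_ℓ
  unfold q
  fun_prop

@[simp] theorem a_zero : N.a 0 = (N.q N.x₀)⁻¹ := rfl
@[simp] theorem a_succ (i : Fin m) : N.a i.succ = N.c i := rfl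

theorem q_ne {x : ℂ} (hx : x ≠ 0) : N.q x ≠ 0 :=
  mul_ne_zero (pow_ne_zero _ hx) (Complex.exp_ne_zero _)

theorem ne_of_q_ne {x : ℂ} (hx : N.q x ≠ 0) : x ≠ 0 := by
  rintro rfl
  have := N.n_pos
  simp [q, show n ≠ 0 by omega] at hx

theorem q_small {x : ℂ} (hx : x ∈ Metric.ball 0 N.r) : ‖N.q x‖ * (4 * N.R) < 1 := N.small x hx

theorem mem_E {p : ℂ × ℂ} :
    p ∈ N.E ↔ p.1 ∈ Metric.ball 0 N.r ∧ p.2 ∉ range N.c ∧ N.q p.1 * p.2 ≠ 1 := by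
  simp [complementOver, curve]

theorem mem_F {y : ℂ} : y ∈ N.F ↔ y ∉ range N.c ∧ N.q N.x₀ * y ≠ 1 := by
  have h := N.q_ne N.x₀_ne
  have h1 : (∃ i, N.a i = y) ↔ N.q N.x₀ * y = 1 ∨ ∃ i, N.c i = y := by
    rw [Fin.exists_fin_succ]
    simp only [a_zero, a_succ]
    have h2 : (N.q N.x₀)⁻¹ = y ↔ N.q N.x₀ * y = 1 := by
      refine ⟨?_, fun h' => (eq_inv_of_mul_eq_one_right h').symm⟩
      rintro rfl
      exact mul_inv_cancel₀ h
    rw [h2]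
  rw [mem_compl_iff, mem_range, h1, mem_range]
  tauto

/-- The inclusion of the fibre. -/
def j : C(↥N.F, ↥N.E) where
  toFun y := ⟨(N.x₀, y), N.mem_E.mpr ⟨N.x₀_mem, N.mem_F.mp y.2⟩⟩
  continuous_toFun := by fun_prop

theorem notMem_range_c {y : ℂ} (hy : N.R ≤ ‖y‖) : y ∉ range N.c := by
  rintro ⟨i, rfl⟩
  exact absurd (N.norm_c_lt i) (not_lt.mpr hy)

/-- The condition `small` separates the branches: the region `|q(x) y| ≥ 1 / 2`, which contains the
branch to infinity, is disjoint from the disc of radius `2R`, hence from the constant branches. -/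
theorem two_R_lt {x y : ℂ} (hx : x ∈ Metric.ball 0 N.r) (h : 1 / 2 ≤ ‖N.q x * y‖) :
    2 * N.R < ‖y‖ := by
  have h1 := N.q_small hx
  have hR := N.R_pos
  rw [norm_mul] at h
  by_contra! h2
  have : ‖N.q x‖ * ‖y‖ ≤ ‖N.q x‖ * (2 * N.R) := by gcongr
  linarith

theorem mem_E_of_half_le {x y : ℂ} (hx : x ∈ Metric.ball 0 N.r) (h : 1 / 2 ≤ ‖N.q x * y‖)
    (h1 : N.q x * y ≠ 1) : (x, y) ∈ N.E :=
  N.mem_E.mpr ⟨hx, N.notMem_range_c (by linarith [N.two_R_lt hx h, N.R_pos]), h1⟩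

/-- The factor by which points are moved into the disc of radius `2R`. -/
def shrink (y : ℂ) : ℝ := 2 * N.R / max ‖y‖ (2 * N.R)

theorem max_pos (y : ℂ) : 0 < max ‖y‖ (2 * N.R) := lt_max_of_lt_right (by linarith [N.R_pos])

@[fun_prop] theorem continuous_shrink : Continuous N.shrink := by
  unfold shrink
  have h : ∀ y, max ‖y‖ (2 * N.R) ≠ 0 := fun y => (N.max_pos y).ne'
  fun_prop (disch := exact h)

theorem shrink_pos (y : ℂ) : 0 < N.shrink y := div_pos (by linarith [N.R_pos]) (N.max_pos y)

theorem shrink_le_one (y : ℂ) : N.shrink y ≤ 1 := div_le_one_of_le₀ (le_max_right _ _) (N.max_pos y).le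

theorem shrink_of_le {y : ℂ} (h : ‖y‖ ≤ 2 * N.R) : N.shrink y = 1 := by
  rw [shrink, max_eq_right h, div_self (by linarith [N.R_pos])]

theorem shrink_mul_norm {y : ℂ} (h : 2 * N.R ≤ ‖y‖) : N.shrink y * ‖y‖ = 2 * N.R := by
  rw [shrink, max_eq_left h, div_mul_cancel₀ _ (by linarith [N.R_pos])]

theorem norm_shrink_le (y : ℂ) : N.shrink y * ‖y‖ ≤ 2 * N.R := by
  rcases le_total ‖y‖ (2 * N.R) with h | h
  · rwa [N.shrink_of_le h, one_mul]
  · exact (N.shrink_mul_norm h).le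

/-- Points of the disc of radius `2R` do not move, and the other ones stay outside its interior,
while all `c i` have norm less than `R`. -/
theorem notMem_c_of_shrink {y : ℂ} (hy : y ∉ range N.c) {μ : ℝ} (h : N.shrink y ≤ μ)
    (h1 : μ ≤ 1) : (μ : ℂ) * y ∉ range N.c := by
  rcases le_total ‖y‖ (2 * N.R) with h' | h'
  · rw [N.shrink_of_le h'] at h
    rw [le_antisymm h1 h]
    simpa using hy
  · apply N.notMem_range_c
    rw [norm_mul, Complex.norm_real, Real.norm_of_nonneg ((N.shrink_pos y).le.trans h)]
    have := N.shrink_mul_norm h'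
    have h2 : N.shrink y * ‖y‖ ≤ μ * ‖y‖ := by gcongr
    linarith [N.R_pos]

/-- The plane without the ray `[1, ∞)`. -/
def cut : Set ℂ := {w | ¬ (w.im = 0 ∧ 1 ≤ w.re)}

/-- The part of the complement where `q(x) y` is not in `[1, ∞)`. -/
def A : Set ↥N.E := {p | N.q p.1.1 * p.1.2 ∈ cut}

/-- The part of the complement where `q(x) y` has real part greater than `1`. -/
def W : Set ↥N.E := {p | 1 < (N.q p.1.1 * p.1.2).re}

theorem isOpen_cut : IsOpen cut := by
  have : cut = {w : ℂ | w.im = 0 ∧ 1 ≤ w.re}ᶜ := rfl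
  rw [this, isOpen_compl_iff]
  exact (isClosed_eq Complex.continuous_im continuous_const).inter
    (isClosed_le continuous_const Complex.continuous_re)

theorem isOpen_A : IsOpen N.A := isOpen_cut.preimage (f := fun p : ↥N.E => N.q p.1.1 * p.1.2)
  (by fun_prop)

theorem isOpen_W : IsOpen N.W :=
  isOpen_lt continuous_const (Complex.continuous_re.comp (by fun_prop))

theorem mem_A_or_mem_W (p : ↥N.E) : p ∈ N.A ∨ p ∈ N.W := by
  by_contra! h
  obtain ⟨h1, h2⟩ := h
  simp only [A, cut, W, mem_ofPred_eq, not_not, not_lt] at h1 h2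
  exact (N.mem_E.mp p.2).2.2 (Complex.ext (le_antisymm h2 h1.2) h1.1)

theorem smul_mem_cut {w : ℂ} (hw : w ∈ cut) {μ : ℝ} (h0 : 0 < μ) (h1 : μ ≤ 1) :
    (μ : ℂ) * w ∈ cut := by
  rintro ⟨h2, h3⟩
  rw [Complex.im_ofReal_mul] at h2
  rw [Complex.re_ofReal_mul] at h3
  refine hw ⟨(mul_eq_zero.mp h2).resolve_left h0.ne', ?_⟩
  nlinarith

theorem ne_one_of_mem_cut {w : ℂ} (hw : w ∈ cut) : w ≠ 1 := by
  rintro rfl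
  exact hw ⟨rfl, le_rfl⟩

/-- The deformation of the part `A` into the fibre. -/
def push (p : ℂ × ℂ) (s : ℝ) : ℂ × ℂ :=
  (p.1 + max 0 (2 * s - 1) * (N.x₀ - p.1), (1 - min 1 (2 * s) * (1 - N.shrink p.2) : ℝ) * p.2)

/-- During the first half `y` is contracted radially, and `q(x) y` stays in the cut plane, which is
star-shaped about `0`. During the second half `x` moves straight to `x₀`; now `|y| ≤ 2R`, so that
`|q(x) y| < 1 / 2`. -/
theorem push_mem {p : ↥N.E} (hp : p ∈ N.A) (s : unitInterval) : N.push p s ∈ N.E := by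
  obtain ⟨h1, h2, h3⟩ := N.mem_E.mp p.2
  have l0 := N.shrink_pos p.1.2
  have l1 := N.shrink_le_one p.1.2
  rw [N.mem_E]
  rcases le_total (2 * (s : ℝ)) 1 with hs | hs
  · have e : N.push p s = (p.1.1, (1 - (2 * s) * (1 - N.shrink p.1.2) : ℝ) * p.1.2) := by
      rw [push, max_eq_left (by linarith), min_eq_right hs]; simp
    have hs0 := s.2.1
    have b1 : N.shrink p.1.2 ≤ 1 - (2 * s) * (1 - N.shrink p.1.2) := by nlinarith
    have b2 : 1 - (2 * s) * (1 - N.shrink p.1.2) ≤ 1 := by nlinarith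
    rw [e]
    refine ⟨h1, N.notMem_c_of_shrink h2 b1 b2, ?_⟩
    rw [mul_left_comm]
    exact ne_one_of_mem_cut (smul_mem_cut hp (l0.trans_le b1) b2)
  · have e : N.push p s = (p.1.1 + (2 * s - 1 : ℝ) * (N.x₀ - p.1.1), (N.shrink p.1.2 : ℝ) * p.1.2) := by
      rw [push, max_eq_right (by linarith), min_eq_left hs]; simp
    have hx : p.1.1 + (2 * s - 1 : ℝ) * (N.x₀ - p.1.1) ∈ Metric.ball 0 N.r := by
      have := (convex_ball (0 : ℂ) N.r).add_smul_sub_mem h1 N.x₀_mem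
        (t := 2 * (s : ℝ) - 1) ⟨by linarith, by linarith [s.2.2]⟩
      simpa using this
    rw [e]
    refine ⟨hx, N.notMem_c_of_shrink h2 le_rfl l1, fun h => ?_⟩
    have h4 := N.two_R_lt hx (y := (N.shrink p.1.2 : ℝ) * p.1.2) (by simp only at h; rw [h]; norm_num)
    rw [norm_mul, Complex.norm_real, Real.norm_of_nonneg l0.le] at h4
    linarith [N.norm_shrink_le p.1.2]

/-- The point of the fibre to which a point is moved. -/
def foot (p : ↥N.E) : ↥N.F := ⟨(N.shrink p.1.2 : ℝ) * p.1.2, by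
  rw [N.mem_F]
  refine ⟨N.notMem_c_of_shrink (N.mem_E.mp p.2).2.1 le_rfl (N.shrink_le_one _), fun h => ?_⟩
  have h4 := N.two_R_lt N.x₀_mem (y := (N.shrink p.1.2 : ℝ) * p.1.2) (by rw [h]; norm_num)
  rw [norm_mul, Complex.norm_real, Real.norm_of_nonneg (N.shrink_pos _).le] at h4
  linarith [N.norm_shrink_le p.1.2]⟩

theorem continuous_foot : Continuous N.foot := by
  unfold foot
  fun_prop

theorem continuous_push : Continuous fun x : (ℂ × ℂ) × ℝ => N.push x.1 x.2 := by
  unfold push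
  fun_prop

@[simp] theorem push_zero (p : ℂ × ℂ) : N.push p 0 = p := by simp [push]

@[simp] theorem push_one (p : ℂ × ℂ) : N.push p 1 = (N.x₀, (N.shrink p.2 : ℝ) * p.2) := by
  have h1 : max (0 : ℝ) (2 * 1 - 1) = 1 := by norm_num
  have h2 : min (1 : ℝ) (2 * 1) = 1 := by norm_num
  rw [push, h1, h2]; simp

/-- The path along which a point of `A` is moved into the fibre. -/
def pushPath {p : ↥N.E} (hp : p ∈ N.A) : Path p (N.j (N.foot p)) :=
  subsetPath (fun s => N.push p s)
    (N.continuous_push.comp (f := fun s : unitInterval => (((p : ℂ × ℂ)), (s : ℝ))) (by fun_prop)) (N.push_mem hp)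
    (by simp) (by simp [j, foot])

@[simp] theorem pushPath_apply {p : ↥N.E} (hp : p ∈ N.A) (s : unitInterval) :
    (N.pushPath hp s : ℂ × ℂ) = N.push p s := rfl

/-- Up to the deformation paths at its ends, a path in `A` is a path in the fibre. -/
theorem push_square {p p' : ↥N.E} (γ : Path p p') (hγ : ∀ t, γ t ∈ N.A) (hp : p ∈ N.A)
    (hp' : p' ∈ N.A) : hc(γ).trans hc(N.pushPath hp') =
      hc(N.pushPath hp).trans (hc(γ.map N.continuous_foot).map N.j) := by
  rw [← Path.Homotopic.Quotient.mk_map]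
  refine square_trans_subset (fun x => N.push (γ x.2) x.1) (N.continuous_push.comp
    (f := fun x : unitInterval × unitInterval => ((γ x.2 : ℂ × ℂ), (x.1 : ℝ))) (by fun_prop))
    (fun x => N.push_mem (hγ _) _) _ _ _ _ ?_ ?_ ?_ ?_
  · intro s; simp
  · intro s; simp; rfl
  · intro s; simp
  · intro s; simp

end NormalForm

/-! ### Functoriality of path classes -/

section Groupoid

variable {X Y : Type*} [TopologicalSpace X] [TopologicalSpace Y] {p q r : X}

theorem map_trans (α : Path.Homotopic.Quotient p q) (β : Path.Homotopic.Quotient q r)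
    (f : C(X, Y)) : (α.trans β).map f = (α.map f).trans (β.map f) := by
  induction α using Path.Homotopic.Quotient.ind with | mk α =>
  induction β using Path.Homotopic.Quotient.ind with | mk β =>
  rw [← Path.Homotopic.Quotient.mk_trans, ← Path.Homotopic.Quotient.mk_map, Path.map_trans]
  rfl

theorem map_symm (α : Path.Homotopic.Quotient p q) (f : C(X, Y)) :
    α.symm.map f = (α.map f).symm := by
  induction α using Path.Homotopic.Quotient.ind with | mk α =>
  rfl

end Groupoid

namespace NormalForm

variable {m n : ℕ} (N : NormalForm m n)

theorem q_ne_of_mem_W {p : ↥N.E} (hp : p ∈ N.W) : N.q p.1.1 ≠ 0 := by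
  intro h
  have : 1 < (N.q p.1.1 * p.1.2).re := hp
  rw [h] at this
  norm_num at this

theorem mem_E_of_one_lt {x y : ℂ} (hx : x ∈ Metric.ball 0 N.r) (h : 1 < (N.q x * y).re) :
    (x, y) ∈ N.E := by
  refine N.mem_E_of_half_le hx ?_ fun h' => ?_
  · linarith [Complex.re_le_norm (N.q x * y)]
  · rw [h'] at h; norm_num at h

/-! ### The logarithmic parametrization near the ray -/

/-- The parameters `(q(x) y, log x)` near the ray. -/
def logRegion : Set (ℂ × ℂ) := {ζ | 1 < ζ.1.re ∧ ζ.2.re < Real.log N.r}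

/-- The parametrization by `(q(x) y, log x)`. -/
def lift (ζ : ℂ × ℂ) : ℂ × ℂ := (Complex.exp ζ.2, ζ.1 / N.q (Complex.exp ζ.2))

theorem r_pos : 0 < N.r := (norm_nonneg _).trans_lt (mem_ball_zero_iff.mp N.x₀_mem)

theorem exp_mem_ball {ξ : ℂ} : Complex.exp ξ ∈ Metric.ball (0 : ℂ) N.r ↔ ξ.re < Real.log N.r := by
  rw [mem_ball_zero_iff, Complex.norm_exp, Real.lt_log_iff_exp_lt N.r_pos]

/-- In these coordinates `W` is the quotient of a convex set by the translations of `log x` by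
multiples of `2πi`. -/
theorem convex_logRegion : Convex ℝ N.logRegion :=
  ((convex_halfSpace_gt (f := fun ζ : ℂ × ℂ => ζ.1.re)
      ⟨fun _ _ => rfl, fun c x => by simp⟩ 1).inter
    (convex_halfSpace_lt (f := fun ζ : ℂ × ℂ => ζ.2.re)
      ⟨fun _ _ => rfl, fun c x => by simp⟩ _))

theorem q_exp_ne (ξ : ℂ) : N.q (Complex.exp ξ) ≠ 0 := N.q_ne (Complex.exp_ne_zero _)

theorem continuous_lift : Continuous N.lift := by
  unfold lift
  have := N.q_exp_ne
  have h1 : Continuous fun ζ : ℂ × ℂ => N.q (Complex.exp ζ.2) := by fun_prop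
  exact (by fun_prop : Continuous fun ζ : ℂ × ℂ => Complex.exp ζ.2).prodMk
    (continuous_fst.div h1 fun ζ => this _)

theorem q_lift (ζ : ℂ × ℂ) : N.q (N.lift ζ).1 * (N.lift ζ).2 = ζ.1 :=
  mul_div_cancel₀ _ (N.q_exp_ne _)

theorem lift_mem {ζ : ℂ × ℂ} (hζ : ζ ∈ N.logRegion) : N.lift ζ ∈ N.E :=
  N.mem_E_of_one_lt (N.exp_mem_ball.mpr hζ.2) ((congrArg Complex.re (N.q_lift ζ)).symm ▸ hζ.1)

theorem exists_lift {p : ↥N.E} (hp : p ∈ N.W) :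
    ∃ ξ : ℂ, Complex.exp ξ = p.1.1 ∧ (N.q p.1.1 * p.1.2, ξ) ∈ N.logRegion ∧
      N.lift (N.q p.1.1 * p.1.2, ξ) = p := by
  have h1 := N.q_ne_of_mem_W hp
  have h2 := N.ne_of_q_ne h1
  refine ⟨Complex.log p.1.1, Complex.exp_log h2, ⟨hp, ?_⟩, ?_⟩
  · rw [← N.exp_mem_ball, Complex.exp_log h2]
    exact (N.mem_E.mp p.2).1
  · simp only [lift]
    rw [Complex.exp_log h2, mul_div_cancel_left₀ _ h1]

theorem lift_eq {p : ↥N.E} {ξ : ℂ} (h1 : N.q p.1.1 ≠ 0) (h : Complex.exp ξ = p.1.1) :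
    N.lift (N.q p.1.1 * p.1.2, ξ) = p := by
  simp only [lift]
  rw [h, mul_div_cancel_left₀ _ h1]

/-- The path in the complement with given logarithmic parameters of its ends. -/
abbrev liftPath {ζ ζ' : ℂ × ℂ} (h : ζ ∈ N.logRegion) (h' : ζ' ∈ N.logRegion) {p p' : ↥N.E}
    (hp : N.lift ζ = p) (hp' : N.lift ζ' = p') : Path p p' :=
  convexPath N.convex_logRegion N.continuous_lift.continuousOn (fun _ => N.lift_mem) h h' hp hp'

/-! ### The vertical movement away from the ray -/

/-- The distance by which a point is moved downwards. -/
def drop (w : ℂ) : ℝ := |w.im| + w.im + 1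

/-- The movement of the coordinate `q(x) y` downwards. -/
def vert (p : ℂ × ℂ) (s : ℝ) : ℂ × ℂ :=
  (p.1, (N.q p.1 * p.2 - (s * drop (N.q p.1 * p.2) : ℝ) * Complex.I) / N.q p.1)

theorem vert_mem {p : ↥N.E} (hp : p ∈ N.W) (s : ℝ) : N.vert p s ∈ N.E := by
  refine N.mem_E_of_one_lt (N.mem_E.mp p.2).1 ?_
  rw [mul_div_cancel₀ _ (N.q_ne_of_mem_W hp)]
  have : 1 < (N.q p.1.1 * p.1.2).re := hp
  simpa using this

/-- The end of the vertical movement. -/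
def vertPoint {p : ↥N.E} (hp : p ∈ N.W) : ↥N.E := ⟨N.vert p 1, N.vert_mem hp 1⟩

theorem q_vertPoint {p : ↥N.E} (hp : p ∈ N.W) :
    N.q (N.vertPoint hp).1.1 * (N.vertPoint hp).1.2 =
      N.q p.1.1 * p.1.2 - (drop (N.q p.1.1 * p.1.2) : ℝ) * Complex.I := by
  simp only [vertPoint, vert, one_mul]
  rw [mul_div_cancel₀ _ (N.q_ne_of_mem_W hp)]

theorem mem_A_of_im_ne {p : ↥N.E} (h : (N.q p.1.1 * p.1.2).im ≠ 0) : p ∈ N.A := fun h' => h h'.1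

/-- By the choice of `drop` the new imaginary part is `-|im| - 1`, so every point of `W` ends below
the ray, in `A`. -/
theorem vertPoint_im {p : ↥N.E} (hp : p ∈ N.W) :
    (N.q (N.vertPoint hp).1.1 * (N.vertPoint hp).1.2).im < 0 := by
  rw [N.q_vertPoint, Complex.sub_im, Complex.im_ofReal_mul, Complex.I_im, drop]
  linarith [abs_nonneg (N.q p.1.1 * p.1.2).im]

theorem vertPoint_mem_A {p : ↥N.E} (hp : p ∈ N.W) : N.vertPoint hp ∈ N.A :=
  N.mem_A_of_im_ne (N.vertPoint_im hp).ne

theorem vert_zero {p : ↥N.E} (hp : p ∈ N.W) : N.vert p 0 = p := by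
  simp only [vert, zero_mul, Complex.ofReal_zero, sub_zero]
  rw [mul_div_cancel_left₀ _ (N.q_ne_of_mem_W hp)]

/-- The vertical movement of a point near the ray. -/
def vertPath {p : ↥N.E} (hp : p ∈ N.W) : Path p (N.vertPoint hp) :=
  subsetPath (fun s => N.vert p s) (by unfold vert; fun_prop) (fun s => N.vert_mem hp s)
    (N.vert_zero hp) rfl

@[simp] theorem vertPath_apply {p : ↥N.E} (hp : p ∈ N.W) (s : unitInterval) :
    (N.vertPath hp s : ℂ × ℂ) = N.vert p s := rfl

theorem vert_square {p p' : ↥N.E} (γ : Path p p') (hγ : ∀ t, γ t ∈ N.W) (hp : p ∈ N.W)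
    (hp' : p' ∈ N.W) : ∃ γ' : Path (N.vertPoint hp) (N.vertPoint hp'), (∀ t, γ' t ∈ N.A) ∧
      hc(γ).trans hc(N.vertPath hp') = hc(N.vertPath hp).trans hc(γ') := by
  have hne : ∀ t, N.q (γ t).1.1 ≠ 0 := fun t => N.q_ne_of_mem_W (hγ t)
  have hcont : Continuous fun x : unitInterval × unitInterval => N.vert (γ x.2) x.1 := by
    have hd : Continuous drop := by unfold drop; fun_prop
    unfold vert
    have h1 : Continuous fun x : unitInterval × unitInterval => N.q (γ x.2).1.1 := by fun_prop
    have h2 := h1.mul (by fun_prop : Continuous fun x : unitInterval × unitInterval => (γ x.2).1.2)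
    have h3 : Continuous fun x : unitInterval × unitInterval => (x.1 : ℝ) := by fun_prop
    exact (by fun_prop : Continuous _).prodMk (((h2.sub ((Complex.continuous_ofReal.comp
      (h3.mul (hd.comp h2))).mul continuous_const))).div h1 fun x => hne _)
  refine ⟨subsetPath (fun t => N.vert (γ t) 1)
    (hcont.comp (f := fun t : unitInterval => ((1 : unitInterval), t)) (by fun_prop))
    (fun t => N.vert_mem (hγ t) 1) (by rw [γ.source]; rfl) (by rw [γ.target]; rfl), fun t => ?_, ?_⟩
  · exact N.vertPoint_mem_A (hγ t)
  · refine square_trans_subset (fun x => N.vert (γ x.2) x.1) hcont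
      (fun x => N.vert_mem (hγ _) _) _ _ _ _ ?_ ?_ ?_ ?_
    · intro s; exact (N.vert_zero (hγ s)).symm
    · intro s; rfl
    · intro s; simp
    · intro s; simp

/-! ### Generation by the fibre -/

theorem exists_map_eq {u v : ↥N.F} (γ : Path (N.j u) (N.j v)) (h : ∀ t, (γ t).1.1 = N.x₀) :
    ∃ σ : Path u v, (∀ t, (σ t : ℂ) = (γ t).1.2) ∧ hc(γ) = hc(σ).map N.j := by
  refine ⟨subsetPath (fun t => (γ t).1.2) (by fun_prop) (fun t => ?_) ?_ ?_, fun t => rfl, ?_⟩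
  · rw [N.mem_F]
    have := (N.mem_E.mp (γ t).2).2
    rwa [h t] at this
  · rw [γ.source]; rfl
  · rw [γ.target]; rfl
  · rw [← Path.Homotopic.Quotient.mk_map]
    congr 1
    apply Path.ext
    funext t
    apply Subtype.ext
    exact Prod.ext (h t) rfl

/-- Over `x₀` the second half of the deformation is at rest, and the first half is radial in the
fibre. -/
theorem pushPath_j (u : ↥N.F) (hu : N.j u ∈ N.A) :
    ∃ σ : Path u (N.foot (N.j u)), (∀ t, ∃ μ : ℝ, N.shrink u ≤ μ ∧ μ ≤ 1 ∧ (σ t : ℂ) = μ * u) ∧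
      hc(N.pushPath hu) = hc(σ).map N.j := by
  obtain ⟨σ, h1, h2⟩ := N.exists_map_eq (N.pushPath hu) (fun t => by
    rw [pushPath_apply]; simp [push, j])
  refine ⟨σ, fun t => ⟨1 - min 1 (2 * (t : ℝ)) * (1 - N.shrink u), ?_, ?_, ?_⟩, h2⟩
  · have := N.shrink_le_one u
    have h3 : min 1 (2 * (t : ℝ)) ≤ 1 := min_le_left _ _
    nlinarith
  · have := N.shrink_le_one u
    have h3 : 0 ≤ min 1 (2 * (t : ℝ)) := le_min zero_le_one (by linarith [t.2.1])
    nlinarith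
  · rw [h1, pushPath_apply]; rfl

-- On the intersection of `A` and `W` there are two ways into the fibre: directly, or after a
-- descent below the ray. To compare them, `log x` is first moved to `log x₀` with `q(x) y` fixed,
-- which is possible inside `A` because the imaginary part is not zero; then the descent takes place
-- in the fibre over `x₀`. The commuting squares leave only a path in the fibre as the difference.
open Path.Homotopic.Quotient in
theorem crossing {p : ↥N.E} (hp : p ∈ N.A) (hW : p ∈ N.W) :
    ∃ τ : Path.Homotopic.Quotient (N.foot p) (N.foot (N.vertPoint hW)),
      hc(N.vertPath hW).trans hc(N.pushPath (N.vertPoint_mem_A hW)) =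
        hc(N.pushPath hp).trans (τ.map N.j) := by
  set w := N.q p.1.1 * p.1.2 with hw
  have hq := N.q_ne_of_mem_W hW
  have hwW : 1 < w.re := hW
  have hwA : w.im ≠ 0 := fun h => hp ⟨h, hwW.le⟩
  obtain ⟨ξ, hξ, hζ, hlift⟩ := N.exists_lift hW
  rw [← hw] at hζ hlift
  set w' : ℂ := w - (drop w : ℝ) * Complex.I with hw'
  have hre' : w'.re = w.re := by simp [hw']
  have him' : w'.im < 0 := by
    have := N.vertPoint_im hW
    rwa [N.q_vertPoint] at this
  have hζ' : (w', ξ) ∈ N.logRegion := ⟨by rw [hre']; exact hwW, hζ.2⟩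
  have hlift' : N.lift (w', ξ) = N.vertPoint hW := by
    have := N.lift_eq (p := N.vertPoint hW) (ξ := ξ) hq hξ
    rwa [N.q_vertPoint] at this
  set ξ₀ := Complex.log N.x₀ with hξ₀
  have hx₀ : Complex.exp ξ₀ = N.x₀ := Complex.exp_log N.x₀_ne
  have hξ₀r : ξ₀.re < Real.log N.r := by rw [← N.exp_mem_ball, hx₀]; exact N.x₀_mem
  have hζ₀ : (w, ξ₀) ∈ N.logRegion := ⟨hwW, hξ₀r⟩
  have hζ₀' : (w', ξ₀) ∈ N.logRegion := ⟨hζ'.1, hξ₀r⟩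
  have pt : ∀ v : ℂ, (v, ξ₀) ∈ N.logRegion → ∃ u : ↥N.F, N.lift (v, ξ₀) = N.j u := by
    intro v hv
    refine ⟨⟨v / N.q N.x₀, N.mem_F.mpr ?_⟩, by simp [lift, j, hx₀]⟩
    have := (N.mem_E.mp (N.lift_mem hv)).2
    simpa [lift, hx₀] using this
  obtain ⟨u, hu⟩ := pt w hζ₀
  obtain ⟨u', hu'⟩ := pt w' hζ₀'
  let μ := N.liftPath hζ hζ₀ hlift hu
  let μ' := N.liftPath hζ' hζ₀' hlift' hu'
  let v₀ := N.liftPath hζ₀ hζ₀' hu hu'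
  have memA : ∀ {v : ℂ} {ξ₁ ξ₂ : ℂ} (h1 : (v, ξ₁) ∈ N.logRegion) (h2 : (v, ξ₂) ∈ N.logRegion)
      {a b : ↥N.E} (ha : N.lift (v, ξ₁) = a) (hb : N.lift (v, ξ₂) = b), v.im ≠ 0 →
      ∀ t, N.liftPath h1 h2 ha hb t ∈ N.A := by
    intro v ξ₁ ξ₂ h1 h2 a b ha hb hv t
    apply N.mem_A_of_im_ne
    rw [convexPath_apply, q_lift]
    simp only [Prod.smul_mk, Prod.mk_add_mk, ← add_smul, sub_add_cancel, one_smul]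
    exact hv
  have hμ : ∀ t, μ t ∈ N.A := memA hζ hζ₀ hlift hu hwA
  have hμ' : ∀ t, μ' t ∈ N.A := memA hζ' hζ₀' hlift' hu' him'.ne
  have huA : N.j u ∈ N.A := by simpa using hμ 1
  have huA' : N.j u' ∈ N.A := by simpa using hμ' 1
  have e1 : hc(N.vertPath hW) = hc(N.liftPath hζ hζ' hlift hlift') := by
    refine hc_eq_convexPath _ _ _ hζ hζ' hlift hlift' _
      (fun s => (w - ((s : ℝ) * drop w : ℝ) * Complex.I, ξ)) (by fun_prop) (fun s => ⟨?_, hζ.2⟩)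
      (by simp) (by simp [hw']) fun s => ?_
    · simpa using hwW
    · rw [vertPath_apply]
      simp only [vert, lift, hξ]
      rfl
  have e2 : hc(N.vertPath hW).trans hc(μ') = hc(μ).trans hc(v₀) := by
    rw [e1]
    exact (convexPath_trans N.convex_logRegion N.continuous_lift.continuousOn
      (fun _ => N.lift_mem) hζ hζ' hζ₀' hlift hlift' hu').trans
      (convexPath_trans N.convex_logRegion N.continuous_lift.continuousOn
      (fun _ => N.lift_mem) hζ hζ₀ hζ₀' hlift hu hu').symm
  obtain ⟨σ, -, hσ⟩ := N.exists_map_eq v₀ (fun t => by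
    simp only [v₀, convexPath_apply, lift, Prod.smul_mk, Prod.mk_add_mk, ← add_smul,
      sub_add_cancel, one_smul, hx₀])
  obtain ⟨ρ, -, hρ⟩ := N.pushPath_j u huA
  obtain ⟨ρ', -, hρ'⟩ := N.pushPath_j u' huA'
  have s1 := N.push_square μ hμ hp huA
  have s2 := N.push_square μ' hμ' (N.vertPoint_mem_A hW) huA'
  set κ := hc(μ.map N.continuous_foot)
  set κ' := hc(μ'.map N.continuous_foot)
  rw [hρ] at s1
  rw [hρ'] at s2
  rw [hσ] at e2
  refine ⟨κ.trans (hc(ρ).symm.trans (hc(σ).trans (hc(ρ').trans κ'.symm))), ?_⟩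
  rw [map_trans, map_trans, map_trans, map_trans, map_symm, map_symm]
  generalize hc(N.vertPath hW) = v at *
  generalize hc(N.pushPath hp) = b at *
  generalize hc(N.pushPath (N.vertPoint_mem_A hW)) = b' at *
  generalize hc(μ) = x at *
  generalize hc(μ') = x' at *
  generalize κ.map N.j = k at *
  generalize κ'.map N.j = k' at *
  generalize hc(ρ).map N.j = y at *
  generalize hc(ρ').map N.j = y' at *
  generalize hc(σ).map N.j = z at *
  have h1 : b' = x'.trans (y'.trans k'.symm) := by
    rw [← trans_assoc, s2, trans_assoc, trans_symm, trans_refl]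
  have h2 : x = b.trans (k.trans y.symm) := by
    rw [← trans_assoc, ← s1, trans_assoc, trans_symm, trans_refl]
  rw [h1, ← trans_assoc, e2, h2]
  simp only [trans_assoc]

open Path.Homotopic.Quotient in
/-- Every loop in the complement is homotopic to a loop in the fibre. -/
theorem exists_fibre_loop (y₀ : ↥N.F) (hA : N.j y₀ ∈ N.A)
    (α : Path.Homotopic.Quotient (N.j y₀) (N.j y₀)) :
    ∃ σ : Path.Homotopic.Quotient y₀ y₀, α = σ.map N.j := by
  -- A class starting at the base point is admissible if its continuation into the fibre, directly
  -- from `A` or by the descent from `W`, comes from a class in the fibre. By `crossing` the two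
  -- conditions agree where both apply, so admissibility persists along paths in either member of
  -- the cover.
  let Adm : ∀ {p : ↥N.E}, Path.Homotopic.Quotient (N.j y₀) p → Prop := fun {p} α =>
    (∀ hp : p ∈ N.A, ∃ σ : Path.Homotopic.Quotient y₀ (N.foot p),
      α.trans hc(N.pushPath hp) = σ.map N.j) ∧
    ∀ hW : p ∈ N.W, ∃ σ : Path.Homotopic.Quotient y₀ (N.foot (N.vertPoint hW)),
      α.trans (hc(N.vertPath hW).trans hc(N.pushPath (N.vertPoint_mem_A hW))) = σ.map N.j
  have mkA : ∀ {p : ↥N.E} (α : Path.Homotopic.Quotient (N.j y₀) p) (hp : p ∈ N.A),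
      (∃ σ : Path.Homotopic.Quotient y₀ (N.foot p), α.trans hc(N.pushPath hp) = σ.map N.j) →
      Adm α := by
    rintro p α hp ⟨σ, hσ⟩
    refine ⟨fun _ => ⟨σ, hσ⟩, fun hW => ?_⟩
    obtain ⟨τ, hτ⟩ := N.crossing hp hW
    exact ⟨σ.trans τ, by rw [hτ, ← trans_assoc, hσ, map_trans]⟩
  have mkW : ∀ {p : ↥N.E} (α : Path.Homotopic.Quotient (N.j y₀) p) (hW : p ∈ N.W),
      (∃ σ : Path.Homotopic.Quotient y₀ (N.foot (N.vertPoint hW)),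
        α.trans (hc(N.vertPath hW).trans hc(N.pushPath (N.vertPoint_mem_A hW))) = σ.map N.j) →
      Adm α := by
    rintro p α hW ⟨σ, hσ⟩
    refine ⟨fun hp => ?_, fun _ => ⟨σ, hσ⟩⟩
    obtain ⟨τ, hτ⟩ := N.crossing hp hW
    refine ⟨σ.trans τ.symm, ?_⟩
    rw [map_trans, map_symm, ← hσ, hτ]
    simp only [trans_assoc, trans_symm, trans_refl]
  have key : ∀ {p q : ↥N.E} (γ : Path.Homotopic.Quotient p q)
      (α : Path.Homotopic.Quotient (N.j y₀) p), Adm α → Adm (α.trans γ) := by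
    intro p q γ
    refine pathClass_induction (U := fun b : Bool => if b then N.A else N.W)
      (Q := fun {p q} γ => ∀ α : Path.Homotopic.Quotient (N.j y₀) p, Adm α → Adm (α.trans γ))
      ?_ ?_ ?_ ?_ γ
    · rintro (b | b)
      · exact N.isOpen_W
      · exact N.isOpen_A
    · intro p
      rcases N.mem_A_or_mem_W p with h | h
      · exact ⟨true, h⟩
      · exact ⟨false, h⟩
    · intro p q r β β' h h' α hα
      rw [← trans_assoc]
      exact h' _ (h _ hα)
    · rintro (b | b) p q δ hδ α ⟨h1, h2⟩
      · have hδ : ∀ t, δ t ∈ N.W := by simpa using hδ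
        have hp : p ∈ N.W := by simpa using hδ 0
        have hq : q ∈ N.W := by simpa using hδ 1
        obtain ⟨δ', hδ', e⟩ := N.vert_square δ hδ hp hq
        obtain ⟨σ, hσ⟩ := h2 hp
        refine mkW _ hq ⟨σ.trans hc(δ'.map N.continuous_foot), ?_⟩
        rw [trans_assoc, ← trans_assoc hc(δ), e, trans_assoc,
          N.push_square δ' hδ' (N.vertPoint_mem_A hp) (N.vertPoint_mem_A hq), map_trans, ← hσ]
        simp only [trans_assoc]
      · have hδ : ∀ t, δ t ∈ N.A := by simpa using hδ
        have hp : p ∈ N.A := by simpa using hδ 0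
        have hq : q ∈ N.A := by simpa using hδ 1
        obtain ⟨σ, hσ⟩ := h1 hp
        refine mkA _ hq ⟨σ.trans hc(δ.map N.continuous_foot), ?_⟩
        rw [trans_assoc, N.push_square δ hδ hp hq, ← trans_assoc, hσ, map_trans]
  obtain ⟨ρ, -, hρ⟩ := N.pushPath_j y₀ hA
  have start : Adm (Path.Homotopic.Quotient.refl (N.j y₀)) :=
    mkA _ hA ⟨hc(ρ), by rw [refl_trans, hρ]⟩
  obtain ⟨σ, hσ⟩ := (key α _ start).1 hA
  refine ⟨σ.trans hc(ρ).symm, ?_⟩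
  rw [map_trans, map_symm, ← hσ, hρ]
  simp only [refl_trans, trans_assoc, trans_symm, trans_refl]

end NormalForm

namespace NormalForm

variable {m n : ℕ} (N : NormalForm m n)

/-! ### The base point and the kite about the branch at infinity -/

theorem a_zero_ne : N.a 0 ≠ 0 := inv_ne_zero (N.q_ne N.x₀_ne)

theorem q_eq_inv : N.q N.x₀ = (N.a 0)⁻¹ := by simp

theorem a_im_pos : 0 < (N.a 0).im := N.im_pos

theorem a_im_lt_re : (N.a 0).im < (N.a 0).re := N.im_lt_re

theorem norm_a_zero_lt : ‖N.a 0‖ < 2 * (N.a 0).re := by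
  have h1 := N.a_im_pos
  have h2 := N.a_im_lt_re
  refine lt_of_pow_lt_pow_left₀ 2 (by linarith) ?_
  rw [← Complex.normSq_eq_norm_sq, Complex.normSq_apply]
  nlinarith

theorem four_R_lt : 4 * N.R < ‖N.a 0‖ := by
  have h := N.q_small N.x₀_mem
  rw [q_eq_inv, norm_inv, inv_mul_lt_iff₀ (norm_pos_iff.mpr N.a_zero_ne), mul_one] at h
  exact h

theorem two_R_lt_a_re : 2 * N.R < (N.a 0).re := by
  linarith [N.four_R_lt, N.norm_a_zero_lt]

/-- As `q(x₀) = 1 / a 0` and the vertex is `a 0 + iL`, the image of the kite is star-shaped about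
`1`, with vertex in the direction of `i / a 0`, that is of `Im (a 0) + i Re (a 0)`. The argument `φ`
of this direction lies between `π / 4` and `π / 2`, since `0 < Im (a 0) < Re (a 0)`. -/
theorem q_mul_kiteLoop (L M t : ℝ) :
    N.q N.x₀ * kiteLoop (N.a 0) (highPoint N.a L) M t =
      1 + (L / Complex.normSq (N.a 0) * (kiteGauge M (unitPoint t))⁻¹ : ℝ) *
        (⟨(N.a 0).im, (N.a 0).re⟩ * unitPoint t) := by
  have h := N.a_zero_ne
  have h1 : (Complex.normSq (N.a 0) : ℂ) ≠ 0 := by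
    exact_mod_cast (Complex.normSq_pos.mpr h).ne'
  have h2 : (⟨(N.a 0).im, (N.a 0).re⟩ : ℂ) * N.a 0 = Complex.I * Complex.normSq (N.a 0) := by
    generalize N.a 0 = α
    apply Complex.ext <;> simp [Complex.normSq_apply] <;> ring
  rw [q_eq_inv, kiteLoop, kite, highPoint, add_sub_cancel_left]
  push_cast
  generalize ((kiteGauge M (unitPoint t) : ℝ) : ℂ)⁻¹ = k
  generalize unitPoint t = z
  rw [inv_mul_eq_iff_eq_mul₀ h, mul_add, mul_one]
  congr 1
  calc (L : ℂ) * Complex.I * (k * z)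
      = (L / Complex.normSq (N.a 0) * k * z) * (Complex.I * Complex.normSq (N.a 0)) := by
        field_simp
    _ = _ := by rw [← h2]; ring

theorem q_mul_kiteLoop_re_im {L M : ℝ} (hL : 0 < L) (hM : 1 ≤ M) (t : ℝ) :
    ∃ s : ℝ, 0 < s ∧
      (N.q N.x₀ * kiteLoop (N.a 0) (highPoint N.a L) M t).re = 1 + s * ((N.a 0).im *
        Real.cos (2 * Real.pi * t) - (N.a 0).re * Real.sin (2 * Real.pi * t)) ∧
      (N.q N.x₀ * kiteLoop (N.a 0) (highPoint N.a L) M t).im = s * ((N.a 0).im *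
        Real.sin (2 * Real.pi * t) + (N.a 0).re * Real.cos (2 * Real.pi * t)) := by
  refine ⟨_, mul_pos (div_pos hL (Complex.normSq_pos.mpr N.a_zero_ne))
    (inv_pos.mpr (kiteGauge_pos hM (unitPoint_ne_zero t))), ?_, ?_⟩
  · rw [q_mul_kiteLoop, Complex.add_re, Complex.re_ofReal_mul, Complex.one_re, Complex.mul_re,
      unitPoint_eq]
  · rw [q_mul_kiteLoop, Complex.add_im, Complex.im_ofReal_mul, Complex.one_im, Complex.mul_im,
      unitPoint_eq, zero_add]

/-- Seen from `1`, the point at `t` has argument `φ + 2πt` with `π / 4 < φ < π / 2`. For `t ≤ 5 / 8`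
this is strictly between `0` and `2π`, so the ray `[1, ∞)` is not met. -/
theorem kite_mem_cut {L M : ℝ} (hL : 0 < L) (hM : 1 ≤ M) {t : ℝ} (h0 : 0 ≤ t) (h1 : t ≤ 5 / 8) :
    N.q N.x₀ * kiteLoop (N.a 0) (highPoint N.a L) M t ∈ cut := by
  obtain ⟨s, hs, hre, him⟩ := N.q_mul_kiteLoop_re_im hL hM t
  have hu := N.a_im_pos
  have hv := N.a_im_lt_re
  have hpi := Real.pi_pos
  set u := (N.a 0).im
  set v := (N.a 0).re
  have hsc := Real.sin_sq_add_cos_sq (2 * Real.pi * t)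
  rintro ⟨h2, h3⟩
  rw [hre] at h3
  rw [him] at h2
  have h4 : u * Real.sin (2 * Real.pi * t) + v * Real.cos (2 * Real.pi * t) = 0 :=
    (mul_eq_zero.mp h2).resolve_left hs.ne'
  have h5 : 0 ≤ u * Real.cos (2 * Real.pi * t) - v * Real.sin (2 * Real.pi * t) := by
    by_contra! h
    nlinarith
  rcases le_total t (1 / 2) with ht | ht
  · have hS : 0 ≤ Real.sin (2 * Real.pi * t) :=
      Real.sin_nonneg_of_nonneg_of_le_pi (by positivity) (by nlinarith)
    generalize Real.sin (2 * Real.pi * t) = S at *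
    generalize Real.cos (2 * Real.pi * t) = C at *
    have hC : C ≤ 0 := by
      by_contra! h
      nlinarith [mul_nonneg hu.le hS, mul_pos (hu.trans hv) h]
    have e1 : u * C ≤ 0 := mul_nonpos_of_nonneg_of_nonpos hu.le hC
    have e2 : 0 ≤ v * S := mul_nonneg (hu.trans hv).le hS
    have e3 : u * C = 0 := by linarith
    have e4 : v * S = 0 := by linarith
    have e5 : C = 0 := (mul_eq_zero.mp e3).resolve_left hu.ne'
    have e6 : S = 0 := (mul_eq_zero.mp e4).resolve_left (hu.trans hv).ne'
    rw [e5, e6] at hsc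
    norm_num at hsc
  · have hS : Real.sin (2 * Real.pi * t) ≤ 0 := by
      rw [← Real.sin_sub_two_pi]
      exact Real.sin_nonpos_of_nonpos_of_neg_pi_le (by nlinarith) (by nlinarith)
    have hC : Real.cos (2 * Real.pi * t) < 0 :=
      Real.cos_neg_of_pi_div_two_lt_of_lt (by nlinarith) (by nlinarith)
    nlinarith [mul_nonpos_of_nonneg_of_nonpos hu.le hS, mul_neg_of_pos_of_neg (hu.trans hv) hC]

/-- For `5 / 8 ≤ t ≤ 1` the argument `φ + 2πt` seen from `1` lies strictly between `3π / 2` and `5π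
/ 2`. -/
theorem kite_one_lt_re {L M : ℝ} (hL : 0 < L) (hM : 1 ≤ M) {t : ℝ} (h0 : 5 / 8 ≤ t)
    (h1 : t ≤ 1) : 1 < (N.q N.x₀ * kiteLoop (N.a 0) (highPoint N.a L) M t).re := by
  obtain ⟨s, hs, hre, -⟩ := N.q_mul_kiteLoop_re_im hL hM t
  have hu := N.a_im_pos
  have hv := N.a_im_lt_re
  have hpi := Real.pi_pos
  set u := (N.a 0).im
  set v := (N.a 0).re
  rw [hre]
  refine lt_add_of_pos_right _ (mul_pos hs ?_)
  rcases le_total t (3 / 4) with ht | ht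
  · set θ := 2 * Real.pi * t - 5 * Real.pi / 4 with hθ
    have hθ0 : 0 ≤ θ := by rw [hθ]; nlinarith
    have hθ1 : θ ≤ Real.pi / 4 := by rw [hθ]; nlinarith
    have e : 2 * Real.pi * t = θ + Real.pi / 4 + Real.pi := by rw [hθ]; ring
    rw [e, Real.cos_add_pi, Real.sin_add_pi, Real.cos_add, Real.sin_add, Real.cos_pi_div_four,
      Real.sin_pi_div_four]
    have hC : 0 < Real.cos θ := Real.cos_pos_of_mem_Ioo ⟨by linarith, by linarith⟩
    have hS : 0 ≤ Real.sin θ := Real.sin_nonneg_of_nonneg_of_le_pi hθ0 (by linarith)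
    have h2 : 0 < √2 / 2 := by positivity
    have e1 : 0 < (v - u) * Real.cos θ := mul_pos (by linarith) hC
    have e2 : 0 ≤ (v + u) * Real.sin θ := mul_nonneg (by linarith) hS
    have : 0 < √2 / 2 * ((v - u) * Real.cos θ + (v + u) * Real.sin θ) := mul_pos h2 (by linarith)
    linarith
  · have hS : Real.sin (2 * Real.pi * t) ≤ 0 := by
      rw [← Real.sin_sub_two_pi]
      exact Real.sin_nonpos_of_nonpos_of_neg_pi_le (by nlinarith) (by nlinarith)
    have hC : 0 ≤ Real.cos (2 * Real.pi * t) := by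
      rw [← Real.cos_sub_two_pi]
      exact Real.cos_nonneg_of_neg_pi_div_two_le_of_le (by nlinarith) (by nlinarith)
    have hsc := Real.sin_sq_add_cos_sq (2 * Real.pi * t)
    generalize Real.sin (2 * Real.pi * t) = S at *
    generalize Real.cos (2 * Real.pi * t) = C at *
    have e1 : 0 ≤ u * C := mul_nonneg hu.le hC
    rcases hS.lt_or_eq with h | h
    · nlinarith [mul_neg_of_pos_of_neg (hu.trans hv) h]
    · rw [h] at hsc ⊢
      have : 0 < C := by
        rcases hC.lt_or_eq with h' | h'
        · exact h'
        · rw [← h'] at hsc; norm_num at hsc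
      have := mul_pos hu this
      linarith

theorem kite_im_neg {L M : ℝ} (hL : 0 < L) (hM : 1 ≤ M) :
    (N.q N.x₀ * kiteLoop (N.a 0) (highPoint N.a L) M (5 / 8)).im < 0 := by
  obtain ⟨s, hs, -, him⟩ := N.q_mul_kiteLoop_re_im hL hM (5 / 8)
  have hu := N.a_im_pos
  have hv := N.a_im_lt_re
  have e : 2 * Real.pi * (5 / 8) = Real.pi / 4 + Real.pi := by ring
  rw [e, Real.cos_add_pi, Real.sin_add_pi, Real.cos_pi_div_four, Real.sin_pi_div_four] at him
  rw [him]
  have h2 : 0 < √2 / 2 := by positivity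
  refine mul_neg_of_pos_of_neg hs ?_
  nlinarith [mul_pos hu h2, mul_pos (hu.trans hv) h2]

theorem q_mul_highPoint (L : ℝ) : N.q N.x₀ * highPoint N.a L =
    1 + (L / Complex.normSq (N.a 0) : ℝ) * ⟨(N.a 0).im, (N.a 0).re⟩ := by
  have h := N.q_mul_kiteLoop L 1 0
  rw [kiteLoop, kite_zero 1 le_rfl, mul_one, add_sub_cancel] at h
  simpa [kiteGauge] using h

theorem high_one_lt_re {L : ℝ} (hL : 0 < L) : 1 < (N.q N.x₀ * highPoint N.a L).re := by
  rw [q_mul_highPoint, Complex.add_re, Complex.re_ofReal_mul, Complex.one_re]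
  have := mul_pos (div_pos hL (Complex.normSq_pos.mpr N.a_zero_ne)) N.a_im_pos
  simpa using this

theorem high_im_pos {L : ℝ} (hL : 0 < L) : 0 < (N.q N.x₀ * highPoint N.a L).im := by
  rw [q_mul_highPoint, Complex.add_im, Complex.im_ofReal_mul, Complex.one_im, zero_add]
  exact mul_pos (div_pos hL (Complex.normSq_pos.mpr N.a_zero_ne)) (N.a_im_pos.trans N.a_im_lt_re)

theorem norm_high {L : ℝ} (hL : 0 < L) : 2 * N.R < ‖highPoint N.a L‖ :=
  N.two_R_lt N.x₀_mem (by linarith [N.high_one_lt_re hL, Complex.re_le_norm (N.q N.x₀ * highPoint N.a L)])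

/-! ### Turning around the special fibre -/

variable {L : ℝ} {y₀ : ↥N.F}

theorem base_mem_logRegion (hL : 0 < L) :
    (N.q N.x₀ * highPoint N.a L, Complex.log N.x₀) ∈ N.logRegion := by
  refine ⟨N.high_one_lt_re hL, ?_⟩
  rw [← N.exp_mem_ball, Complex.exp_log N.x₀_ne]
  exact N.x₀_mem

theorem lift_add (ζ : ℂ × ℂ) (k : ℤ) :
    N.lift (ζ + (0, k * (2 * Real.pi * Complex.I))) = N.lift ζ := by
  have : Complex.exp (ζ.2 + k * (2 * Real.pi * Complex.I)) = Complex.exp ζ.2 :=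
    Complex.exp_eq_exp_iff_exists_int.mpr ⟨k, rfl⟩
  simp [lift, this]

theorem add_mem_logRegion {ζ : ℂ × ℂ} (h : ζ ∈ N.logRegion) (k : ℤ) :
    ζ + (0, k * (2 * Real.pi * Complex.I)) ∈ N.logRegion := by
  have : (k * (2 * Real.pi * Complex.I) : ℂ).re = 0 := by simp
  exact ⟨by simpa using h.1, by simpa using h.2⟩

theorem lift_base (hy₀ : (y₀ : ℂ) = highPoint N.a L) :
    N.lift (N.q N.x₀ * highPoint N.a L, Complex.log N.x₀) = N.j y₀ := by
  have h1 : Complex.exp (Complex.log N.x₀) = (N.j y₀).1.1 := Complex.exp_log N.x₀_ne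
  have := N.lift_eq (p := N.j y₀) (N.q_ne N.x₀_ne) h1
  rw [← this, ← hy₀]
  rfl

/-- The loop along which `q(x) y` is constant while `x` goes `k` times around `0`. -/
def turn (hL : 0 < L) (hy₀ : (y₀ : ℂ) = highPoint N.a L) (k : ℤ) : Path (N.j y₀) (N.j y₀) :=
  N.liftPath (N.base_mem_logRegion hL) (N.add_mem_logRegion (N.base_mem_logRegion hL) k)
    (N.lift_base hy₀) ((N.lift_add _ k).trans (N.lift_base hy₀))

theorem turn_apply (hL : 0 < L) (hy₀ : (y₀ : ℂ) = highPoint N.a L) (k : ℤ) (t : unitInterval) :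
    (N.turn hL hy₀ k t : ℂ × ℂ) = N.lift (N.q N.x₀ * highPoint N.a L,
      Complex.log N.x₀ + t * (k * (2 * Real.pi * Complex.I))) := by
  rw [turn, liftPath, convexPath_apply]
  congr 1
  refine Prod.ext ?_ ?_
  · simp; ring
  · simp; ring

theorem base_mem_A (hL : 0 < L) (hy₀ : (y₀ : ℂ) = highPoint N.a L) : N.j y₀ ∈ N.A := by
  apply N.mem_A_of_im_ne
  have := N.high_im_pos hL
  rw [← hy₀] at this
  exact this.ne'

theorem turn_mem_A (hL : 0 < L) (hy₀ : (y₀ : ℂ) = highPoint N.a L) (k : ℤ) (t : unitInterval) :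
    N.turn hL hy₀ k t ∈ N.A := by
  apply N.mem_A_of_im_ne
  rw [turn_apply, q_lift]
  exact (N.high_im_pos hL).ne'

/-- The product `q(x) y` is constant and `q = exp (n log x + ℓ)`, so the logarithm of `y` decreases
by `n` times the increase of `log x` and by the increase of `ℓ`. This is the origin of the exponent
`n` in the relation. -/
theorem turn_snd (hL : 0 < L) (hy₀ : (y₀ : ℂ) = highPoint N.a L) (k : ℤ) (t : unitInterval) :
    (N.turn hL hy₀ k t).1.2 = Complex.exp (Complex.log y₀ - n * (t * (k * (2 * Real.pi *
      Complex.I))) - (N.ℓ (N.turn hL hy₀ k t).1.1 - N.ℓ N.x₀)) := by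
  have hne : (y₀ : ℂ) ≠ 0 := by
    intro h
    have := N.norm_high hL
    rw [← hy₀, h, norm_zero] at this
    linarith [N.R_pos]
  have h1 : (N.turn hL hy₀ k t).1.1 =
      Complex.exp (Complex.log N.x₀ + t * (k * (2 * Real.pi * Complex.I))) := by
    rw [turn_apply]; rfl
  have h2 : (N.turn hL hy₀ k t).1.2 = N.q N.x₀ * y₀ / N.q (N.turn hL hy₀ k t).1.1 := by
    rw [turn_apply, ← hy₀]; rfl
  have h3 : N.q N.x₀ = Complex.exp (n * Complex.log N.x₀ + N.ℓ N.x₀) := by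
    rw [Complex.exp_add, Complex.exp_nat_mul, Complex.exp_log N.x₀_ne, q]
  have h4 : N.q (N.turn hL hy₀ k t).1.1 = Complex.exp (n * (Complex.log N.x₀ +
      t * (k * (2 * Real.pi * Complex.I))) + N.ℓ (N.turn hL hy₀ k t).1.1) := by
    rw [Complex.exp_add, Complex.exp_nat_mul, ← h1, q]
  rw [h2, h4, h3]
  nth_rewrite 1 [← Complex.exp_log hne]
  rw [← Complex.exp_add, ← Complex.exp_sub]
  congr 1
  ring

theorem norm_turn_snd (hL : 0 < L) (hy₀ : (y₀ : ℂ) = highPoint N.a L) (k : ℤ)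
    (t : unitInterval) : 2 * N.R < ‖(N.turn hL hy₀ k t).1.2‖ := by
  refine N.two_R_lt (N.mem_E.mp (N.turn hL hy₀ k t).2).1 ?_
  rw [turn_apply, q_lift]
  linarith [N.high_one_lt_re hL, Complex.re_le_norm (N.q N.x₀ * highPoint N.a L)]

theorem shrink_exp {η : ℂ} (h : 2 * N.R ≤ ‖Complex.exp η‖) :
    (N.shrink (Complex.exp η) : ℂ) * Complex.exp η = anglePoint (2 * N.R) η.im := by
  have h1 := N.shrink_mul_norm h
  have h2 : Complex.exp η = (‖Complex.exp η‖ : ℝ) * Complex.exp (η.im * Complex.I) := by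
    rw [Complex.norm_exp, Complex.ofReal_exp, ← Complex.exp_add, Complex.re_add_im]
  rw [anglePoint, ← h1, Complex.ofReal_mul, mul_assoc, ← h2]

/-- The segment from `y₀` inwards to the circle of radius `2R` lies in the upper half-plane and
outside the open disc, hence above the downward rays from the points inside; it meets the vertical
line of `a 0` only in `y₀`, which is above `a 0`. -/
theorem radial_mem_slitDown (hL : 0 < L) (hy₀ : (y₀ : ℂ) = highPoint N.a L) {k' : ℕ}
    {a' : Fin k' → ℂ} (ha' : ∀ i, ‖a' i‖ < 2 * N.R ∨ a' i = N.a 0) {μ : ℝ}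
    (h : N.shrink y₀ ≤ μ) (h1 : μ ≤ 1) : (μ : ℂ) * y₀ ∈ slitDown a' := by
  have him : 0 < (y₀ : ℂ).im := by
    rw [hy₀, highPoint_im]; linarith [N.a_im_pos]
  have hμ : 0 < μ := (N.shrink_pos _).trans_le h
  have hn : 2 * N.R ≤ ‖(μ : ℂ) * y₀‖ := by
    rw [norm_mul, Complex.norm_real, Real.norm_of_nonneg hμ.le]
    have h3 := N.norm_high hL
    rw [← hy₀] at h3
    rw [← N.shrink_mul_norm h3.le]
    gcongr
  rintro i ⟨h2, h3⟩
  rcases ha' i with h4 | h4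
  · have him' : 0 < ((μ : ℂ) * y₀).im := by rw [Complex.im_ofReal_mul]; positivity
    have h5 : ‖a' i‖ ^ 2 < ‖(μ : ℂ) * y₀‖ ^ 2 := by
      have := h4.trans_le hn
      gcongr
    rw [← Complex.normSq_eq_norm_sq, ← Complex.normSq_eq_norm_sq, Complex.normSq_apply,
      Complex.normSq_apply, h2] at h5
    nlinarith
  · rw [h4, Complex.re_ofReal_mul, hy₀, highPoint_re] at h2
    have h5 : μ = 1 := by
      have : 0 < (N.a 0).re := N.a_im_pos.trans N.a_im_lt_re
      nlinarith
    rw [h4, h5, Complex.im_ofReal_mul, hy₀, highPoint_im] at h3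
    linarith

/-- Turning around the special fibre is homotopic to a loop in the fibre, whose holonomy about the
constant branches is the power `- n k` of the holonomy of a large circle. -/
theorem exists_turn_eq (hL : 0 < L) (hy₀ : (y₀ : ℂ) = highPoint N.a L) (k : ℤ) :
    ∃ Δ : Path.Homotopic.Quotient y₀ y₀, hc(N.turn hL hy₀ k) = Δ.map N.j ∧
      ∀ {k' : ℕ} {a' : Fin k' → ℂ} (_ : ∀ i, ‖a' i‖ < 2 * N.R ∨ a' i = N.a 0)
        {H : Type} [Group H] (h : Fin k' → H) (φ : Holonomy ↥(range a')ᶜ H)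
        (_ : ∀ {p q : ↥(range a')ᶜ} (γ : Path p q), (∀ t, (γ t : ℂ) ∈ slitDown a') →
          φ.val hc(γ) = 1)
        (_ : ∀ {p q : ↥(range a')ᶜ} (γ : Path p q), (∀ t, (γ t : ℂ) ∈ slitUp a') →
          φ.val hc(γ) = leftProduct a' h q * (leftProduct a' h p)⁻¹)
        (f : C(↥N.F, ↥(range a')ᶜ)) (_ : ∀ y, (f y : ℂ) = y),
        φ.val (Δ.map f) = leftProduct a' h (2 * N.R : ℝ) ^ (-(n * k) : ℤ) := by
  have hA := N.base_mem_A hL hy₀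
  obtain ⟨ρ, hρ, hρ'⟩ := N.pushPath_j y₀ hA
  have sq := N.push_square (N.turn hL hy₀ k) (N.turn_mem_A hL hy₀ k) hA hA
  set σ := (N.turn hL hy₀ k).map N.continuous_foot with hσ
  refine ⟨hc(ρ).trans (hc(σ).trans hc(ρ).symm), ?_, ?_⟩
  · rw [map_trans, map_trans, map_symm, ← hρ', ← Path.Homotopic.Quotient.trans_assoc, ← sq]
    simp only [Path.Homotopic.Quotient.trans_assoc, Path.Homotopic.Quotient.trans_symm,
      Path.Homotopic.Quotient.trans_refl]
  · intro k' a' ha' H _ h φ hφ hφ' f hf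
    have h1 : φ.val (hc(ρ).map f) = 1 := by
      rw [← Path.Homotopic.Quotient.mk_map]
      refine hφ _ fun t => ?_
      obtain ⟨μ, hμ, hμ1, e⟩ := hρ t
      rw [Path.map_coe, Function.comp_apply, hf, e]
      exact N.radial_mem_slitDown hL hy₀ ha' hμ hμ1
    rw [map_trans, map_trans, map_symm, φ.val_trans, φ.val_trans, φ.val_symm, h1, inv_one, one_mul,
      mul_one, ← Path.Homotopic.Quotient.mk_map]
    -- The shrunk path runs on the circle of radius `2R`. Its angle changes by `-2πnk` in all,
    -- because `ℓ` returns to its initial value together with `x`.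
    refine val_circle (by linarith [N.R_pos]) (fun i => ?_) h φ hφ hφ' _
      (fun t => (Complex.log y₀ - n * (t * (k * (2 * Real.pi *
        Complex.I))) - (N.ℓ (N.turn hL hy₀ k t).1.1 - N.ℓ N.x₀)).im) ?_ (fun t => ?_) _ ?_ ?_
    · refine (ha' i).imp id fun h => ?_
      rw [h]
      exact N.two_R_lt_a_re
    · have := N.continuous_ℓ
      fun_prop
    · rw [Path.map_coe, Function.comp_apply, hf, hσ, Path.map_coe, Function.comp_apply]
      change (N.shrink (N.turn hL hy₀ k t).1.2 : ℂ) * (N.turn hL hy₀ k t).1.2 = _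
      have h2 := N.norm_turn_snd hL hy₀ k t
      rw [turn_snd] at h2 ⊢
      exact N.shrink_exp h2.le
    · simp only [Path.source, Path.target]
      simp [j]
      ring
    · have h2 : (Complex.log y₀).im ∈ Icc 0 Real.pi := by
        rw [Complex.log_im]
        refine ⟨Complex.arg_nonneg_iff.mpr ?_, Complex.arg_le_pi _⟩
        rw [hy₀, highPoint_im]
        linarith [N.a_im_pos]
      have e : (N.turn hL hy₀ k 0).1.1 = N.x₀ := by rw [Path.source]; rfl
      simp only [e]
      simpa using h2

end NormalForm

/-! ### Extension of planar holonomies to the complement -/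

namespace NormalForm

variable {m n : ℕ} (N : NormalForm m n) {L : ℝ} {y₀ : ↥N.F}

theorem strictAnti_a : StrictAnti fun i => (N.a i).re := N.strictAnti

theorem strictAnti_c : StrictAnti fun i => (N.c i).re := fun _ _ h =>
  N.strictAnti_a (Fin.succ_lt_succ_iff.mpr h)

/-- The projection of the complement to the plane without the constant branches. -/
def pr : C(↥N.E, ↥(range N.c)ᶜ) where
  toFun p := ⟨p.1.2, (N.mem_E.mp p.2).2.1⟩
  continuous_toFun := by fun_prop

section Extension

variable {H : Type} [Group H]

/-- The planar frames over the two slit planes. -/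
def planarFrame (c : Fin m → ℂ) (h : Fin m → H) (b : Bool) (y : ℂ) : H :=
  if b then 1 else leftProduct c h y

/-- The two slit planes. -/
def slit (c : Fin m → ℂ) (b : Bool) : Set ℂ := if b then slitDown c else slitUp c

theorem isOpen_slit (c : Fin m → ℂ) (b : Bool) : IsOpen (slit c b) := by
  cases b
  · exact isOpen_slitUp
  · exact isOpen_slitDown

theorem planarFrame_locally_constant (c : Fin m → ℂ) (h : Fin m → H) (b b' : Bool) {y : ℂ}
    (hy : y ∈ slit c b) (hy' : y ∈ slit c b') :
    ∀ᶠ z in 𝓝 y, (planarFrame c h b z)⁻¹ * planarFrame c h b' z =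
      (planarFrame c h b y)⁻¹ * planarFrame c h b' y := by
  have key : y ∈ slitDown c → y ∈ slitUp c → ∀ᶠ z in 𝓝 y, leftProduct c h z = leftProduct c h y := by
    intro h1 h2
    filter_upwards [sameStrip_self_eventually (re_ne_of_mem_slits h1 h2)] with z hz
    exact hz.leftProduct_eq h
  cases b <;> cases b' <;> simp only [planarFrame, slit, if_true, Bool.false_eq_true, if_false] at *
  · simp
  · filter_upwards [key hy' hy] with z hz; rw [hz]
  · filter_upwards [key hy hy'] with z hz; rw [hz]
  · simp

/-- A planar holonomy extends, with a given value on the loop about the branch at infinity which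
commutes with the `n`-th power of the holonomy of a large circle. -/
theorem exists_extension (hL : 0 < L) (hy₀ : (y₀ : ℂ) = highPoint N.a L) (h : Fin (m + 1) → H)
    (comm : Commute (h 0) ((List.ofFn fun i : Fin m => h i.succ).prod ^ n)) :
    ∃ φ : Holonomy ↥N.E H,
      (∀ (b : Bool) {p q : ↥N.E} (γ : Path p q), (∀ t, γ t ∈ N.A) → (∀ t, (γ t).1.2 ∈ slit N.c b) →
        φ.val hc(γ) = planarFrame N.c (fun i => h i.succ) b q.1.2 *
          (planarFrame N.c (fun i => h i.succ) b p.1.2)⁻¹) ∧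
      ∀ {p : ↥N.E} (γ : Path p (N.j y₀)), (∀ t, γ t ∈ N.W) → (∀ t, (γ t).1.2 ∈ slitDown N.c) →
        (N.q p.1.1 * p.1.2).im < 0 → φ.val hc(γ) = h 0 := by
  set h' : Fin m → H := fun i => h i.succ with hh'
  obtain ⟨ψ, hψ, hψ'⟩ := exists_planar_holonomy N.strictAnti_c h'
  -- This holonomy ignores the branch to infinity. The required one differs from it by a jump `h 0`,
  -- suitably transported, between the lower and the upper side of the ray in `W`.
  set Ψ := ψ.pullback N.pr with hΨ
  have Ψ_slit : ∀ (b : Bool) {p q : ↥N.E} (γ : Path p q), (∀ t, (γ t).1.2 ∈ slit N.c b) →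
      Ψ.val hc(γ) = planarFrame N.c h' b q.1.2 * (planarFrame N.c h' b p.1.2)⁻¹ := by
    intro b p q γ hγ
    change ψ.val (hc(γ).map N.pr) = _
    rw [← Path.Homotopic.Quotient.mk_map]
    cases b
    · exact hψ' _ hγ
    · refine (hψ (γ.map N.pr.continuous) hγ).trans ?_
      simp [planarFrame]
  set ζ₀ : ℂ × ℂ := (N.q N.x₀ * highPoint N.a L, Complex.log N.x₀) with hζ₀
  have m₀ : ζ₀ ∈ N.logRegion := N.base_mem_logRegion hL
  have l₀ : N.lift ζ₀ = N.j y₀ := N.lift_base hy₀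
  let pt : ↥N.logRegion → ↥N.E := fun ζ => ⟨N.lift ζ, N.lift_mem ζ.2⟩
  let Kt : ↥N.logRegion → H := fun ζ => Ψ.val hc(N.liftPath m₀ ζ.2 l₀ (rfl : _ = (pt ζ : ℂ × ℂ)))
  have Kt_step : ∀ ζ ζ' : ↥N.logRegion, Kt ζ' =
      Ψ.val hc(N.liftPath ζ.2 ζ'.2 (rfl : _ = (pt ζ : ℂ × ℂ)) (rfl : _ = (pt ζ' : ℂ × ℂ))) * Kt ζ := by
    intro ζ ζ'
    simp only [Kt]
    rw [← Ψ.val_trans, liftPath, liftPath, convexPath_trans]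
  have turn_comm : ∀ k : ℤ, Commute (h 0) (Ψ.val hc(N.turn hL hy₀ k)) := by
    intro k
    obtain ⟨Δ, e1, e2⟩ := N.exists_turn_eq hL hy₀ k
    have e3 := e2 (a' := N.c) (fun i => Or.inl (by linarith [N.norm_c_lt i, N.R_pos])) h' ψ hψ hψ'
      (N.pr.comp N.j) (fun y => rfl)
    have e4 : Ψ.val hc(N.turn hL hy₀ k) = ψ.val (Δ.map (N.pr.comp N.j)) := by
      rw [e1, Path.Homotopic.Quotient.map_comp]
      rfl
    have e5 : leftProduct N.c h' ((2 * N.R : ℝ) : ℂ) = (List.ofFn h').prod := by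
      unfold leftProduct
      congr 2
      funext i
      rw [if_pos]
      rw [Complex.ofReal_re]
      linarith [Complex.re_le_norm (N.c i), N.norm_c_lt i, N.R_pos]
    rw [e4, e3, e5, ← mul_neg, zpow_mul, zpow_natCast]
    exact comm.zpow_right _
  -- Two parameters of the same point differ by a number of turns, and `h 0` commutes with the
  -- holonomy of a turn. Here the relation is needed.
  have Kt_indep : ∀ ζ ζ' : ↥N.logRegion, pt ζ = pt ζ' →
      Kt ζ' * h 0 * (Kt ζ')⁻¹ = Kt ζ * h 0 * (Kt ζ)⁻¹ := by
    intro ζ ζ' hpt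
    have e0 : N.lift ζ = N.lift ζ' := congrArg Subtype.val hpt
    have e1 : (ζ : ℂ × ℂ).1 = (ζ' : ℂ × ℂ).1 := by
      rw [← N.q_lift ζ, ← N.q_lift ζ', e0]
    have e2 : Complex.exp (ζ' : ℂ × ℂ).2 = Complex.exp (ζ : ℂ × ℂ).2 := congrArg Prod.fst e0.symm
    obtain ⟨k, hk⟩ := Complex.exp_eq_exp_iff_exists_int.mp e2
    have e3 : (ζ' : ℂ × ℂ) = (ζ : ℂ × ℂ) + (0, k * (2 * Real.pi * Complex.I)) :=
      Prod.ext (by simp [e1]) (by simp [hk])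
    obtain ⟨z, hz⟩ := ζ
    obtain ⟨z', hz'⟩ := ζ'
    simp only at e3
    subst e3
    have e4 : Kt ⟨_, hz'⟩ = Kt ⟨z, hz⟩ * Ψ.val hc(N.turn hL hy₀ k) := by
      have gen : ∀ (p : ↥N.E) (hp : pt ⟨_, hz'⟩ = p), Kt ⟨_, hz'⟩ =
          Ψ.val hc(N.liftPath m₀ hz' l₀ (congrArg Subtype.val hp)) := by
        rintro _ rfl
        rfl
      rw [gen _ hpt.symm]
      simp only [Kt]
      have e5 := convexPath_translate N.convex_logRegion N.continuous_lift.continuousOn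
        (fun _ => N.lift_mem) m₀ hz (N.add_mem_logRegion m₀ k) hz' (fun x _ => N.lift_add x k)
        l₀ (rfl : _ = (pt ⟨z, hz⟩ : ℂ × ℂ)) ((N.lift_add _ k).trans l₀)
        (congrArg Subtype.val hpt.symm)
      rw [liftPath, liftPath, ← e5, ← Ψ.val_trans, turn, liftPath, convexPath_trans]
    rw [e4]
    have := (turn_comm k).eq
    generalize Ψ.val hc(N.turn hL hy₀ k) = u at *
    rw [mul_inv_rev, mul_assoc (Kt ⟨z, hz⟩), ← this]
    group
  -- The jump at `p`: the conjugate of `h 0` by the transport from the base point. The points of `W`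
  -- are all parametrized, so the value `1` elsewhere plays no role there.
  let g : ↥N.E → H := fun p => open Classical in
    if hp : ∃ ζ, pt ζ = p then Kt hp.choose * h 0 * (Kt hp.choose)⁻¹ else 1
  have g_eq : ∀ ζ, g (pt ζ) = Kt ζ * h 0 * (Kt ζ)⁻¹ := by
    intro ζ
    have hp : ∃ ζ', pt ζ' = pt ζ := ⟨ζ, rfl⟩
    simp only [g]
    rw [dif_pos hp]
    exact Kt_indep ζ _ hp.choose_spec.symm
  have g_local : ∀ (b : Bool) (p : ↥N.E), p ∈ N.W → p.1.2 ∈ slit N.c b → ∃ ζ, pt ζ = p ∧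
      ∀ᶠ p' in 𝓝 p, ∃ ζ', pt ζ' = p' ∧ Kt ζ' =
        planarFrame N.c h' b p'.1.2 * (planarFrame N.c h' b p.1.2)⁻¹ * Kt ζ := by
    intro b p hp hpb
    obtain ⟨ξ, hξ, hζ, hlift⟩ := N.exists_lift hp
    set ζ : ℂ × ℂ := (N.q p.1.1 * p.1.2, ξ) with hζdef
    have hx : p.1.1 ≠ 0 := N.ne_of_q_ne (N.q_ne_of_mem_W hp)
    have hopen : IsOpen (N.logRegion ∩ {ζ | (N.lift ζ).2 ∈ slit N.c b}) := by
      refine IsOpen.inter ?_ ?_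
      · exact (isOpen_lt continuous_const (Complex.continuous_re.comp continuous_fst)).inter
          (isOpen_lt (Complex.continuous_re.comp continuous_snd) continuous_const)
      · exact (isOpen_slit N.c b).preimage (continuous_snd.comp N.continuous_lift)
    obtain ⟨ε, hε, hball⟩ := Metric.isOpen_iff.mp hopen ζ ⟨hζ, by
      rw [mem_ofPred_eq, hlift]; exact hpb⟩
    let ζf : ↥N.E → ℂ × ℂ := fun p' => (N.q p'.1.1 * p'.1.2, ξ + Complex.log (p'.1.1 / p.1.1))
    have ζf_cont : ContinuousAt ζf p := by
      have h1 : ContinuousAt (fun p' : ↥N.E => N.q p'.1.1 * p'.1.2) p := by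
        have : Continuous fun p' : ↥N.E => N.q p'.1.1 * p'.1.2 := by fun_prop
        exact this.continuousAt
      have h2 : ContinuousAt (fun p' : ↥N.E => p'.1.1 / p.1.1) p := by
        have : Continuous fun p' : ↥N.E => p'.1.1 / p.1.1 := by fun_prop
        exact this.continuousAt
      refine h1.prodMk (continuousAt_const.add (h2.clog ?_))
      rw [div_self hx]
      exact Complex.one_mem_slitPlane
    have ζf_p : ζf p = ζ := by simp [ζf, hζdef, div_self hx]
    refine ⟨⟨ζ, hζ⟩, Subtype.ext hlift, ?_⟩
    have h3 : ∀ᶠ p' in 𝓝 p, ζf p' ∈ Metric.ball ζ ε := by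
      apply ζf_cont
      rw [ζf_p]
      exact Metric.ball_mem_nhds _ hε
    filter_upwards [h3, N.isOpen_W.mem_nhds hp] with p' hp' hW
    have hx' : p'.1.1 ≠ 0 := N.ne_of_q_ne (N.q_ne_of_mem_W hW)
    have e1 : N.lift (ζf p') = p' := by
      refine N.lift_eq (N.q_ne_of_mem_W hW) ?_
      rw [Complex.exp_add, hξ, Complex.exp_log (div_ne_zero hx' hx), mul_div_cancel₀ _ hx]
    refine ⟨⟨ζf p', (hball hp').1⟩, Subtype.ext e1, ?_⟩
    rw [Kt_step ⟨ζ, hζ⟩ ⟨ζf p', (hball hp').1⟩, Ψ_slit b]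
    · simp only [pt]
      rw [e1, hlift]
    · intro t
      have : (1 - (t : ℝ)) • ζ + (t : ℝ) • ζf p' ∈ Metric.ball ζ ε :=
        Convex.segment_mem (convex_ball ζ ε) (Metric.mem_ball_self hε) hp' t
      exact (hball this).2
  -- The frames over `W` are multiplied by the jump on the upper side only, so that they differ from
  -- those of `A` above the ray and agree with them below it.
  let k : ↥N.E → H := fun p => open Classical in if 0 < (N.q p.1.1 * p.1.2).im then g p else 1
  have im_cont : Continuous fun p : ↥N.E => (N.q p.1.1 * p.1.2).im :=
    Complex.continuous_im.comp (by fun_prop)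
  have planar : ∀ (b b' : Bool) (p : ↥N.E), p.1.2 ∈ slit N.c b → p.1.2 ∈ slit N.c b' →
      ∀ᶠ p' in 𝓝 p, (planarFrame N.c h' b p'.1.2)⁻¹ * planarFrame N.c h' b' p'.1.2 =
        (planarFrame N.c h' b p.1.2)⁻¹ * planarFrame N.c h' b' p.1.2 := fun b b' p hb hb' =>
    (by fun_prop : Continuous fun p : ↥N.E => p.1.2).continuousAt.eventually
      (planarFrame_locally_constant N.c h' b b' hb hb')
  have mixed : ∀ (b b' : Bool) (p : ↥N.E), p ∈ N.A → p ∈ N.W → p.1.2 ∈ slit N.c b →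
      p.1.2 ∈ slit N.c b' →
      ∀ᶠ p' in 𝓝 p, (planarFrame N.c h' b p'.1.2)⁻¹ * (k p' * planarFrame N.c h' b' p'.1.2) =
        (planarFrame N.c h' b p.1.2)⁻¹ * (k p * planarFrame N.c h' b' p.1.2) := by
    intro b b' p hA hW hb hb'
    have hne : (N.q p.1.1 * p.1.2).im ≠ 0 := fun h0 => hA ⟨h0, le_of_lt hW⟩
    rcases lt_or_gt_of_ne hne with hneg | hpos
    · filter_upwards [im_cont.continuousAt.eventually (gt_mem_nhds hneg), planar b b' p hb hb']
        with p' hp' e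
      simp only [k]
      rw [if_neg (not_lt.mpr hneg.le), if_neg (not_lt.mpr hp'.le), one_mul, one_mul, e]
    · obtain ⟨ζ, hζ, ev⟩ := g_local b p hW hb
      filter_upwards [im_cont.continuousAt.eventually (lt_mem_nhds hpos), planar b b' p hb hb', ev]
        with p' hp' e ⟨ζ', hζ', e'⟩
      simp only [k]
      rw [if_pos hpos, if_pos hp', ← hζ, ← hζ', g_eq, g_eq, e', hζ, hζ']
      have e2 : planarFrame N.c h' b' p'.1.2 = planarFrame N.c h' b p'.1.2 *
          ((planarFrame N.c h' b p.1.2)⁻¹ * planarFrame N.c h' b' p.1.2) := by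
        rw [← e]; group
      rw [e2]
      group
  obtain ⟨φ, hφ⟩ := exists_holonomy
    (fun i : Bool × Bool => (if i.1 then N.A else N.W) ∩ {p : ↥N.E | p.1.2 ∈ slit N.c i.2})
    (fun (i : Bool × Bool) (p : ↥N.E) => if i.1 then planarFrame N.c h' i.2 p.1.2 else
      k p * planarFrame N.c h' i.2 p.1.2)
    (by
      rintro ⟨s, b⟩
      refine IsOpen.inter ?_ ((isOpen_slit N.c b).preimage (by fun_prop))
      cases s
      · exact N.isOpen_W
      · exact N.isOpen_A)
    (by
      intro p
      have h1 : ∃ b, p.1.2 ∈ slit N.c b := by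
        by_cases hy : p.1.2 ∈ slitDown N.c
        · exact ⟨true, hy⟩
        · exact ⟨false, mem_slitUp_of_notMem_slitDown N.strictAnti_c (N.mem_E.mp p.2).2.1 hy⟩
      obtain ⟨b, hb⟩ := h1
      rcases N.mem_A_or_mem_W p with h | h
      · exact ⟨(true, b), h, hb⟩
      · exact ⟨(false, b), h, hb⟩)
    (by
      rintro ⟨s, b⟩ ⟨s', b'⟩ p ⟨⟨h1, h2⟩, h3, h4⟩
      cases s <;> cases s' <;>
        simp only [if_true, Bool.false_eq_true, if_false, mem_ofPred_eq] at h1 h2 h3 h4 ⊢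
      · filter_upwards [planar b b' p h2 h4] with p' e
        rw [mul_inv_rev, mul_inv_rev, mul_assoc, mul_assoc, inv_mul_cancel_left,
          inv_mul_cancel_left, e]
      · filter_upwards [mixed b' b p h3 h1 h4 h2] with p' e
        have := congrArg (·⁻¹) e
        simpa [mul_inv_rev, mul_assoc] using this
      · exact mixed b b' p h1 h3 h2 h4
      · exact planar b b' p h2 h4)
  refine ⟨φ, fun b p q γ hA hb => ?_, fun {p} γ hW hD hneg => ?_⟩
  · have := hφ (true, b) γ (fun t => ⟨hA t, hb t⟩)
    simpa using this
  · have := hφ (false, true) γ (fun t => ⟨hW t, hD t⟩)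
    rw [this]
    have hpos : 0 < (N.q (N.j y₀).1.1 * (N.j y₀).1.2).im := by
      have := N.high_im_pos hL
      rw [← hy₀] at this
      exact this
    have e0 : pt ⟨ζ₀, m₀⟩ = N.j y₀ := Subtype.ext l₀
    have e1 : Kt ⟨ζ₀, m₀⟩ = 1 := by
      refine (Ψ_slit true (N.liftPath m₀ m₀ l₀ rfl) fun t => ?_).trans (by simp [planarFrame])
      rw [liftPath, convexPath_apply, ← add_smul, sub_add_cancel, one_smul, l₀]
      have := N.radial_mem_slitDown hL hy₀ (a' := N.c) (μ := 1)
        (fun i => Or.inl (by linarith [N.norm_c_lt i, N.R_pos])) (N.shrink_le_one _) le_rfl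
      change (y₀ : ℂ) ∈ slitDown N.c
      simpa using this
    have e2 : g (N.j y₀) = h 0 := by rw [← e0, g_eq, e1]; simp
    simp only [Bool.false_eq_true, if_false, planarFrame, if_true, k]
    rw [if_pos hpos, if_neg (not_lt.mpr hneg.le), e2]
    simp

end Extension
end NormalForm

/-! ### The presentation in normal form -/

namespace NormalForm

variable {m n : ℕ} (N : NormalForm m n) {L : ℝ} {y₀ : ↥N.F}

/-- Loops in the fibre about the branch at infinity commute with the turn around the special
fibre. -/
theorem turn_commutes (hL : 0 < L) (hy₀ : (y₀ : ℂ) = highPoint N.a L) (γ : Path y₀ y₀)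
    (hγ : ∀ t, ‖N.a 0‖ < 2 * ‖(γ t : ℂ)‖) :
    (hc(γ).map N.j).trans hc(N.turn hL hy₀ 1) = hc(N.turn hL hy₀ 1).trans (hc(γ).map N.j) := by
  rw [← Path.Homotopic.Quotient.mk_map]
  let X : unitInterval → ℂ := fun s =>
    Complex.exp (Complex.log N.x₀ + s * ((1 : ℤ) * (2 * Real.pi * Complex.I)))
  have hX : ∀ s, N.q (X s) ≠ 0 := fun s => N.q_exp_ne _
  have hXc : Continuous X := by simp only [X]; fun_prop
  have hXmem : ∀ s, X s ∈ Metric.ball 0 N.r := by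
    intro s
    have := (N.mem_E.mp (N.turn hL hy₀ 1 s).2).1
    rwa [turn_apply] at this
  have hX0 : X 0 = N.x₀ := by simp [X, Complex.exp_log N.x₀_ne]
  have hX1 : X 1 = N.x₀ := by simp [X, Complex.exp_add, Complex.exp_log N.x₀_ne]
  have hq := N.q_ne N.x₀_ne
  have hqX : Continuous fun s => N.q (X s) := N.continuous_q.comp hXc
  -- A torus: `x` runs over the circle through `x₀` while `q(x) y` runs over the image of `γ`. There
  -- `|q(x) y| = |γ| / |a 0| > 1 / 2`, which keeps it away from the constant branches.
  refine square_trans_subset (fun x => (X x.1, N.q N.x₀ * γ x.2 / N.q (X x.1))) ?_ (fun x => ?_)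
    _ _ _ _ (fun s => ?_) (fun s => ?_) (fun s => ?_) fun s => ?_
  · refine (hXc.comp continuous_fst).prodMk (Continuous.div (by fun_prop)
      (hqX.comp continuous_fst) fun x => hX _)
  · refine N.mem_E_of_half_le (hXmem _) ?_ ?_
    · rw [mul_div_cancel₀ _ (hX _), q_eq_inv, norm_mul, norm_inv, le_inv_mul_iff₀
        (norm_pos_iff.mpr N.a_zero_ne)]
      linarith [hγ x.2]
    · rw [mul_div_cancel₀ _ (hX _)]
      exact (N.mem_F.mp (γ x.2).2).2
  · simp only [hX0]
    rw [mul_div_cancel_left₀ _ hq]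
    rfl
  · simp only [hX1]
    rw [mul_div_cancel_left₀ _ hq]
    rfl
  · rw [turn_apply, γ.source, ← hy₀]; rfl
  · rw [turn_apply, γ.target, ← hy₀]; rfl

theorem slitDown_a_subset : slitDown N.a ⊆ slitDown N.c := fun _ hy i => hy i.succ

theorem slitUp_a_subset : slitUp N.a ⊆ slitUp N.c := fun _ hy i => hy i.succ

/-- The fundamental group of the complement, for the normal form. -/
theorem exists_presentation : ∃ (y₀ : ↥N.F) (M : ℝ) (hK : KitesSeparated N.a y₀ M),
    Function.Bijective (FreeGroup.lift fun i => FundamentalGroup.fromPath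
      hc(kitePath y₀ (N.a i) hK.1 fun t => hK.kiteLoop_mem i t)) ∧
    ∃ φ : PresentedGroup {asymptoticRelator m n} ≃* FundamentalGroup ↥N.E (N.j y₀),
      ∀ i, φ (PresentedGroup.of i) = FundamentalGroup.map N.j y₀
        (FundamentalGroup.fromPath
          hc(kitePath y₀ (N.a i) hK.1 fun t => hK.kiteLoop_mem i t)) := by
  obtain ⟨L, hL, M, hK, k1, k2, k3, k4, k5, k6⟩ := exists_kites N.strictAnti_a N.two_R_lt_a_re
    (N.a_im_pos.trans N.a_im_lt_re) N.norm_a_zero_lt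
  let y₀ : ↥N.F := ⟨highPoint N.a L, slitDown_subset _ k1⟩
  have hy₀ : (y₀ : ℂ) = highPoint N.a L := rfl
  change KitesSeparated N.a y₀ M at hK
  have hM := hK.1
  let κ : Fin (m + 1) → Path y₀ y₀ := fun i =>
    kitePath y₀ (N.a i) hK.1 fun t => hK.kiteLoop_mem i t
  let b : Fin (m + 1) → FundamentalGroup ↥N.F y₀ := fun i => FundamentalGroup.fromPath hc(κ i)
  let q4 : unitInterval := ⟨1 / 4, by norm_num, by norm_num⟩
  let t4 : unitInterval := ⟨3 / 4, by norm_num, by norm_num⟩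
  have hq4t4 : q4 ≤ t4 := by
    change (1 / 4 : ℝ) ≤ 3 / 4
    norm_num
  have cross : ∀ i, CrossesBelow N.a (κ i) q4 t4 := fun i =>
    ⟨hq4t4, fun u hu => k2 i u (Or.inl ⟨u.2.1, hu⟩), fun u hu hu' => k3 i u hu hu',
      fun u hu => k2 i u (Or.inr ⟨hu, u.2.2⟩)⟩
  have straddle : ∀ i, StraddlesOnly N.a i (κ i q4) (κ i t4) := k4
  have free : Function.Bijective (FreeGroup.lift b) := planar_free N.strictAnti_a k1 κ
    fun i => ⟨q4, t4, cross i, k4 i⟩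
  refine ⟨y₀, M, hK, free, ?_⟩
  have hA : N.j y₀ ∈ N.A := N.base_mem_A hL hy₀
  let J : FundamentalGroup ↥N.F y₀ →* FundamentalGroup ↥N.E (N.j y₀) := FundamentalGroup.map N.j y₀
  have hJ : ∀ σ : Path.Homotopic.Quotient y₀ y₀, J (FundamentalGroup.fromPath σ) =
      FundamentalGroup.fromPath (σ.map N.j) := fun σ => rfl
  have J_surj : Function.Surjective J := by
    intro α
    obtain ⟨σ, hσ⟩ := N.exists_fibre_loop y₀ hA (FundamentalGroup.toPath α)
    refine ⟨FundamentalGroup.fromPath σ, ?_⟩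
    rw [hJ, ← hσ]
  -- the relation
  obtain ⟨Δ, hΔ, hΔ'⟩ := N.exists_turn_eq hL hy₀ 1
  have hcomm := N.turn_commutes hL hy₀ (κ 0) fun t =>
    (k6 _ (kiteLoop_mem hM (hK.2.1 0) t)).2
  rw [hΔ] at hcomm
  let w : FreeGroup (Fin (m + 1)) := (List.ofFn fun i : Fin m => FreeGroup.of i.succ).prod
  -- The holonomy with the free generators as labels is inverse to `FreeGroup.lift b`, so the word
  -- of `Δ` can be read off from its winding along the large circle.
  have hΔw : FundamentalGroup.fromPath Δ = FreeGroup.lift b (w ^ (-n : ℤ)) := by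
    obtain ⟨φ, hφ, hφ'⟩ := exists_planar_holonomy N.strictAnti_a
      (FreeGroup.of : Fin (m + 1) → FreeGroup (Fin (m + 1)))
    obtain ⟨u, hu⟩ := free.2 (FundamentalGroup.fromPath Δ)
    have e1 : (φ.toHom y₀).comp (FreeGroup.lift b) = MonoidHom.id _ := by
      ext i
      rw [MonoidHom.comp_apply, FreeGroup.lift_apply_of]
      change φ.val hc(κ i) = _
      rw [(cross i).val_eq _ φ hφ hφ', (straddle i).leftProduct_eq N.strictAnti_a]
      simp
    have e2 : u = φ.val Δ := by
      rw [← show (MonoidHom.id _) u = u from rfl, ← e1, MonoidHom.comp_apply, hu]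
      rfl
    have e3 := hΔ' (a' := N.a) (fun i => by
      induction i using Fin.cases with
      | zero => exact Or.inr rfl
      | succ i => left; rw [a_succ]; linarith [N.norm_c_lt i, N.R_pos]) FreeGroup.of φ hφ hφ'
      (ContinuousMap.id _) (fun _ => rfl)
    have e4 : Δ.map (ContinuousMap.id _) = Δ := by
      induction Δ using Path.Homotopic.Quotient.ind with | mk Δ =>
      rfl
    have e5 : leftProduct N.a FreeGroup.of ((2 * N.R : ℝ) : ℂ) = w := by
      unfold leftProduct
      rw [List.ofFn_succ, List.prod_cons, if_neg, one_mul]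
      · congr 2
        funext i
        rw [if_pos]
        rw [a_succ, Complex.ofReal_re]
        linarith [Complex.re_le_norm (N.c i), N.norm_c_lt i, N.R_pos]
      · rw [Complex.ofReal_re, not_lt]
        exact N.two_R_lt_a_re.le
    rw [e4, e5, mul_one] at e3
    have e6 : φ.val Δ = w ^ (-n : ℤ) := e3
    rw [← hu, e2, e6]
  let G : FreeGroup (Fin (m + 1)) →* FundamentalGroup ↥N.E (N.j y₀) := J.comp (FreeGroup.lift b)
  have hG0 : G (FreeGroup.of 0) = FundamentalGroup.fromPath (hc(κ 0).map N.j) := by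
    simp only [G, MonoidHom.comp_apply, FreeGroup.lift_apply_of]
    rfl
  have hGw : G (w ^ (-n : ℤ)) = FundamentalGroup.fromPath (Δ.map N.j) := by
    simp only [G, MonoidHom.comp_apply]
    rw [← hΔw]
    rfl
  have hrel : Commute (G (w ^ n)) (G (FreeGroup.of 0)) := by
    have h1 : Commute (G (w ^ (-n : ℤ))) (G (FreeGroup.of 0)) := by
      rw [hG0, hGw]
      exact hcomm
    have h2 : G (w ^ n) = (G (w ^ (-n : ℤ)))⁻¹ := by
      rw [← map_inv, zpow_neg, zpow_natCast, inv_inv]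
    rw [h2]
    exact h1.inv_left
  have hrels : ∀ r ∈ ({asymptoticRelator m n} : Set (FreeGroup (Fin (m + 1)))),
      FreeGroup.lift (fun i => J (b i)) r = 1 := by
    rintro _ rfl
    have e : FreeGroup.lift (fun i => J (b i)) = G := by
      ext i
      simp [G]
    rw [e, asymptoticRelator, map_mul, map_inv, map_mul, map_mul]
    rw [mul_inv_eq_one]
    exact hrel.eq
  let Φ : PresentedGroup {asymptoticRelator m n} →* FundamentalGroup ↥N.E (N.j y₀) :=
    PresentedGroup.toGroup hrels
  have Φ_of : ∀ i, Φ (PresentedGroup.of i) = J (b i) := fun i => PresentedGroup.toGroup.of hrels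
  have Φ_surj : Function.Surjective Φ := by
    intro α
    obtain ⟨β, rfl⟩ := J_surj α
    obtain ⟨u, rfl⟩ := free.2 β
    refine ⟨PresentedGroup.mk _ u, ?_⟩
    have e : Φ.comp (PresentedGroup.mk _) = J.comp (FreeGroup.lift b) := by
      ext i
      rw [MonoidHom.comp_apply, MonoidHom.comp_apply, FreeGroup.lift_apply_of]
      exact Φ_of i
    exact DFunLike.congr_fun e u
  -- A holonomy with values in the presented group itself, labelled by its generators, inverts `Φ`;
  -- the commutation that the extension requires is the defining relation.
  have Φ_inj : Function.Injective Φ := by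
    let h : Fin (m + 1) → PresentedGroup {asymptoticRelator m n} := PresentedGroup.of
    have hw : (List.ofFn fun i : Fin m => h i.succ).prod = PresentedGroup.mk _ w := by
      rw [map_list_prod, List.map_ofFn]
      rfl
    have comm : Commute (h 0) ((List.ofFn fun i : Fin m => h i.succ).prod ^ n) := by
      have h1 : PresentedGroup.mk {asymptoticRelator m n}
          ((w ^ n * FreeGroup.of 0) * (FreeGroup.of 0 * w ^ n)⁻¹) = 1 :=
        PresentedGroup.one_of_mem (rels := {asymptoticRelator m n}) rfl
      simp only [map_mul, map_inv, mul_inv_eq_one] at h1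
      rw [hw, ← map_pow]
      exact h1.symm
    obtain ⟨φ, hφ, hφ'⟩ := N.exists_extension hL hy₀ h comm
    have val_b : ∀ i, φ.val (hc(κ i).map N.j) = h i := by
      intro i
      induction i using Fin.cases with
      | zero =>
        -- Up to `5 / 8` the kite is in `A` and in the plane slit downwards from the `c i`, and
        -- contributes `1`. After that it is in `W` and leads from below the ray to the base point
        -- above it, contributing `h 0`.
        let s : unitInterval := ⟨5 / 8, by norm_num, by norm_num⟩
        have hslit : ∀ t, (κ 0 t : ℂ) ∈ slitDown N.c := by
          intro t i hi
          have h1 := (k6 _ (kiteLoop_mem hM (hK.2.1 0) t)).1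
          have h2 : (κ 0 t : ℂ).re = (N.c i).re := hi.1
          have h3 : (κ 0 t : ℂ) = kiteLoop (N.a 0) y₀ M t := rfl
          rw [← h3, h2] at h1
          linarith [Complex.re_le_norm (N.c i), N.norm_c_lt i, N.R_pos]
        rw [hc_split (κ 0) s, map_trans, φ.val_trans, ← Path.Homotopic.Quotient.mk_map,
          ← Path.Homotopic.Quotient.mk_map]
        rw [hφ true ((initialPart (κ 0) s).map N.j.continuous)]
        · rw [hφ' ((finalPart (κ 0) s).map N.j.continuous)]
          · simp [planarFrame]
          · refine finalPart_mem (V := {y : ↥N.F | N.j y ∈ N.W}) (κ 0) fun u hu => ?_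
            exact N.kite_one_lt_re hL hM hu u.2.2
          · exact finalPart_mem (V := {y : ↥N.F | (y : ℂ) ∈ slitDown N.c}) (κ 0) fun u _ => hslit u
          · exact N.kite_im_neg hL hM
        · refine initialPart_mem (V := {y : ↥N.F | N.j y ∈ N.A}) (κ 0) fun u hu => ?_
          exact N.kite_mem_cut hL hM u.2.1 hu
        · exact initialPart_mem (V := {y : ↥N.F | (y : ℂ) ∈ slitDown N.c}) (κ 0) fun u _ => hslit u
      | succ i =>
        -- A point outside `A` would lie on the ray of the points `t * a 0` with `1 ≤ t`, which
        -- these kites avoid.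
        have hAall : ∀ t, N.j (κ i.succ t) ∈ N.A := by
          rintro t ⟨h1, h2⟩
          have e1 : (κ i.succ t : ℂ) = ((N.q N.x₀ * (κ i.succ t : ℂ)).re : ℝ) * N.a 0 := by
            have e2 : N.q N.x₀ * (κ i.succ t : ℂ) = ((N.q N.x₀ * (κ i.succ t : ℂ)).re : ℝ) :=
              Complex.ext rfl h1
            rw [← e2, a_zero, mul_comm (N.q N.x₀), mul_assoc, mul_inv_cancel₀ (N.q_ne N.x₀_ne),
              mul_one]
          exact k5 i.succ (Fin.succ_ne_zero i) _ (kiteLoop_mem hM (hK.2.1 _) t) _ h2 e1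
        obtain ⟨c1, c2, c3, c4⟩ := cross i.succ
        rw [hc_split₂ (κ i.succ) q4 t4, map_trans, map_trans, φ.val_trans, φ.val_trans,
          ← Path.Homotopic.Quotient.mk_map, ← Path.Homotopic.Quotient.mk_map,
          ← Path.Homotopic.Quotient.mk_map]
        rw [hφ true ((initialPart (κ i.succ) q4).map N.j.continuous),
          hφ false (((κ i.succ).subpath q4 t4).map N.j.continuous),
          hφ true ((finalPart (κ i.succ) t4).map N.j.continuous)]
        · have hs : StraddlesOnly N.c i (κ i.succ q4) (κ i.succ t4) :=
            ⟨(k4 i.succ).1, (k4 i.succ).2.1, fun l hl =>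
              (k4 i.succ).2.2 l.succ fun h => hl (Fin.succ_injective _ h)⟩
          have := hs.leftProduct_eq N.strictAnti_c fun i => h i.succ
          change (planarFrame N.c _ true _ * (planarFrame N.c _ true _)⁻¹) *
            (leftProduct N.c _ (κ i.succ t4) * (leftProduct N.c _ (κ i.succ q4))⁻¹) *
            (planarFrame N.c _ true _ * (planarFrame N.c _ true _)⁻¹) = _
          rw [this]
          simp [planarFrame]
        · exact finalPart_mem (V := {y : ↥N.F | N.j y ∈ N.A}) (κ i.succ) fun u _ => hAall u
        · exact finalPart_mem (V := {y : ↥N.F | (y : ℂ) ∈ slitDown N.c}) (κ i.succ)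
            fun u hu => N.slitDown_a_subset (c4 u hu)
        · exact subpath_mem (V := {y : ↥N.F | N.j y ∈ N.A}) (κ i.succ) c1 fun u _ _ => hAall u
        · exact subpath_mem (V := {y : ↥N.F | (y : ℂ) ∈ slitUp N.c}) (κ i.succ) c1
            fun u hu hu' => N.slitUp_a_subset (c3 u hu hu')
        · exact initialPart_mem (V := {y : ↥N.F | N.j y ∈ N.A}) (κ i.succ) fun u _ => hAall u
        · exact initialPart_mem (V := {y : ↥N.F | (y : ℂ) ∈ slitDown N.c}) (κ i.succ)
            fun u hu => N.slitDown_a_subset (c2 u hu)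
    have e : (φ.toHom (N.j y₀)).comp Φ = MonoidHom.id _ := by
      ext i
      rw [MonoidHom.comp_apply, Φ_of]
      exact val_b i
    exact Function.LeftInverse.injective (g := φ.toHom (N.j y₀)) fun x => DFunLike.congr_fun e x
  exact ⟨MulEquiv.ofBijective Φ ⟨Φ_inj, Φ_surj⟩, fun i => Φ_of i⟩

end NormalForm

/-! ### Change of the base point and of the space -/

section Transfer

variable {X Y : Type*} [TopologicalSpace X] [TopologicalSpace Y]

open Path.Homotopic.Quotient

theorem map_injective (e : X ≃ₜ Y) {p q : X} {α β : Path.Homotopic.Quotient p q}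
    (h : α.map (e : C(X, Y)) = β.map (e : C(X, Y))) : α = β := by
  induction α using Path.Homotopic.Quotient.ind with | mk γ =>
  induction β using Path.Homotopic.Quotient.ind with | mk γ' =>
  rw [← mk_map, ← mk_map, Path.Homotopic.Quotient.eq] at h
  obtain ⟨F⟩ := h
  have := square_trans (fun x => e.symm (F x)) (e.symm.continuous.comp F.continuous) γ γ'
    (Path.refl p) (Path.refl q) (fun s => by simp) (fun s => by simp) (fun s => by simp)
    (fun s => by simp)
  simpa using this

theorem map_surjective (e : X ≃ₜ Y) {p q : X}
    (β : Path.Homotopic.Quotient (e p) (e q)) :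
    ∃ α : Path.Homotopic.Quotient p q, α.map (e : C(X, Y)) = β := by
  induction β using Path.Homotopic.Quotient.ind with | mk γ =>
  let γ' : Path p q :=
    { toFun := fun t => e.symm (γ t), continuous_toFun := by fun_prop, source' := by simp,
      target' := by simp }
  refine ⟨hc(γ'), ?_⟩
  rw [← mk_map]
  congr 1
  apply Path.ext
  funext t
  exact e.apply_symm_apply _

theorem fundamentalGroup_map_bijective (e : X ≃ₜ Y) (p : X) :
    Function.Bijective (FundamentalGroup.map (e : C(X, Y)) p) :=
  ⟨fun _ _ h => map_injective e h, fun β => map_surjective e β⟩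

/-- Conjugation with a path class. -/
def conjPath {p q : X} (δ : Path.Homotopic.Quotient p q) :
    FundamentalGroup X p ≃* FundamentalGroup X q where
  toFun α := FundamentalGroup.fromPath (δ.symm.trans (α.toPath.trans δ))
  invFun α := FundamentalGroup.fromPath (δ.trans (α.toPath.trans δ.symm))
  left_inv α := by
    change δ.trans ((δ.symm.trans (Path.Homotopic.Quotient.trans α δ)).trans δ.symm) = α
    grind
  right_inv α := by
    change δ.symm.trans ((δ.trans (Path.Homotopic.Quotient.trans α δ.symm)).trans δ) = α
    grind
  map_mul' α β := by
    change δ.symm.trans ((Path.Homotopic.Quotient.trans β α).trans δ) =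
      (δ.symm.trans (Path.Homotopic.Quotient.trans β δ)).trans
        (δ.symm.trans (Path.Homotopic.Quotient.trans α δ))
    grind

theorem map_conjPath (f : C(X, Y)) {p q : X} (δ : Path.Homotopic.Quotient p q)
    (α : FundamentalGroup X p) : FundamentalGroup.map f q (conjPath δ α) =
      conjPath (δ.map f) (FundamentalGroup.map f p α) := by
  change (δ.symm.trans (Path.Homotopic.Quotient.trans α δ)).map f = (δ.map f).symm.trans
    ((Path.Homotopic.Quotient.map α f).trans (δ.map f))
  rw [map_trans, map_trans, map_symm]

variable {ι : Type} {G G' : Type*} [Group G] [Group G']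

theorem bijective_lift_comp (e : G ≃* G') {b : ι → G}
    (h : Function.Bijective (FreeGroup.lift b)) :
    Function.Bijective (FreeGroup.lift fun i => e (b i)) := by
  have : (FreeGroup.lift fun i => e (b i)) = (e : G →* G').comp (FreeGroup.lift b) := by
    ext i; simp
  rw [this]
  exact e.bijective.comp h

variable {F F' E E' : Type*} [TopologicalSpace F] [TopologicalSpace F'] [TopologicalSpace E]
  [TopologicalSpace E']

/-- The images of the elements `b i` generate the fundamental group of `E`, with the defining
relations `rels`. -/
def Presents (j : C(F, E)) (y₀ : F) (b : ι → FundamentalGroup F y₀)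
    (rels : Set (FreeGroup ι)) : Prop :=
  ∃ φ : PresentedGroup rels ≃* FundamentalGroup E (j y₀),
    ∀ i, φ (PresentedGroup.of i) = FundamentalGroup.map j y₀ (b i)

theorem Presents.conj {j : C(F, E)} {y₀ y₁ : F} {b : ι → FundamentalGroup F y₀}
    {rels : Set (FreeGroup ι)} (h : Presents j y₀ b rels) (δ : Path.Homotopic.Quotient y₀ y₁) :
    Presents j y₁ (fun i => conjPath δ (b i)) rels := by
  obtain ⟨φ, hφ⟩ := h
  refine ⟨φ.trans (conjPath (δ.map j)), fun i => ?_⟩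
  rw [MulEquiv.trans_apply, hφ, map_conjPath]

theorem Presents.transfer {j : C(F, E)} {j' : C(F', E')} {y₀ : F} {b : ι → FundamentalGroup F y₀}
    {rels : Set (FreeGroup ι)} (h : Presents j y₀ b rels) (e : E ≃ₜ E') (g : C(F, F'))
    (hc : ∀ y, e (j y) = j' (g y)) :
    Presents j' (g y₀) (fun i => FundamentalGroup.map g y₀ (b i)) rels := by
  have h1 : Presents ((e : C(E, E')).comp j) y₀ b rels := by
    obtain ⟨φ, hφ⟩ := h
    refine ⟨φ.trans (MulEquiv.ofBijective (FundamentalGroup.map (e : C(E, E')) (j y₀))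
      (fundamentalGroup_map_bijective e (j y₀))), fun i => ?_⟩
    rw [MulEquiv.trans_apply, hφ]
    exact (Path.Homotopic.Quotient.map_comp ..).symm
  have h2 : (e : C(E, E')).comp j = j'.comp g := by
    ext y
    exact hc y
  rw [h2] at h1
  obtain ⟨φ, hφ⟩ := h1
  refine ⟨φ, fun i => ?_⟩
  rw [hφ]
  exact Path.Homotopic.Quotient.map_comp ..

end Transfer

/-! ### Presentations by kites -/

section KitePresentations

variable {m : ℕ}

/-- The complement of `C` over `B` is presented by kites about the punctures `a i` of the fibre
over `x₀`. -/
def HasKitePresentation (B : Set ℂ) (C : Set (ℂ × ℂ)) (x₀ : ℂ) (hx : x₀ ∈ B)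
    (a : Fin (m + 1) → ℂ) (n : ℕ) : Prop :=
  fibre C x₀ = range a ∧ ∃ (y₀ : ↥(fibre C x₀)ᶜ) (M : ℝ) (hK : KitesSeparated a y₀ M)
    (hS : ∀ i (t : unitInterval), kiteLoop (a i) y₀ M t ∈ (fibre C x₀)ᶜ),
    Function.Bijective (FreeGroup.lift fun i =>
      FundamentalGroup.fromPath hc(kitePath y₀ (a i) hK.1 (hS i))) ∧
    IsPresentedBy B C x₀ hx y₀
      (fun i => FundamentalGroup.fromPath hc(kitePath y₀ (a i) hK.1 (hS i)))
      {asymptoticRelator m n}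

theorem HasKitePresentation.exists_geometricBasis {B : Set ℂ} {C : Set (ℂ × ℂ)} {x₀ : ℂ}
    {hx : x₀ ∈ B} {a : Fin (m + 1) → ℂ} {n : ℕ} (h : HasKitePresentation B C x₀ hx a n) :
    ∃ (y₀ : ↥(fibre C x₀)ᶜ) (b : Fin (m + 1) → FundamentalGroup ↥(fibre C x₀)ᶜ y₀),
      IsGeometricBasis (fibre C x₀) y₀ a b ∧
      IsPresentedBy B C x₀ hx y₀ b {asymptoticRelator m n} := by
  obtain ⟨hP, y₀, M, hK, hS, h1, h2⟩ := h
  exact ⟨y₀, _, hK.isGeometricBasis hP hS _ (fun _ => rfl) h1, h2⟩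

theorem KitesSeparated.mul {ι : Type} {a : ι → ℂ} {y₀ : ℂ} {M : ℝ} (h : KitesSeparated a y₀ M)
    {u : ℂ} (hu : u ≠ 0) : KitesSeparated (fun i => u * a i) (u * y₀) M := by
  refine ⟨h.1, fun i h' => h.2.1 i (mul_left_cancel₀ hu h'), fun i j hij => ?_⟩
  rw [← mul_sub, ← mul_sub, mul_div_mul_left _ _ hu]
  exact h.2.2 i j hij

theorem kiteLoop_mul (u a y₀ : ℂ) (M t : ℝ) :
    kiteLoop (u * a) (u * y₀) M t = u * kiteLoop a y₀ M t := by
  simp only [kiteLoop]; ring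

/-- Kites are given by complex affine formulas, so multiplication by `u` takes the kites about the
`a i` to the kites about the `u * a i`, and with them the explicit generators. -/
theorem HasKitePresentation.transfer {B B' : Set ℂ} {C C' : Set (ℂ × ℂ)} {x₀ x₀' : ℂ}
    {hx : x₀ ∈ B} {a : Fin (m + 1) → ℂ} {n : ℕ} (h : HasKitePresentation B C x₀ hx a n)
    (hx' : x₀' ∈ B') (e : ↥(complementOver B C) ≃ₜ ↥(complementOver B' C')) {u : ℂ} (hu : u ≠ 0)
    (hfib : ∀ y, y ∈ fibre C x₀ ↔ u * y ∈ fibre C' x₀')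
    (he : ∀ y : ↥(fibre C x₀)ᶜ, (e (fibreInclusion B C x₀ hx y) : ℂ × ℂ) = (x₀', u * y)) :
    HasKitePresentation B' C' x₀' hx' (fun i => u * a i) n := by
  obtain ⟨hP, y₀, M, hK, hS, h1, h2⟩ := h
  let g : ↥(fibre C x₀)ᶜ ≃ₜ ↥(fibre C' x₀')ᶜ :=
    (Homeomorph.mulLeft₀ u hu).subtype fun y => not_congr (hfib y)
  have hP' : fibre C' x₀' = range fun i => u * a i := by
    ext y
    have : y = u * (u⁻¹ * y) := by rw [mul_inv_cancel_left₀ hu]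
    rw [this, ← hfib, hP, ← this, mem_range, mem_range]
    refine exists_congr fun i => ?_
    rw [eq_inv_mul_iff_mul_eq₀ hu]
  have hS' : ∀ i (t : unitInterval), kiteLoop (u * a i) (g y₀) M t ∈ (fibre C' x₀')ᶜ := by
    intro i t
    have : kiteLoop (u * a i) (g y₀) M t = u * kiteLoop (a i) y₀ M t := kiteLoop_mul ..
    rw [this, mem_compl_iff, ← hfib]
    exact hS i t
  have hb : ∀ i, FundamentalGroup.map (g : C(↥(fibre C x₀)ᶜ, ↥(fibre C' x₀')ᶜ)) y₀
      (FundamentalGroup.fromPath hc(kitePath y₀ (a i) hK.1 (hS i))) =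
      FundamentalGroup.fromPath hc(kitePath (g y₀) (u * a i) hK.1 (hS' i)) := by
    intro i
    change (hc(kitePath y₀ (a i) hK.1 (hS i))).map (g : C(↥(fibre C x₀)ᶜ, ↥(fibre C' x₀')ᶜ)) = _
    rw [← Path.Homotopic.Quotient.mk_map]
    congr 1
    apply Path.ext
    funext t
    apply Subtype.ext
    exact (kiteLoop_mul ..).symm
  refine ⟨hP', g y₀, M, hK.mul hu, hS', ?_, ?_⟩
  · have := bijective_lift_comp (MulEquiv.ofBijective (FundamentalGroup.map (g : C(↥(fibre C x₀)ᶜ, ↥(fibre C' x₀')ᶜ)) y₀)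
      (fundamentalGroup_map_bijective g y₀)) h1
    simp only [MulEquiv.ofBijective_apply, hb] at this
    exact this
  · have h3 : Presents (fibreInclusion B C x₀ hx) y₀ _ _ := h2
    have := h3.transfer (j' := fibreInclusion B' C' x₀' hx') e (g : C(↥(fibre C x₀)ᶜ, ↥(fibre C' x₀')ᶜ))
      (fun y => Subtype.ext (he y))
    simp only [hb] at this
    exact this

end KitePresentations

/-! ### Reduction to the adapted position -/

theorem NormalForm.hasKitePresentation {m n : ℕ} (N : NormalForm m n) :
    HasKitePresentation (Metric.ball 0 N.r) N.curve N.x₀ N.x₀_mem N.a n := by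
  have key : ∀ (P : Set ℂ) (_ : P = range N.a) (j : C(↥Pᶜ, ↥N.E))
      (_ : ∀ y, (j y : ℂ × ℂ) = (N.x₀, (y : ℂ))), ∃ (y₀ : ↥Pᶜ) (M : ℝ)
      (hK : KitesSeparated N.a y₀ M) (hS : ∀ i (t : unitInterval), kiteLoop (N.a i) y₀ M t ∈ Pᶜ),
      Function.Bijective (FreeGroup.lift fun i =>
        FundamentalGroup.fromPath hc(kitePath y₀ (N.a i) hK.1 (hS i))) ∧
      Presents j y₀ (fun i => FundamentalGroup.fromPath hc(kitePath y₀ (N.a i) hK.1 (hS i)))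
        {asymptoticRelator m n} := by
    rintro _ rfl j hj
    obtain rfl : j = N.j := by
      ext y : 1
      exact Subtype.ext (hj y)
    obtain ⟨y₀, M, hK, h1, h2⟩ := N.exists_presentation
    exact ⟨y₀, M, hK, _, h1, h2⟩
  have hP : fibre N.curve N.x₀ = range N.a := by
    ext y
    rw [← not_iff_not, ← mem_compl_iff (range N.a), N.mem_F]
    simp [fibre, curve]
  exact ⟨hP, key _ hP (fibreInclusion _ _ _ N.x₀_mem) fun y => rfl⟩

theorem exists_perm_strictAnti {m : ℕ} {f : Fin m → ℝ} (hf : Function.Injective f) :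
    ∃ σ : Equiv.Perm (Fin m), StrictAnti fun i => f (σ i) := by
  refine ⟨Tuple.sort fun i => -f i, fun i j hij => ?_⟩
  have h1 : Monotone ((fun i => -f i) ∘ Tuple.sort fun i => -f i) := Tuple.monotone_sort _
  have h2 := h1.strictMono_of_injective
    (((neg_injective.comp hf)).comp (Equiv.injective _)) hij
  simpa using h2

/-- Each pair of points excludes at most one slope `s`. -/
theorem exists_generic_slope {m : ℕ} {d : Fin m → ℂ} (hd : Function.Injective d) :
    ∃ s : ℝ, 0 < s ∧ s < 1 ∧ Function.Injective fun i => (d i).re - s * (d i).im := by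
  let bad : Set ℝ := ⋃ i, ⋃ j, {((d i).re - (d j).re) / ((d i).im - (d j).im)}
  have hfin : bad.Finite := finite_iUnion fun i => finite_iUnion fun j => finite_singleton _
  obtain ⟨s, ⟨h0, h1⟩, hs⟩ := ((Ioo_infinite (zero_lt_one (α := ℝ))).sdiff hfin).nonempty
  refine ⟨s, h0, h1, fun i j hij => hd ?_⟩
  simp only at hij
  by_cases him : (d i).im - (d j).im = 0
  · refine Complex.ext ?_ (sub_eq_zero.mp him)
    rw [sub_eq_zero.mp him] at hij
    linarith
  · exfalso
    apply hs
    rw [mem_iUnion]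
    refine ⟨i, mem_iUnion.mpr ⟨j, ?_⟩⟩
    rw [mem_singleton_iff, eq_div_iff him]
    linarith

/-- The complement of distinct constant branches and of one branch going to infinity is presented
by kites. -/
theorem exists_hasKitePresentation {m n : ℕ} (hn : 1 ≤ n) {r R : ℝ} (hR : 0 < R) {c : Fin m → ℂ}
    (hc : Function.Injective c) (hcR : ∀ i, ‖c i‖ < R) {ℓ : ℂ → ℂ} (hℓ : Continuous ℓ)
    (small : ∀ x ∈ Metric.ball (0 : ℂ) r, ‖x ^ n * Complex.exp (ℓ x)‖ * (4 * R) < 1) {x₀ : ℂ}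
    (hx₀ : x₀ ∈ Metric.ball (0 : ℂ) r) (hne : x₀ ≠ 0) :
    ∃ σ : Equiv.Perm (Fin m), HasKitePresentation (Metric.ball 0 r)
      {p | p.2 ∈ range c ∨ p.1 ^ n * Complex.exp (ℓ p.1) * p.2 = 1} x₀ hx₀
      (Fin.cons (x₀ ^ n * Complex.exp (ℓ x₀))⁻¹ fun i => c (σ i)) n := by
  set q₀ := x₀ ^ n * Complex.exp (ℓ x₀) with hq₀
  have hq : q₀ ≠ 0 := mul_ne_zero (pow_ne_zero _ hne) (Complex.exp_ne_zero _)
  obtain ⟨s, hs0, hs1, hinj⟩ := exists_generic_slope (d := fun i => q₀ * c i)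
    ((mul_right_injective₀ hq).comp hc)
  -- Multiplication of `y` by `ω = τ q₀` moves the puncture of the branch to infinity to `τ = 1 + i
  -- s`, in the sector that `NormalForm` requires; a generic `s` gives the other punctures distinct
  -- real parts. The resulting factor `ω⁻¹` of `q` is absorbed into `ℓ`.
  set τ : ℂ := ⟨1, s⟩ with hτ
  have hτ0 : τ ≠ 0 := fun h => by have := congrArg Complex.re h; simp [hτ] at this
  have hτn : ‖τ‖ < 2 := by
    refine lt_of_pow_lt_pow_left₀ 2 (by norm_num) ?_
    rw [← Complex.normSq_eq_norm_sq, Complex.normSq_apply]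
    nlinarith
  set ω := τ * q₀ with hω
  have hω0 : ω ≠ 0 := mul_ne_zero hτ0 hq
  obtain ⟨σ, hσ⟩ := exists_perm_strictAnti hinj
  have hωre : ∀ i, (ω * c i).re = (q₀ * c i).re - s * (q₀ * c i).im := by
    intro i
    rw [hω, mul_assoc, Complex.mul_re]
    simp [hτ]
  have hωnorm : 0 < ‖ω‖ := norm_pos_iff.mpr hω0
  have hexp : ∀ x, Complex.exp (ℓ x - Complex.log ω) = Complex.exp (ℓ x) / ω := fun x => by
    rw [Complex.exp_sub, Complex.exp_log hω0]
  have ha0 : (x₀ ^ n * Complex.exp (ℓ x₀ - Complex.log ω))⁻¹ = τ := by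
    rw [hexp, ← mul_div_assoc, ← hq₀, inv_div, hω, mul_div_assoc, div_self hq, mul_one]
  let N : NormalForm m n :=
    { r := r
      c := fun i => ω * c (σ i)
      ℓ := fun x => ℓ x - Complex.log ω
      R := ‖ω‖ * R
      x₀ := x₀
      n_pos := hn
      continuous_ℓ := by fun_prop
      R_pos := by positivity
      norm_c_lt := fun i => by rw [norm_mul]; gcongr; exact hcR _
      small := fun x hx => by
        have := small x hx
        rw [hexp, ← mul_div_assoc, norm_div]
        calc _ = ‖x ^ n * Complex.exp (ℓ x)‖ * (4 * R) := by field_simp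
          _ < 1 := this
      x₀_mem := hx₀
      x₀_ne := hne
      strictAnti := by
        rw [ha0]
        intro i j hij
        induction j using Fin.cases with
        | zero => exact absurd hij (Fin.not_lt_zero i)
        | succ j =>
          induction i using Fin.cases with
          | zero =>
            have h1 : ‖ω * c (σ j)‖ ≤ 2 * ‖q₀‖ * R := by
              rw [norm_mul, hω, norm_mul]
              have := hcR (σ j)
              gcongr
            have h2 := small x₀ hx₀
            rw [← hq₀] at h2
            have h3 := Complex.re_le_norm (ω * c (σ j))
            change (ω * c (σ j)).re < 1
            linarith
          | succ i =>
            have h1 := hσ (Fin.succ_lt_succ_iff.mp hij)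
            simp only [← hωre] at h1
            exact h1
      im_pos := by rw [ha0]; exact hs0
      im_lt_re := by rw [ha0]; exact hs1 }
  refine ⟨σ, ?_⟩
  have hu : ω⁻¹ ≠ 0 := inv_ne_zero hω0
  have hcurve : ∀ p : ℂ × ℂ, p ∈ N.curve ↔ (p.1, ω⁻¹ * p.2) ∈
      {p : ℂ × ℂ | p.2 ∈ range c ∨ p.1 ^ n * Complex.exp (ℓ p.1) * p.2 = 1} := by
    intro p
    refine or_congr ?_ ?_
    · rw [mem_range, mem_range, ← σ.exists_congr_right (q := fun i => c i = ω⁻¹ * p.2)]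
      refine exists_congr fun i => ?_
      rw [eq_inv_mul_iff_mul_eq₀ hω0]
    · change p.1 ^ n * Complex.exp (ℓ p.1 - Complex.log ω) * p.2 = 1 ↔ _
      rw [hexp]
      simp only
      rw [← mul_div_assoc, div_mul_eq_mul_div, div_eq_mul_inv, mul_assoc _ _ ω⁻¹, mul_comm p.2]
  let e : ↥N.E ≃ₜ ↥(complementOver (Metric.ball 0 r)
      {p : ℂ × ℂ | p.2 ∈ range c ∨ p.1 ^ n * Complex.exp (ℓ p.1) * p.2 = 1}) :=
    ((Homeomorph.refl ℂ).prodCongr (Homeomorph.mulLeft₀ ω⁻¹ hu)).subtype fun p =>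
      and_congr Iff.rfl (not_congr (hcurve p))
  have h := N.hasKitePresentation.transfer hx₀ e hu (fun y => hcurve (N.x₀, y)) (fun y => rfl)
  convert h using 1
  funext i
  induction i using Fin.cases with
  | zero =>
    change q₀⁻¹ = ω⁻¹ * (x₀ ^ n * Complex.exp (ℓ x₀ - Complex.log ω))⁻¹
    rw [ha0, hω]
    field_simp
  | succ i =>
    change c (σ i) = ω⁻¹ * (ω * c (σ i))
    rw [inv_mul_cancel_left₀ hω0]

/-! ### Bases of the free group of rank two consisting of conjugates of the generators -/

section RankTwo

/-- The edges with label `g` of the graph of the subgroup generated by the first generator and by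
the conjugate of the second one with the word `w`. -/
def wordEdge (w : List (Fin 2 × Bool)) (g : Fin 2) (p : ℕ × ℕ) : Prop :=
  (w[p.1]? = some (g, false) ∧ p.2 = p.1 + 1) ∨ (w[p.2]? = some (g, true) ∧ p.1 = p.2 + 1) ∨
    (g = 0 ∧ p.1 = 0 ∧ p.2 = 0) ∨ (g = 1 ∧ p.1 = w.length ∧ p.2 = w.length)

theorem wordEdge_le {w : List (Fin 2 × Bool)} {g : Fin 2} {p : ℕ × ℕ} (h : wordEdge w g p) :
    p.1 ≤ w.length ∧ p.2 ≤ w.length := by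
  rcases h with ⟨h, h'⟩ | ⟨h, h'⟩ | ⟨-, h, h'⟩ | ⟨-, h, h'⟩
  · obtain ⟨h1, -⟩ := List.getElem?_eq_some_iff.mp h
    omega
  · obtain ⟨h1, -⟩ := List.getElem?_eq_some_iff.mp h
    omega
  · omega
  · omega

variable {w : List (Fin 2 × Bool)}

theorem no_turn_back (hw : FreeGroup.IsReduced w) {i : ℕ} {g : Fin 2} {s : Bool}
    (h : w[i]? = some (g, s)) (h' : w[i + 1]? = some (g, !s)) : False := by
  obtain ⟨h1, e1⟩ := List.getElem?_eq_some_iff.mp h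
  obtain ⟨h2, e2⟩ := List.getElem?_eq_some_iff.mp h'
  have := List.isChain_iff_getElem.mp hw i h2
  rw [e1, e2] at this
  simpa using this rfl

/-- The edges with a given label form a finite partial injection of the vertices: reducedness
excludes a turn back along the word, and `h0` and `h1` keep the word apart from the loops at its two
ends. A finite partial injection of `ℕ` extends to a permutation. -/
theorem exists_word_perm (hw : FreeGroup.IsReduced w) (h0 : ∀ s, w[0]? ≠ some (0, s))
    (h1 : ∀ i s, i + 1 = w.length → w[i]? ≠ some (1, s)) (g : Fin 2) :
    ∃ σ : Equiv.Perm ℕ, ∀ p, wordEdge w g p → σ p.1 = p.2 := by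
  have : Finite {p : ℕ × ℕ // wordEdge w g p} := by
    refine Set.Finite.subset ((finite_Iic w.length).prod (finite_Iic w.length)) ?_
    intro p hp
    exact ⟨(wordEdge_le hp).1, (wordEdge_le hp).2⟩
  have turn : ∀ {i j : ℕ} {s : Bool}, w[i]? = some (g, s) → w[j]? = some (g, !s) → j = i + 1 →
      False := by
    rintro i _ s h h' rfl
    exact no_turn_back hw h h'
  obtain ⟨σ, hσ⟩ := Equiv.Perm.exists_extending_pair
    (fun p : {p : ℕ × ℕ // wordEdge w g p} => p.1.1) (fun p => p.1.2)
    (by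
      rintro ⟨⟨a, b⟩, h⟩ ⟨⟨a', b'⟩, h'⟩ (rfl : a = a')
      have : b = b' := by
        rcases h with ⟨h, e⟩ | ⟨h, e⟩ | ⟨hg, e, e'⟩ | ⟨hg, e, e'⟩ <;>
          rcases h' with ⟨h', f⟩ | ⟨h', f⟩ | ⟨hg', f, f'⟩ | ⟨hg', f, f'⟩ <;> grind
      subst this
      rfl)
    (by
      rintro ⟨⟨a, b⟩, h⟩ ⟨⟨a', b'⟩, h'⟩ (rfl : b = b')
      have : a = a' := by
        rcases h with ⟨h, e⟩ | ⟨h, e⟩ | ⟨hg, e, e'⟩ | ⟨hg, e, e'⟩ <;>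
          rcases h' with ⟨h', f⟩ | ⟨h', f⟩ | ⟨hg', f, f'⟩ | ⟨hg', f, f'⟩ <;> grind
      subst this
      rfl)
  exact ⟨σ, fun p hp => hσ ⟨p, hp⟩⟩

/-- Stallings' folded graph: an arc spelling `w`, with a loop labelled `0` at its start and a loop
labelled `1` at its end. If neither alternative held, the graph would be folded and would define an
action in which the given subgroup fixes the vertex `0`; but the first letter of `w` would then be a
power of the generator `1`, which moves this vertex. -/
theorem first_letter_or_last_letter (hne : w ≠ []) (hw : FreeGroup.IsReduced w)
    (hgen : Subgroup.closure {FreeGroup.of 0, FreeGroup.mk w * FreeGroup.of 1 *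
      (FreeGroup.mk w)⁻¹} = (⊤ : Subgroup (FreeGroup (Fin 2)))) :
    (∃ s, w[0]? = some (0, s)) ∨ ∃ i s, i + 1 = w.length ∧ w[i]? = some (1, s) := by
  by_contra! hcon
  obtain ⟨h0, h1⟩ := hcon
  choose σ hσ using exists_word_perm hw h0 h1
  let ρ : FreeGroup (Fin 2) →* Equiv.Perm ℕ := FreeGroup.lift σ
  -- Letters act from the right, so the end segments of `w` move the vertex `w.length` step by step
  -- back to `0`.
  have word : ∀ j i, i + j = w.length → ρ (FreeGroup.mk (w.drop i)) w.length = i := by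
    intro j
    induction j with
    | zero =>
      intro i hi
      rw [List.drop_of_length_le (by omega)]
      have : ρ (FreeGroup.mk []) = 1 := map_one ρ
      rw [this]
      simpa using hi.symm
    | succ j ih =>
      intro i hi
      have hlt : i < w.length := by omega
      have e1 : w.drop i = [w[i]] ++ w.drop (i + 1) := by simp
      rw [e1, ← FreeGroup.mul_mk, map_mul, Equiv.Perm.mul_apply, ih (i + 1) (by omega)]
      obtain ⟨g, s, hl⟩ : ∃ g s, w[i] = (g, s) := ⟨_, _, rfl⟩
      have hl' : w[i]? = some (g, s) := by rw [List.getElem?_eq_getElem hlt, hl]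
      rw [hl]
      cases s
      · have h2 : FreeGroup.mk [(g, false)] = (FreeGroup.of g)⁻¹ := rfl
        rw [h2, map_inv, Equiv.Perm.inv_eq_iff_eq]
        simp only [ρ, FreeGroup.lift_apply_of]
        exact (hσ g (i, i + 1) (Or.inl ⟨hl', rfl⟩)).symm
      · have h2 : FreeGroup.mk [(g, true)] = FreeGroup.of g := rfl
        rw [h2]
        simp only [ρ, FreeGroup.lift_apply_of]
        exact hσ g (i + 1, i) (Or.inr (Or.inl ⟨hl', rfl⟩))
  have hk : ρ (FreeGroup.mk w) w.length = 0 := by simpa using word w.length 0 (by omega)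
  have hstab : Subgroup.closure {FreeGroup.of 0, FreeGroup.mk w * FreeGroup.of 1 *
      (FreeGroup.mk w)⁻¹} ≤ (MulAction.stabilizer (Equiv.Perm ℕ) 0).comap ρ := by
    rw [Subgroup.closure_le]
    rintro x (rfl | rfl)
    · change ρ (FreeGroup.of 0) 0 = 0
      simp only [ρ, FreeGroup.lift_apply_of]
      exact hσ 0 (0, 0) (Or.inr (Or.inr (Or.inl ⟨rfl, rfl, rfl⟩)))
    · change ρ (FreeGroup.mk w * FreeGroup.of 1 * (FreeGroup.mk w)⁻¹) 0 = 0
      have e1 : (ρ (FreeGroup.mk w))⁻¹ 0 = w.length := by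
        rw [Equiv.Perm.inv_eq_iff_eq, hk]
      have e2 : ρ (FreeGroup.of 1) w.length = w.length := by
        simp only [ρ, FreeGroup.lift_apply_of]
        exact hσ 1 (w.length, w.length) (Or.inr (Or.inr (Or.inr ⟨rfl, rfl, rfl⟩)))
      rw [map_mul, map_mul, map_inv, Equiv.Perm.mul_apply, Equiv.Perm.mul_apply, e1, e2, hk]
  rw [hgen] at hstab
  -- If the generators all fix the vertex `0`, so does the second one, although an edge of the arc
  -- with this label joins `0` and `1`.
  have hone : σ 1 0 = 0 := by
    have : ρ (FreeGroup.of 1) 0 = 0 := hstab (Subgroup.mem_top (FreeGroup.of 1))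
    simpa only [ρ, FreeGroup.lift_apply_of] using this
  have hpos : 0 < w.length := List.length_pos_iff.mpr hne
  obtain ⟨g, s, hl⟩ : ∃ g s, w[0] = (g, s) := ⟨_, _, rfl⟩
  have hl' : w[0]? = some (g, s) := by rw [List.getElem?_eq_getElem hpos, hl]
  have hg : g = 1 := by
    have := h0 s
    rw [hl'] at this
    fin_cases g
    · exact absurd rfl this
    · rfl
  subst hg
  cases s
  · have := hσ 1 (0, 1) (Or.inl ⟨hl', rfl⟩)
    simp only at this
    omega
  · have := hσ 1 (1, 0) (Or.inr (Or.inl ⟨hl', rfl⟩))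
    simp only at this
    exact absurd ((σ 1).injective (this.trans hone.symm)) one_ne_zero

theorem closure_conj {G : Type*} [Group G] (u a b : G) (h : Subgroup.closure {a, b} = ⊤) :
    Subgroup.closure {u * a * u⁻¹, u * b * u⁻¹} = ⊤ := by
  have h1 : (Subgroup.closure {a, b}).map (MulAut.conj u).toMonoidHom = ⊤ := by
    rw [h]
    exact Subgroup.map_top_of_surjective _ (MulAut.conj u).surjective
  rw [MonoidHom.map_closure, image_pair] at h1
  exact h1

/-- If a generator and a conjugate of the other one generate the free group of rank two, then they
are simultaneously conjugate to the two generators. -/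
theorem eq_mul_of_closure_eq_top (k : FreeGroup (Fin 2))
    (hgen : Subgroup.closure {FreeGroup.of 0, k * FreeGroup.of 1 * k⁻¹} = ⊤) :
    ∃ i j : ℤ, k = FreeGroup.of 0 ^ i * FreeGroup.of 1 ^ j := by
  induction hN : k.norm using Nat.strong_induction_on generalizing k with
  | h N ih =>
  have letter : ∀ (g : Fin 2) (s : Bool), ∃ e : ℤ, FreeGroup.mk [(g, s)] = FreeGroup.of g ^ e := by
    intro g s
    cases s
    · exact ⟨-1, by rw [zpow_neg_one]; rfl⟩
    · exact ⟨1, by rw [zpow_one]; rfl⟩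
  by_cases hne : k.toWord = []
  · rw [FreeGroup.toWord_eq_nil_iff] at hne
    exact ⟨0, 0, by simpa using hne⟩
  have hk : FreeGroup.mk k.toWord = k := FreeGroup.mk_toWord
  -- A first letter from the first generator is removed by conjugating the whole pair, a last letter
  -- from the second one because it commutes with that generator. In both cases the norm of `k`
  -- decreases.
  rcases first_letter_or_last_letter hne FreeGroup.isReduced_toWord (by rwa [hk]) with
    ⟨s, hs⟩ | ⟨i, s, hi, hs⟩
  · obtain ⟨x, l, hxl⟩ := List.exists_cons_of_ne_nil hne
    rw [hxl] at hs
    obtain rfl : x = (0, s) := by simpa using hs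
    have e1 : k = FreeGroup.mk [(0, s)] * FreeGroup.mk l := by
      rw [← hk, hxl, FreeGroup.mul_mk]; rfl
    obtain ⟨e, he⟩ := letter 0 s
    rw [he] at e1
    have hlt : (FreeGroup.mk l).norm < N := by
      refine FreeGroup.norm_mk_le.trans_lt ?_
      rw [← hN, FreeGroup.norm, hxl]
      simp
    obtain ⟨i, j, hij⟩ := ih _ hlt (FreeGroup.mk l) (by
      have := closure_conj (FreeGroup.of 0 ^ e)⁻¹ _ _ hgen
      rw [e1] at this
      convert this using 2
      congr 1
      · group
      · congr 1; group) rfl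
    exact ⟨e + i, j, by rw [e1, hij, zpow_add, mul_assoc]⟩
  · obtain ⟨l, x, hxl⟩ := (List.eq_nil_or_concat' k.toWord).resolve_left hne
    rw [hxl] at hs hi
    have hil : i = l.length := by simpa using hi
    subst hil
    obtain rfl : x = (1, s) := by simpa using hs
    have e1 : k = FreeGroup.mk l * FreeGroup.mk [(1, s)] := by
      rw [← hk, hxl, FreeGroup.mul_mk]
    obtain ⟨e, he⟩ := letter 1 s
    rw [he] at e1
    have hlt : (FreeGroup.mk l).norm < N := by
      refine FreeGroup.norm_mk_le.trans_lt ?_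
      rw [← hN, FreeGroup.norm, hxl]
      simp
    obtain ⟨i, j, hij⟩ := ih _ hlt (FreeGroup.mk l) (by
      rw [e1] at hgen
      convert hgen using 3
      congr 1
      group) rfl
    exact ⟨i, j + e, by rw [e1, hij, zpow_add, mul_assoc]⟩

end RankTwo

/-! ### Loops isotopic to a small circle -/

section FreeHomotopy

variable {X : Type*} [TopologicalSpace X]

theorem quotient_symm_trans {p q r : X} (δ : Path.Homotopic.Quotient p q)
    (δ' : Path.Homotopic.Quotient q r) : (δ.trans δ').symm = δ'.symm.trans δ.symm := by
  induction δ using Path.Homotopic.Quotient.ind with | mk γ =>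
  induction δ' using Path.Homotopic.Quotient.ind with | mk γ' =>
  simp only [← Path.Homotopic.Quotient.mk_trans, ← Path.Homotopic.Quotient.mk_symm,
    Path.trans_symm]

theorem conjPath_trans {p q r : X} (δ : Path.Homotopic.Quotient p q)
    (δ' : Path.Homotopic.Quotient q r) (α : FundamentalGroup X p) :
    conjPath (δ.trans δ') α = conjPath δ' (conjPath δ α) := by
  change (δ.trans δ').symm.trans (Path.Homotopic.Quotient.trans α (δ.trans δ')) =
    δ'.symm.trans ((δ.symm.trans (Path.Homotopic.Quotient.trans α δ)).trans δ')
  rw [quotient_symm_trans]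
  simp only [Path.Homotopic.Quotient.trans_assoc]

theorem conjPath_symm {p q : X} (δ : Path.Homotopic.Quotient p q) (α : FundamentalGroup X q) :
    conjPath δ.symm α = (conjPath δ).symm α := by
  rw [MulEquiv.eq_symm_apply]
  change δ.symm.trans ((δ.symm.symm.trans (Path.Homotopic.Quotient.trans α δ.symm)).trans δ) = α
  grind

theorem conjPath_self {p : X} (δ : Path.Homotopic.Quotient p p) (α : FundamentalGroup X p) :
    conjPath δ α = FundamentalGroup.fromPath δ * α * (FundamentalGroup.fromPath δ)⁻¹ := by
  rfl

/-- The conjugating path is the one traced by the base point during the homotopy. -/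
theorem exists_conj_of_freeHomotopy {P : Set ℂ} {y₀ y₁ : ↥Pᶜ} (γ : Path y₀ y₀) (γ' : Path y₁ y₁)
    (H : unitInterval × unitInterval → ℂ) (hH : Continuous H) (hP : ∀ x, H x ∈ Pᶜ)
    (hloop : ∀ s, H (s, 0) = H (s, 1)) (h0 : ∀ t, H (0, t) = γ t) (h1 : ∀ t, H (1, t) = γ' t) :
    ∃ δ : Path.Homotopic.Quotient y₀ y₁,
      FundamentalGroup.fromPath hc(γ') = conjPath δ (FundamentalGroup.fromPath hc(γ)) := by
  let l : Path y₀ y₁ := subsetPath (fun s => H (s, 0)) (by fun_prop) (fun s => hP _)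
    (by rw [h0, γ.source]) (by rw [h1, γ'.source])
  have := square_trans_subset H hH hP γ γ' l l (fun s => (h0 s).symm) (fun s => (h1 s).symm)
    (fun s => rfl) (fun s => hloop s)
  refine ⟨hc(l), ?_⟩
  change hc(γ') = hc(l).symm.trans (hc(γ).trans hc(l))
  rw [this]
  grind

/-- The circle of radius `ε` about `a`, as a loop in the complement of `P`. -/
def circleLoop {P : Set ℂ} {a : ℂ} {ε : ℝ} (hε : 0 < ε)
    (hP : Metric.closedBall a ε ∩ P = {a}) : Path (⟨circleMap a ε 0, fun h => by
      have h1 : circleMap a ε 0 ∈ Metric.closedBall a ε ∩ P :=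
        ⟨circleMap_mem_closedBall a hε.le 0, h⟩
      rw [hP] at h1
      exact circleMap_ne_center hε.ne' h1⟩ : ↥Pᶜ) ⟨circleMap a ε 0, fun h => by
      have h1 : circleMap a ε 0 ∈ Metric.closedBall a ε ∩ P :=
        ⟨circleMap_mem_closedBall a hε.le 0, h⟩
      rw [hP] at h1
      exact circleMap_ne_center hε.ne' h1⟩ :=
  subsetPath (S := Pᶜ) (fun t => circleMap a ε (2 * Real.pi * t)) (by fun_prop) (fun t (h : _ ∈ P) => by
      have h1 : circleMap a ε (2 * Real.pi * t) ∈ Metric.closedBall a ε ∩ P :=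
        ⟨circleMap_mem_closedBall a hε.le _, h⟩
      rw [hP] at h1
      exact circleMap_ne_center hε.ne' h1) (by simp) (by simp [circleMap])

theorem exists_conj_circle {P : Set ℂ} {a : ℂ} {y₀ : ↥Pᶜ} (γ : Path y₀ y₀)
    (h : IsIsotopicToSmallCircle P a fun t => (γ t : ℂ)) :
    ∃ (ε : ℝ) (hε : 0 < ε) (hP : Metric.closedBall a ε ∩ P = {a})
      (δ : Path.Homotopic.Quotient y₀ _), FundamentalGroup.fromPath hc(circleLoop hε hP) =
        conjPath δ (FundamentalGroup.fromPath hc(γ)) := by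
  obtain ⟨ε, hε, hP, H, hH, h1, h2, h3, h4⟩ := h
  exact ⟨ε, hε, hP, exists_conj_of_freeHomotopy γ (circleLoop hε hP) H hH (fun x => h1 x.1 x.2)
    (fun s => (h2 s).1) h3 h4⟩

theorem exists_conj_circles {P : Set ℂ} {a : ℂ} {ε ε' : ℝ} (hε : 0 < ε) (hε' : 0 < ε')
    (hP : Metric.closedBall a ε ∩ P = {a}) (hP' : Metric.closedBall a ε' ∩ P = {a}) :
    ∃ δ, FundamentalGroup.fromPath hc(circleLoop hε' hP') =
      conjPath δ (FundamentalGroup.fromPath hc(circleLoop hε hP)) := by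
  refine exists_conj_of_freeHomotopy _ _ (fun x => circleMap a ((1 - (x.1 : ℝ)) * ε + x.1 * ε')
    (2 * Real.pi * x.2)) (by unfold circleMap; fun_prop) (fun x hx => ?_) (fun s => ?_)
    (fun t => ?_) fun t => ?_
  · have h0 := x.1.2.1
    have h1 := x.1.2.2
    have hpos : 0 < (1 - (x.1 : ℝ)) * ε + x.1 * ε' := by
      rcases h0.eq_or_lt with h | h
      · rw [← h]; linarith
      · nlinarith [mul_pos h hε', mul_nonneg (sub_nonneg.mpr h1) hε.le]
    have hmem := circleMap_mem_closedBall a hpos.le (2 * Real.pi * x.2)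
    refine circleMap_ne_center (c := a) hpos.ne' (θ := 2 * Real.pi * x.2) ?_
    rcases le_total ε ε' with hle | hle
    · have : (1 - (x.1 : ℝ)) * ε + x.1 * ε' ≤ ε' := by nlinarith
      have h2 : circleMap a ((1 - (x.1 : ℝ)) * ε + x.1 * ε') (2 * Real.pi * x.2) ∈
        Metric.closedBall a ε' ∩ P := ⟨Metric.closedBall_subset_closedBall this hmem, hx⟩
      rwa [hP'] at h2
    · have : (1 - (x.1 : ℝ)) * ε + x.1 * ε' ≤ ε := by nlinarith
      have h2 : circleMap a ((1 - (x.1 : ℝ)) * ε + x.1 * ε') (2 * Real.pi * x.2) ∈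
        Metric.closedBall a ε ∩ P := ⟨Metric.closedBall_subset_closedBall this hmem, hx⟩
      rwa [hP] at h2
  · simp [circleMap]
  · simp [circleLoop]
  · simp [circleLoop]

/-- Loops which are isotopic to small circles about the same puncture are conjugate. -/
theorem exists_conj_of_isotopic {P : Set ℂ} {a : ℂ} {y₀ y₁ : ↥Pᶜ} (γ : Path y₀ y₀)
    (γ' : Path y₁ y₁) (h : IsIsotopicToSmallCircle P a fun t => (γ t : ℂ))
    (h' : IsIsotopicToSmallCircle P a fun t => (γ' t : ℂ)) :
    ∃ δ : Path.Homotopic.Quotient y₀ y₁,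
      FundamentalGroup.fromPath hc(γ') = conjPath δ (FundamentalGroup.fromPath hc(γ)) := by
  obtain ⟨ε, hε, hP, δ, hδ⟩ := exists_conj_circle γ h
  obtain ⟨ε', hε', hP', δ', hδ'⟩ := exists_conj_circle γ' h'
  obtain ⟨σ, hσ⟩ := exists_conj_circles hε hε' hP hP'
  refine ⟨δ.trans (σ.trans δ'.symm), ?_⟩
  rw [conjPath_trans, conjPath_trans, ← hδ, ← hσ, hδ', conjPath_symm, MulEquiv.symm_apply_apply]

end FreeHomotopy

/-! ### Two punctures -/

section TwoPunctures

theorem closure_pair_eq_top {G : Type*} [Group G] {b : Fin 2 → G}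
    (h : Function.Surjective (FreeGroup.lift b)) : Subgroup.closure {b 0, b 1} = ⊤ := by
  rw [← MonoidHom.range_eq_top, FreeGroup.range_lift_eq_closure] at h
  rw [← h]
  congr 1
  ext x
  simp [Fin.exists_fin_two, eq_comm]

/-- In a free group of rank two, the conjugates of the two elements of a basis which generate are
simultaneously conjugate to this basis. -/
theorem exists_simultaneous_conj {G : Type*} [Group G] {b : Fin 2 → G}
    (hb : Function.Bijective (FreeGroup.lift b)) (g : Fin 2 → G)
    (hg : Function.Surjective (FreeGroup.lift fun i => g i * b i * (g i)⁻¹)) :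
    ∃ u : G, ∀ i, g i * b i * (g i)⁻¹ = u * b i * u⁻¹ := by
  obtain ⟨k, hk⟩ := hb.2 ((g 0)⁻¹ * g 1)
  have h1 := closure_conj (g 0)⁻¹ _ _ (closure_pair_eq_top hg)
  have h2 : Subgroup.closure {FreeGroup.of 0, k * FreeGroup.of 1 * k⁻¹} = ⊤ := by
    let e := MulEquiv.ofBijective _ hb
    have h3 : (Subgroup.closure {FreeGroup.of 0, k * FreeGroup.of 1 * k⁻¹}).map e.toMonoidHom =
        (⊤ : Subgroup (FreeGroup (Fin 2))).map e.toMonoidHom := by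
      rw [MonoidHom.map_closure, image_pair, Subgroup.map_top_of_surjective e.toMonoidHom e.surjective,
        ← h1]
      have e0 : e.toMonoidHom (FreeGroup.of 0) = b 0 := FreeGroup.lift_apply_of ..
      have e1 : e.toMonoidHom (FreeGroup.of 1) = b 1 := FreeGroup.lift_apply_of ..
      have ek : e.toMonoidHom k = (g 0)⁻¹ * g 1 := hk
      rw [map_mul, map_mul, map_inv, e0, e1, ek]
      congr 1
      congr 1
      · group
      · congr 1; group
    exact Subgroup.map_injective e.injective h3
  obtain ⟨i, j, hij⟩ := eq_mul_of_closure_eq_top k h2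
  have h4 : g 1 = g 0 * (b 0 ^ i * b 1 ^ j) := by
    rw [hij, map_mul, map_zpow, map_zpow, FreeGroup.lift_apply_of, FreeGroup.lift_apply_of] at hk
    rw [hk]; group
  -- As `g 1 = g 0 * b 0 ^ i * b 1 ^ j`, the factor `b 0 ^ i` can be added for the first element and
  -- `b 1 ^ j` dropped for the second, since they commute with `b 0` and with `b 1`.
  refine ⟨g 0 * b 0 ^ i, fun l => ?_⟩
  fin_cases l
  · simp only [Fin.zero_eta]; group
  · simp only [Fin.mk_one]; rw [h4]; group

theorem asymptoticRelator_one (n : ℕ) : asymptoticRelator 1 n = modelRelator n := by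
  simp [asymptoticRelator, modelRelator]

/-- If the complement is presented by kites about two punctures, it is presented by every geometric
basis. -/
theorem HasKitePresentation.of_isGeometricBasis {B : Set ℂ} {C : Set (ℂ × ℂ)} {x₀ : ℂ}
    {hx : x₀ ∈ B} {a : Fin 2 → ℂ} {n : ℕ} (h : HasKitePresentation (m := 1) B C x₀ hx a n)
    (y₁ : ↥(fibre C x₀)ᶜ) (b' : Fin 2 → FundamentalGroup ↥(fibre C x₀)ᶜ y₁)
    (hb' : IsGeometricBasis (fibre C x₀) y₁ a b') :
    IsPresentedBy B C x₀ hx y₁ b' {modelRelator n} := by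
  rw [← asymptoticRelator_one]
  obtain ⟨y₀, b, ⟨hfree, γ, hγ, hiso, -⟩, hpres⟩ := h.exists_geometricBasis
  obtain ⟨hfree', γ', hγ', hiso', -⟩ := hb'
  choose δ hδ using fun i => exists_conj_of_isotopic (γ i) (γ' i) (hiso i) (hiso' i)
  have hp : Presents (fibreInclusion B C x₀ hx) y₀ b {asymptoticRelator 1 n} := hpres
  let β : Fin 2 → FundamentalGroup ↥(fibre C x₀)ᶜ y₁ := fun i => conjPath (δ 0) (b i)
  have hβ := bijective_lift_comp (conjPath (δ 0)) hfree
  -- All elements of the first basis are moved to `y₁` along the same path `δ 0`; the remaining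
  -- discrepancy for each puncture is then a conjugation inside one group.
  let g : Fin 2 → FundamentalGroup ↥(fibre C x₀)ᶜ y₁ := fun i =>
    FundamentalGroup.fromPath ((δ 0).symm.trans (δ i))
  have e : ∀ i, b' i = g i * β i * (g i)⁻¹ := by
    intro i
    rw [hγ' i, hδ i, ← conjPath_self, ← conjPath_trans, ← hγ i]
    congr 2
    grind
  have e' : b' = fun i => g i * β i * (g i)⁻¹ := funext e
  obtain ⟨u, hu⟩ := exists_simultaneous_conj hβ g (by rw [← e']; exact hfree'.2)
  have := (hp.conj (δ 0)).conj u.toPath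
  have e2 : (fun i => conjPath u.toPath (conjPath (δ 0) (b i))) = b' := by
    funext i
    rw [e i, hu i]
    rfl
  rw [e2] at this
  exact this

end TwoPunctures

/-! ### The model curve `y (y xⁿ - 1) = 0` -/

section Model

theorem mem_asymptoticCurve {n : ℕ} {p : ℂ × ℂ} :
    p ∈ asymptoticCurve n ↔ p.2 = 0 ∨ p.1 ^ n * p.2 = 1 := by
  change p.2 * (p.2 * p.1 ^ n - 1) = 0 ↔ _
  rw [mul_eq_zero, sub_eq_zero, mul_comm p.2]

theorem one_add_norm_pos (x : ℂ) : 0 < 1 + ‖x‖ := by positivity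

theorem norm_div_one_add (x : ℂ) : ‖x / ((1 + ‖x‖ : ℝ) : ℂ)‖ = ‖x‖ / (1 + ‖x‖) := by
  rw [norm_div, Complex.norm_real, Real.norm_of_nonneg (one_add_norm_pos x).le]

theorem norm_div_one_sub {x : ℂ} (hx : ‖x‖ < 1) :
    ‖x / ((1 - ‖x‖ : ℝ) : ℂ)‖ = ‖x‖ / (1 - ‖x‖) := by
  rw [norm_div, Complex.norm_real, Real.norm_of_nonneg (by linarith)]

/-- Radial expansion of the unit disc to the plane, with the corresponding contraction of the
vertical lines. -/
def modelHomeomorph (n : ℕ) :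
    ↥(complementOver (Metric.ball 0 1) {p | p.2 ∈ range (fun _ : Fin 1 => (0 : ℂ)) ∨
      p.1 ^ n * Complex.exp 0 * p.2 = 1}) ≃ₜ ↥(complementOver univ (asymptoticCurve n)) where
  toFun p := ⟨(p.1.1 / ((1 - ‖p.1.1‖ : ℝ) : ℂ), ((1 - ‖p.1.1‖ : ℝ) : ℂ) ^ n * p.1.2), mem_univ _, by
    obtain ⟨⟨x, y⟩, hx, hp⟩ := p
    have hx1 : (1 - ‖x‖ : ℝ) ≠ 0 := by
      have : ‖x‖ < 1 := by simpa using hx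
      linarith
    have hx2 : ((1 - ‖x‖ : ℝ) : ℂ) ≠ 0 := Complex.ofReal_ne_zero.mpr hx1
    rw [mem_asymptoticCurve]
    rintro (h | h)
    · exact hp (Or.inl ⟨0, ((mul_eq_zero.mp h).resolve_left (pow_ne_zero _ hx2)).symm⟩)
    · refine hp (Or.inr ?_)
      change (x / ((1 - ‖x‖ : ℝ) : ℂ)) ^ n * (((1 - ‖x‖ : ℝ) : ℂ) ^ n * y) = 1 at h
      change x ^ n * Complex.exp 0 * y = 1
      rwa [Complex.exp_zero, mul_one, ← div_mul_cancel₀ x hx2, mul_pow, mul_assoc]⟩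
  invFun p := ⟨(p.1.1 / ((1 + ‖p.1.1‖ : ℝ) : ℂ), ((1 + ‖p.1.1‖ : ℝ) : ℂ) ^ n * p.1.2), by
    rw [mem_ball_zero_iff]
    change ‖p.1.1 / _‖ < 1
    rw [norm_div_one_add, div_lt_one (one_add_norm_pos _)]
    linarith, by
    obtain ⟨⟨x, y⟩, hx, hp⟩ := p
    have hx2 : ((1 + ‖x‖ : ℝ) : ℂ) ≠ 0 := Complex.ofReal_ne_zero.mpr (one_add_norm_pos x).ne'
    rw [mem_asymptoticCurve] at hp
    rintro (⟨i, h⟩ | h)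
    · exact hp (Or.inl ((mul_eq_zero.mp h.symm).resolve_left (pow_ne_zero _ hx2)))
    · refine hp (Or.inr ?_)
      change (x / ((1 + ‖x‖ : ℝ) : ℂ)) ^ n * Complex.exp 0 *
        (((1 + ‖x‖ : ℝ) : ℂ) ^ n * y) = 1 at h
      rwa [Complex.exp_zero, mul_one, ← mul_assoc, ← mul_pow, div_mul_cancel₀ _ hx2] at h⟩
  left_inv p := by
    obtain ⟨⟨x, y⟩, hx, hp⟩ := p
    have hx0 : ‖x‖ < 1 := by simpa using hx
    have hx1 : (1 - ‖x‖ : ℝ) ≠ 0 := by linarith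
    have hx2 : ((1 - ‖x‖ : ℝ) : ℂ) ≠ 0 := Complex.ofReal_ne_zero.mpr hx1
    have e : (1 + ‖x / ((1 - ‖x‖ : ℝ) : ℂ)‖ : ℝ) = (1 - ‖x‖)⁻¹ := by
      rw [norm_div_one_sub hx0]; field_simp; ring
    apply Subtype.ext
    apply Prod.ext
    · change x / ((1 - ‖x‖ : ℝ) : ℂ) / ((1 + ‖x / ((1 - ‖x‖ : ℝ) : ℂ)‖ : ℝ) : ℂ) = x
      rw [e, Complex.ofReal_inv]; field_simp
    · change ((1 + ‖x / ((1 - ‖x‖ : ℝ) : ℂ)‖ : ℝ) : ℂ) ^ n * (((1 - ‖x‖ : ℝ) : ℂ) ^ n * y) = y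
      rw [e, Complex.ofReal_inv, inv_pow, inv_mul_cancel_left₀ (pow_ne_zero _ hx2)]
  right_inv p := by
    obtain ⟨⟨x, y⟩, hx, hp⟩ := p
    have hx1 := (one_add_norm_pos x).ne'
    have hx2 : ((1 + ‖x‖ : ℝ) : ℂ) ≠ 0 := Complex.ofReal_ne_zero.mpr hx1
    have e : (1 - ‖x / ((1 + ‖x‖ : ℝ) : ℂ)‖ : ℝ) = (1 + ‖x‖)⁻¹ := by
      rw [norm_div_one_add]; field_simp; ring
    apply Subtype.ext
    apply Prod.ext
    · change x / ((1 + ‖x‖ : ℝ) : ℂ) / ((1 - ‖x / ((1 + ‖x‖ : ℝ) : ℂ)‖ : ℝ) : ℂ) = x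
      rw [e, Complex.ofReal_inv]; field_simp
    · change ((1 - ‖x / ((1 + ‖x‖ : ℝ) : ℂ)‖ : ℝ) : ℂ) ^ n * (((1 + ‖x‖ : ℝ) : ℂ) ^ n * y) = y
      rw [e, Complex.ofReal_inv, inv_pow, inv_mul_cancel_left₀ (pow_ne_zero _ hx2)]
  continuous_toFun := by
    refine Continuous.subtype_mk (Continuous.prodMk (Continuous.div (by fun_prop) (by fun_prop)
      fun p => ?_) (by fun_prop)) _
    have : ‖p.1.1‖ < 1 := by simpa using p.2.1
    exact Complex.ofReal_ne_zero.mpr (by linarith)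
  continuous_invFun := by
    refine Continuous.subtype_mk (Continuous.prodMk (Continuous.div (by fun_prop) (by fun_prop)
      fun p => ?_) (by fun_prop)) _
    exact Complex.ofReal_ne_zero.mpr (one_add_norm_pos _).ne'

theorem asymptoticCurve_hasKitePresentation {n : ℕ} (hn : 1 ≤ n) {x₀ : ℂ} (hx₀ : x₀ ≠ 0) :
    HasKitePresentation (m := 1) univ (asymptoticCurve n) x₀ (mem_univ _) ![(x₀ ^ n)⁻¹, 0] n := by
  have hpos := one_add_norm_pos x₀
  have hu : ((1 + ‖x₀‖ : ℝ) : ℂ) ≠ 0 := Complex.ofReal_ne_zero.mpr hpos.ne'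
  -- On the unit disc `|xⁿ| ≤ 1`, so the bound `R = 1 / 8` for the branch `y = 0` satisfies the
  -- smallness condition. The base point is the preimage of `x₀` under the radial expansion.
  obtain ⟨σ, hσ⟩ := exists_hasKitePresentation (m := 1) (n := n) hn (r := 1) (R := 1 / 8)
    (by norm_num) (c := fun _ => 0) (fun _ _ _ => Subsingleton.elim _ _) (fun _ => by norm_num)
    (ℓ := fun _ => 0) continuous_const (fun x hx => by
      rw [mem_ball_zero_iff] at hx
      rw [Complex.exp_zero, mul_one, norm_pow]
      have := pow_le_one₀ (n := n) (norm_nonneg x) hx.le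
      linarith) (x₀ := x₀ / ((1 + ‖x₀‖ : ℝ) : ℂ))
    (by
      rw [mem_ball_zero_iff, norm_div_one_add, div_lt_one hpos]
      linarith) (div_ne_zero hx₀ hu)
  have e : (1 - ‖x₀ / ((1 + ‖x₀‖ : ℝ) : ℂ)‖ : ℝ) = (1 + ‖x₀‖)⁻¹ := by
    rw [norm_div_one_add]; field_simp; ring
  have e1 : x₀ / ((1 + ‖x₀‖ : ℝ) : ℂ) /
      ((1 - ‖x₀ / ((1 + ‖x₀‖ : ℝ) : ℂ)‖ : ℝ) : ℂ) = x₀ := by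
    rw [e, Complex.ofReal_inv]; field_simp
  have key := hσ.transfer (C' := asymptoticCurve n) (x₀' := x₀) (mem_univ _) (modelHomeomorph n)
    (u := (((1 + ‖x₀‖)⁻¹ : ℝ) : ℂ) ^ n)
    (pow_ne_zero _ (Complex.ofReal_ne_zero.mpr (inv_ne_zero hpos.ne'))) (fun y => ?_) fun y => ?_
  · convert key using 1
    funext i
    refine Fin.cases ?_ (fun j => ?_) i
    · simp only [Matrix.cons_val_zero, Fin.cons_zero, Complex.exp_zero, mul_one, div_pow,
        Complex.ofReal_inv, inv_pow, inv_div]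
      rw [inv_mul_eq_div, div_div, mul_comm, ← div_div, div_self (pow_ne_zero _ hu), one_div]
    · fin_cases j
      simp
  · change y ∈ range _ ∨ _ ↔ (x₀, _) ∈ asymptoticCurve n
    rw [mem_asymptoticCurve]
    refine or_congr ?_ ?_
    · rw [mem_range, mul_eq_zero, or_iff_right (pow_ne_zero _ (Complex.ofReal_ne_zero.mpr
        (inv_ne_zero hpos.ne')))]
      exact ⟨fun ⟨_, h⟩ => h.symm, fun h => ⟨0, h.symm⟩⟩
    · simp only [Complex.exp_zero, mul_one, div_pow, Complex.ofReal_inv]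
      rw [div_eq_mul_inv, inv_pow, mul_assoc]
  · refine Prod.ext e1 ?_
    change ((1 - ‖x₀ / ((1 + ‖x₀‖ : ℝ) : ℂ)‖ : ℝ) : ℂ) ^ n * (y : ℂ) = _
    rw [e]

end Model

/-! ### Local equations of a graph -/

section LocalEquation

/-- An analytic function which divides its derivative vanishes near its zeros. -/
theorem eventually_eq_zero_of_deriv_eq_mul {h k : ℂ → ℂ} (hh : AnalyticAt ℂ h 0)
    (hk : AnalyticAt ℂ k 0) (h0 : h 0 = 0) (hd : ∀ᶠ w in 𝓝 0, deriv h w = h w * k w) :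
    ∀ᶠ w in 𝓝 0, h w = 0 := by
  by_contra hne
  obtain ⟨d, hd'⟩ : ∃ d : ℕ, analyticOrderAt h 0 = d :=
    ⟨_, (ENat.natCast_toNat (fun ht => hne (analyticOrderAt_eq_top.mp ht))).symm⟩
  obtain ⟨u, hu, hu0, hhu⟩ := hh.analyticOrderAt_eq_natCast.mp hd'
  have hd0 : d ≠ 0 := by
    rintro rfl
    have := hhu.self_of_nhds
    simp [h0] at this
    exact hu0 this.symm
  obtain ⟨e, rfl⟩ := Nat.exists_eq_succ_of_ne_zero hd0
  -- With `h = w ^ (e + 1) * u` the equation can be divided by `w ^ e`; in the limit at `0` it gives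
  -- `(e + 1) * u 0 = 0`, that is, the derivative has smaller order than `h`.
  have h1 : ∀ᶠ w in 𝓝[≠] (0 : ℂ), ((e : ℂ) + 1) * u w + w * deriv u w = w * (u w * k w) := by
    have h2 := hhu.eventually_nhds
    filter_upwards [nhdsWithin_le_nhds h2, nhdsWithin_le_nhds hu.eventually_analyticAt,
      nhdsWithin_le_nhds hd, self_mem_nhdsWithin] with w hw huw hdw hw0
    have h3 : deriv h w = ((e : ℂ) + 1) * w ^ e * u w + w ^ (e + 1) * deriv u w := by
      have : h =ᶠ[𝓝 w] fun w => w ^ (e + 1) * u w := by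
        filter_upwards [hw] with z hz; simpa using hz
      rw [this.deriv_eq]
      have := ((hasDerivAt_pow (e + 1) w).mul huw.differentiableAt.hasDerivAt).deriv
      have e1 : (fun x => x ^ (e + 1)) * u = fun w => w ^ (e + 1) * u w := rfl
      simpa [e1] using this
    have hw' := hw.self_of_nhds
    simp only [sub_zero, smul_eq_mul, Nat.succ_eq_add_one] at hw'
    rw [h3, hw'] at hdw
    have hwe : w ^ e ≠ 0 := pow_ne_zero _ hw0
    apply mul_left_cancel₀ hwe
    linear_combination hdw
  have hu' := hu.deriv.continuousAt
  have huc := hu.continuousAt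
  have hkc := hk.continuousAt
  have t1 : Tendsto (fun w => ((e : ℂ) + 1) * u w + w * deriv u w) (𝓝[≠] 0)
      (𝓝 (((e : ℂ) + 1) * u 0 + 0 * deriv u 0)) := by
    have : ContinuousAt (fun w => ((e : ℂ) + 1) * u w + w * deriv u w) 0 := by fun_prop
    exact this.tendsto.mono_left nhdsWithin_le_nhds
  have t2 : Tendsto (fun w => w * (u w * k w)) (𝓝[≠] 0) (𝓝 (0 * (u 0 * k 0))) := by
    have : ContinuousAt (fun w => w * (u w * k w)) 0 := by fun_prop
    exact this.tendsto.mono_left nhdsWithin_le_nhds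
  have := tendsto_nhds_unique (t1.congr' h1) t2
  rw [zero_mul, zero_mul, add_zero, mul_eq_zero] at this
  exact this.elim (by exact_mod_cast Nat.succ_ne_zero e) hu0

/-- A holomorphic function with a single simple zero in a disc is bounded below by its values on
the boundary. -/
theorem norm_sub_mul_le_of_simple_zero {F : ℂ → ℂ} {ε μ : ℝ} (hμ : 0 < μ)
    (hF : ∀ w ∈ Metric.closedBall (0 : ℂ) ε, AnalyticAt ℂ F w) {z : ℂ} (hz : ‖z‖ < ε)
    (hzero : ∀ w ∈ Metric.closedBall (0 : ℂ) ε, F w = 0 ↔ w = z) (hd : deriv F z ≠ 0)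
    (hle : ∀ w ∈ Metric.sphere (0 : ℂ) ε, μ ≤ ‖F w‖) {w : ℂ} (hw : w ∈ Metric.closedBall 0 ε) :
    μ / (2 * ε) * ‖w - z‖ ≤ ‖F w‖ := by
  have hε : 0 < ε := (norm_nonneg z).trans_lt hz
  have hFz : F z = 0 := (hzero z (by simpa using hz.le)).2 rfl
  -- The quotient of `F` by `w - z` has no zeros in the disc, so the maximum principle applies to
  -- its inverse.
  let g := dslope F z
  have hg : ∀ v, (v - z) * g v = F v := fun v => by
    have := sub_smul_dslope F z v
    rwa [hFz, sub_zero, smul_eq_mul] at this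
  have hg0 : ∀ v ∈ Metric.closedBall (0 : ℂ) ε, g v ≠ 0 := by
    intro v hv h
    by_cases hvz : v = z
    · rw [hvz] at h
      exact hd (by rwa [← dslope_same F z])
    · have := hg v
      rw [h, mul_zero] at this
      exact hvz ((hzero v hv).1 this.symm)
  have hgd : DiffContOnCl ℂ (fun v => (g v)⁻¹) (Metric.ball 0 ε) := by
    have hgan : ∀ v ∈ Metric.closedBall (0 : ℂ) ε, DifferentiableAt ℂ g v := by
      intro v hv
      by_cases hvz : v = z
      · have hs : {w | AnalyticAt ℂ F w} ∈ 𝓝 z := by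
          rw [← hvz]; exact (hF v hv).eventually_analyticAt
        have h2 := (Complex.differentiableOn_dslope hs).2
          fun w (hw : AnalyticAt ℂ F w) => hw.differentiableAt.differentiableWithinAt
        rw [hvz]
        exact (h2 z (mem_of_mem_nhds hs)).differentiableAt hs
      · exact (differentiableAt_dslope_of_ne hvz).2 (hF v hv).differentiableAt
    refine DifferentiableOn.diffContOnCl fun v hv => ?_
    rw [closure_ball _ hε.ne'] at hv
    exact ((hgan v hv).inv (hg0 v hv)).differentiableWithinAt
  have key := Complex.norm_le_of_forall_mem_frontier_norm_le Metric.isBounded_ball hgd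
    (C := 2 * ε / μ) (fun v hv => by
      rw [frontier_ball _ hε.ne'] at hv
      have h1 := hle v hv
      have hv' : ‖v‖ = ε := by simpa using hv
      have h2 : ‖v - z‖ ≤ 2 * ε := (norm_sub_le _ _).trans (by linarith)
      have h0 : 0 < ‖g v‖ := norm_pos_iff.2 (hg0 v (Metric.sphere_subset_closedBall hv))
      rw [← hg v, norm_mul] at h1
      rw [norm_inv, inv_le_comm₀ h0 (by positivity), inv_div, div_le_iff₀ (by positivity)]
      nlinarith) (z := w) (by rwa [closure_ball _ hε.ne'])
  have h0 : 0 < ‖g w‖ := norm_pos_iff.2 (hg0 w hw)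
  rw [norm_inv, inv_le_comm₀ h0 (by positivity), inv_div] at key
  rw [← hg w, norm_mul, mul_comm]
  gcongr

variable {f : ℂ × ℂ → ℂ} {z : ℂ → ℂ}

theorem analyticAt_slice {f : ℂ × ℂ → ℂ} {x w : ℂ} (hf : AnalyticAt ℂ f (x, w)) :
    AnalyticAt ℂ (fun w => f (x, w)) w :=
  hf.comp₂ analyticAt_const analyticAt_id

/-- If the zeros of `f (x, ·)` near `0` are single, and simple for points `x` arbitrarily close to
`0`, then `f (0, ·)` has a simple zero. -/
theorem deriv_ne_zero_of_frequently (hf : AnalyticAt ℂ f (0, 0)) (hz : ContinuousAt z 0)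
    (hz0 : z 0 = 0) (hzero : ∀ᶠ q in 𝓝 ((0 : ℂ), (0 : ℂ)), f q = 0 ↔ q.2 = z q.1)
    (hfreq : ∃ᶠ x in 𝓝 0, deriv (fun w => f (x, w)) (z x) ≠ 0) :
    deriv (fun w => f (0, w)) 0 ≠ 0 := by
  obtain ⟨ε, hε, hball⟩ := Metric.nhds_basis_closedBall.eventually_iff.1
    (hzero.and hf.eventually_analyticAt)
  rw [← closedBall_prod_same] at hball
  have hzc := hz.tendsto
  rw [hz0] at hzc
  obtain ⟨δ, hδ, hzδ⟩ := Metric.nhds_basis_closedBall.eventually_iff.1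
    (hzc.eventually (Metric.ball_mem_nhds 0 hε))
  let K : Set (ℂ × ℂ) := Metric.closedBall 0 (min δ ε) ×ˢ Metric.sphere 0 ε
  have hK : IsCompact K := (isCompact_closedBall _ _).prod (isCompact_sphere _ _)
  have hKmem : ∀ q ∈ K, q ∈ Metric.closedBall (0 : ℂ) ε ×ˢ Metric.closedBall (0 : ℂ) ε :=
    fun q hq => ⟨Metric.closedBall_subset_closedBall (min_le_right _ _) hq.1,
      Metric.sphere_subset_closedBall hq.2⟩
  have hfK : ContinuousOn (fun q => ‖f q‖) K := fun q hq =>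
    (hball (hKmem q hq)).2.continuousAt.norm.continuousWithinAt
  have hKne : K.Nonempty := by
    refine ⟨(0, (ε : ℂ)), ?_, ?_⟩
    · simp [hδ.le, hε.le]
    · simp [hε.le]
  obtain ⟨q₀, hq₀, hmin⟩ := hK.exists_isMinOn hKne hfK
  have hμ : 0 < ‖f q₀‖ := by
    rw [norm_pos_iff]
    intro h
    have h1 := (hball (hKmem q₀ hq₀)).1.1 h
    have h2 := hzδ (Metric.closedBall_subset_closedBall (min_le_left _ _) hq₀.1)
    rw [← h1, dist_zero_right] at h2
    exact h2.ne (by simpa using hq₀.2)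
  set c := ‖f q₀‖ / (2 * ε) with hc
  have hcpos : 0 < c := by positivity
  -- The bound holds, with the same constant `c`, for points `x` arbitrarily close to `0`, and
  -- passes to the limit by continuity. It excludes a multiple zero at `0`.
  have key : ∀ w ∈ Metric.closedBall (0 : ℂ) ε, c * ‖w‖ ≤ ‖f (0, w)‖ := by
    intro w hw
    by_contra! hlt
    have hcont : ContinuousAt (fun x => f (x, w)) 0 :=
      ContinuousAt.comp (g := f) (f := fun x => (x, w))
        (hball (x := (0, w)) ⟨by simp [hε.le], hw⟩).2.continuousAt (by fun_prop)
    have t1 : Tendsto (fun x => c * ‖w - z x‖) (𝓝 0) (𝓝 (c * ‖w - 0‖)) :=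
      (tendsto_const_nhds.sub hzc).norm.const_mul c
    rw [sub_zero] at t1
    have ev := (hcont.norm.tendsto.eventually_lt t1 hlt).and
      (Metric.closedBall_mem_nhds (0 : ℂ) (lt_min hδ hε))
    obtain ⟨x, hx, hx1, hx2⟩ := (hfreq.and_eventually ev).exists
    refine absurd (norm_sub_mul_le_of_simple_zero (F := fun w => f (x, w)) hμ (fun v hv => ?_)
      (z := z x) ?_ (fun v hv => ?_) hx (fun v hv => ?_) hw) (not_le.2 hx1)
    · exact analyticAt_slice
        (hball (x := (x, v)) ⟨Metric.closedBall_subset_closedBall (min_le_right _ _) hx2, hv⟩).2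
    · simpa using hzδ (Metric.closedBall_subset_closedBall (min_le_left _ _) hx2)
    · exact
        (hball (x := (x, v)) ⟨Metric.closedBall_subset_closedBall (min_le_right _ _) hx2, hv⟩).1
    · exact hmin (a := (x, v)) ⟨hx2, hv⟩
  intro hd
  have hder : HasDerivAt (fun w => f (0, w)) 0 0 := by
    have := (analyticAt_slice hf).differentiableAt.hasDerivAt
    rwa [hd] at this
  have h0 : f (0, 0) = 0 := hzero.self_of_nhds.2 hz0.symm
  have ho := hasDerivAt_iff_isLittleO.1 hder
  simp only [h0, sub_zero, smul_zero] at ho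
  have ho' := (ho.bound (half_pos hcpos)).and (Metric.closedBall_mem_nhds (0 : ℂ) hε)
  obtain ⟨w, ⟨hw1, hw2⟩, hw0⟩ := ((ho'.filter_mono (nhdsWithin_le_nhds (s := {0}ᶜ))).and
    self_mem_nhdsWithin).exists
  have := key w hw2
  have hw0 : 0 < ‖w‖ := norm_pos_iff.2 hw0
  nlinarith

/-- A reduced equation of a graph has a simple zero on the vertical line. -/
theorem IsReducedEquationAt.deriv_ne_zero {S : Set (ℂ × ℂ)} (hf : IsReducedEquationAt S (0, 0) f)
    (hz : ContinuousAt z 0) (hz0 : z 0 = 0)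
    (hS : ∀ᶠ q in 𝓝 ((0 : ℂ), (0 : ℂ)), q ∈ S ↔ q.2 = z q.1) :
    deriv (fun w => f (0, w)) 0 ≠ 0 := by
  obtain ⟨hfan, hfS, hdiv⟩ := hf
  have hzero : ∀ᶠ q in 𝓝 ((0 : ℂ), (0 : ℂ)), f q = 0 ↔ q.2 = z q.1 := by
    filter_upwards [hfS, hS] with q h1 h2
    rw [← h1, h2]
  refine deriv_ne_zero_of_frequently hfan hz hz0 hzero fun hall => ?_
  have hall : ∀ᶠ x in 𝓝 0, deriv (fun w => f (x, w)) (z x) = 0 := by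
    filter_upwards [hall] with x hx using not_not.1 hx
  -- This is the derivative of `f` in the second variable. If it vanished on the graph near the
  -- origin, it would be divisible by the reduced equation `f`. On the line `x = 0` the function `f`
  -- would then divide its own derivative and vanish identically, whereas its only zero there is
  -- `0`.
  let g : ℂ × ℂ → ℂ := fun q => fderiv ℂ f q (0, 1)
  have hg : ∀ {q}, AnalyticAt ℂ f q → deriv (fun w => f (q.1, w)) q.2 = g q := by
    intro q hq
    have h1 : HasFDerivAt f (fderiv ℂ f q) (q.1, q.2) := hq.differentiableAt.hasFDerivAt
    have h2 : HasDerivAt (fun w : ℂ => (q.1, w)) (0, 1) q.2 :=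
      (hasDerivAt_const _ _).prodMk (hasDerivAt_id _)
    exact (h1.comp_hasDerivAt q.2 h2).deriv
  have hgan : AnalyticAt ℂ g (0, 0) := ((ContinuousLinearMap.apply ℂ ℂ ((0, 1) : ℂ × ℂ)).analyticAt _).comp hfan.fderiv
  obtain ⟨k, hk, hgk⟩ := hdiv g hgan (by
    have h1 : ∀ᶠ q in 𝓝 ((0 : ℂ), (0 : ℂ)), deriv (fun w => f (q.1, w)) (z q.1) = 0 :=
      (continuous_fst.tendsto' ((0 : ℂ), (0 : ℂ)) 0 rfl).eventually hall
    filter_upwards [h1, hS, hfan.eventually_analyticAt] with q h2 h3 h4 hq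
    rw [← hg h4, h3.1 hq, h2])
  have hslice : Tendsto (fun w : ℂ => ((0 : ℂ), w)) (𝓝 0) (𝓝 (0, 0)) :=
    (by fun_prop : Continuous fun w : ℂ => ((0 : ℂ), w)).tendsto' _ _ rfl
  have := eventually_eq_zero_of_deriv_eq_mul (analyticAt_slice hfan) (analyticAt_slice hk)
    (hzero.self_of_nhds.2 hz0.symm) (by
      filter_upwards [hslice.eventually hfan.eventually_analyticAt, hslice.eventually hgk]
        with w h1 h2
      exact (hg h1).trans h2)
  have h2 := this.and (hslice.eventually hzero)
  obtain ⟨w, ⟨hw1, hw2⟩, hw0⟩ := ((h2.filter_mono (nhdsWithin_le_nhds (s := {0}ᶜ))).and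
    self_mem_nhdsWithin).exists
  exact hw0 ((hw2.1 hw1).trans hz0)

/-- The order of contact of a graph with the axis is the order of the restriction to the axis of a
reduced equation of the graph. -/
theorem IsReducedEquationAt.exists_tendsto_div_pow {S : Set (ℂ × ℂ)} {n : ℕ}
    (hf : IsReducedEquationAt S (0, 0) f) (hord : analyticOrderAt (fun t => f (t, 0)) 0 = n)
    (hz : ContinuousAt z 0) (hz0 : z 0 = 0)
    (hS : ∀ᶠ q in 𝓝 ((0 : ℂ), (0 : ℂ)), q ∈ S ↔ q.2 = z q.1) :
    ∃ u : ℂ, u ≠ 0 ∧ Tendsto (fun x => z x / x ^ n) (𝓝[≠] 0) (𝓝 u) := by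
  have hl := hf.deriv_ne_zero hz hz0 hS
  set l := deriv (fun w => f (0, w)) 0 with hldef
  have han : AnalyticAt ℂ (fun t => f (t, 0)) 0 :=
    AnalyticAt.comp₂ (h := f) (f := fun t => t) (g := fun _ => 0) hf.1 analyticAt_id analyticAt_const
  obtain ⟨a, ha, ha0, hfa⟩ := han.analyticOrderAt_eq_natCast.mp hord
  have hL : fderiv ℂ f (0, 0) (0, 1) = l := by
    have h1 : HasFDerivAt f (fderiv ℂ f (0, 0)) (0, 0) := hf.1.differentiableAt.hasFDerivAt
    have h2 : HasDerivAt (fun w : ℂ => ((0 : ℂ), w)) (0, 1) 0 :=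
      (hasDerivAt_const _ _).prodMk (hasDerivAt_id _)
    exact (h1.comp_hasDerivAt 0 h2).deriv.symm
  have hzt : Tendsto z (𝓝 0) (𝓝 0) := by simpa [hz0] using hz.tendsto
  have t1 : Tendsto (fun x : ℂ => ((x, z x), ((x, 0) : ℂ × ℂ))) (𝓝 0) (𝓝 ((0, 0), (0, 0))) :=
    (tendsto_id.prodMk_nhds hzt).prodMk_nhds (tendsto_id.prodMk_nhds tendsto_const_nhds)
  have ho := (hf.1.hasStrictFDerivAt.isLittleO).comp_tendsto t1
  have hgraph : ∀ᶠ x in 𝓝 0, f (x, z x) = 0 := by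
    have t2 : Tendsto (fun x : ℂ => (x, z x)) (𝓝 0) (𝓝 (0, 0)) := tendsto_id.prodMk_nhds hzt
    filter_upwards [t2.eventually hf.2.1, t2.eventually hS] with x h1 h2
    exact h1.1 (h2.2 rfl)
  -- As `f` vanishes on the graph, `f (x, 0)` is its difference between `(x, 0)` and `(x, z x)`.
  -- Strict differentiability makes this equivalent to `-(l * z x)`, although `z` is only known to
  -- be continuous.
  have ho2 : (fun x => f (x, 0) - (-(l * z x))) =o[𝓝 0] fun x => -(l * z x) := by
    have h3 : (fun x => f (x, 0) - (-(l * z x))) =o[𝓝 0] z := by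
      refine (ho.neg_left.congr' ?_ EventuallyEq.rfl).trans_isBigO
        (Asymptotics.IsBigO.of_bound 1 (Eventually.of_forall fun x => ?_))
      · filter_upwards [hgraph] with x hx
        have : ((x, z x) : ℂ × ℂ) - (x, 0) = z x • (0, 1) := by ext <;> simp
        simp only [Function.comp, this, map_smul, hL, hx, smul_eq_mul]
        ring
      · simp [Prod.norm_def]
    refine h3.trans_isBigO ?_
    simp_rw [← neg_mul]
    exact Asymptotics.isBigO_self_const_mul (neg_ne_zero.2 hl) _ _
  have e1 : Asymptotics.IsEquivalent (𝓝[≠] 0) (fun x => f (x, 0)) fun x => -(l * z x) :=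
    Asymptotics.IsLittleO.mono ho2 nhdsWithin_le_nhds
  refine ⟨-(a 0 / l), neg_ne_zero.2 (div_ne_zero ha0 hl), ?_⟩
  have hzne : ∀ᶠ x in 𝓝[≠] 0, -(l * z x) ≠ 0 := by
    have hane := ha.continuousAt.eventually_ne ha0
    have hfx : ∀ᶠ x in 𝓝[≠] (0 : ℂ), f (x, 0) ≠ 0 := by
      filter_upwards [nhdsWithin_le_nhds hfa, nhdsWithin_le_nhds hane, self_mem_nhdsWithin]
        with x h1 h2 h3
      rw [h1, sub_zero, smul_eq_mul]
      exact mul_ne_zero (pow_ne_zero _ h3) h2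
    filter_upwards [hfx, nhdsWithin_le_nhds hgraph] with x h1 h2 h3
    have : z x = 0 := by simpa [hl] using h3
    rw [this] at h2
    exact h1 h2
  have e2 := (Asymptotics.isEquivalent_iff_tendsto_one hzne).1 e1
  have e3 := (e2.inv₀ one_ne_zero).mul
    ((ha.continuousAt.tendsto.mono_left (nhdsWithin_le_nhds (s := {0}ᶜ))).div_const (-l))
  rw [inv_one, one_mul, div_neg] at e3
  refine e3.congr' ?_
  filter_upwards [nhdsWithin_le_nhds hfa, hzne, self_mem_nhdsWithin,
    nhdsWithin_le_nhds (ha.continuousAt.eventually_ne ha0)] with x h1 h2 h3 h4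
  simp only [sub_zero, smul_eq_mul] at h1
  have hx : x ^ n ≠ 0 := pow_ne_zero _ h3
  have hzx : z x ≠ 0 := fun h => h2 (by simp [h])
  simp only [Pi.div_apply, h1]
  field_simp

end LocalEquation

/-! ### Affine coordinates on the projective line -/

section Charts

/-- The affine coordinate, extended by `0` at infinity. -/
def affineCoord : OnePoint ℂ → ℂ
  | none => 0
  | some y => y

@[simp] theorem affineCoord_coe (y : ℂ) : affineCoord (y : OnePoint ℂ) = y := rfl

theorem continuousAt_affineCoord (y : ℂ) : ContinuousAt affineCoord (y : OnePoint ℂ) :=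
  OnePoint.continuousAt_coe.2 continuousAt_id

/-- The coordinate at infinity, with the junk value `0` at the origin. -/
def infinityCoord : OnePoint ℂ → ℂ
  | none => 0
  | some y => y⁻¹

theorem continuousAt_infinityCoord {w : OnePoint ℂ} (hw : w ≠ ((0 : ℂ) : OnePoint ℂ)) :
    ContinuousAt infinityCoord w := by
  induction w using OnePoint.rec with
  | infty =>
    rw [OnePoint.continuousAt_infty', coclosedCompact_eq_cocompact, ← Metric.cobounded_eq_cocompact]
    exact tendsto_inv₀_cobounded
  | coe y =>
    exact OnePoint.continuousAt_coe.2 (continuousAt_inv₀ fun h => hw (by rw [h]))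

theorem chartAtInfinity_infinityCoord {w : OnePoint ℂ} (hw : w ≠ ((0 : ℂ) : OnePoint ℂ)) :
    chartAtInfinity (infinityCoord w) = w := by
  induction w using OnePoint.rec with
  | infty => exact if_pos rfl
  | coe y =>
    have hy : y ≠ 0 := fun h => hw (by rw [h])
    change chartAtInfinity y⁻¹ = _
    rw [chartAtInfinity, if_neg (inv_ne_zero hy), inv_inv]

theorem chartAtInfinity_zero : chartAtInfinity 0 = OnePoint.infty := if_pos rfl

theorem chartAtInfinity_of_ne {z : ℂ} (hz : z ≠ 0) : chartAtInfinity z = ((z⁻¹ : ℂ) : OnePoint ℂ) :=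
  if_neg hz

theorem infinityCoord_chartAtInfinity (z : ℂ) : infinityCoord (chartAtInfinity z) = z := by
  by_cases hz : z = 0
  · rw [hz, chartAtInfinity_zero]; rfl
  · rw [chartAtInfinity_of_ne hz]
    exact inv_inv z

end Charts

/-! ### The branches of an asymptotic germ -/

section Branches

/-- A local equation shows that `C` is closed in `U × ℂ`, which is open in `U × ℙ¹`; the closure
adds points at infinity only. -/
theorem coe_mem_projectiveClosure_iff {U : Set ℂ} {C : Set (ℂ × ℂ)} (hC : IsCurveIn U C) {x y : ℂ}
    (hx : x ∈ U) : (x, (y : OnePoint ℂ)) ∈ projectiveClosure U C ↔ (x, y) ∈ C := by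
  refine ⟨fun h => ?_, fun h => ⟨subset_closure ⟨_, h, rfl⟩, hx⟩⟩
  obtain ⟨f, hf, -, hfC⟩ := hC.2 (x, y) hx
  rw [hfC.self_of_nhds]
  by_contra hne
  have h1 : ∀ᶠ q in 𝓝 (x, y), q ∉ C := by
    filter_upwards [hfC, hf.continuousAt.eventually_ne hne] with q h2 h3 h4
    exact h3 (h2.1 h4)
  have hemb : IsOpenEmbedding fun p : ℂ × ℂ => (p.1, (p.2 : OnePoint ℂ)) :=
    IsOpenEmbedding.id.prodMap OnePoint.isOpenEmbedding_coe
  obtain ⟨V, hV, hVo, hxV⟩ := eventually_nhds_iff.1 h1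
  obtain ⟨-, ⟨p, hp, rfl⟩, q, hq, hpq⟩ := mem_closure_iff.1 h.1 _ (hemb.isOpenMap V hVo) ⟨_, hxV, rfl⟩
  rw [hemb.injective hpq] at hq
  exact hV _ hp hq

/-- Over a small disc a covering is a disjoint union of graphs of continuous functions. -/
theorem exists_local_sections {R : ℝ} (hR : 0 < R) {Y : Type} [TopologicalSpace Y]
    {S : Set (ℂ × Y)} (hS : ∀ p ∈ S, p.1 ∈ Metric.ball (0 : ℂ) R)
    (hcov : IsCoveringMap fun p : ↥S => (⟨p.1.1, hS _ p.2⟩ : ↥(Metric.ball (0 : ℂ) R))) :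
    ∃ ρ : ℝ, 0 < ρ ∧ ρ ≤ R ∧ ∃ (I : Type) (τ : I → ℂ → Y),
      (∀ i, ContinuousOn (τ i) (Metric.ball 0 ρ)) ∧
      ∀ x ∈ Metric.ball (0 : ℂ) ρ, Function.Injective (fun i => τ i x) ∧
        ∀ w, (x, w) ∈ S ↔ ∃ i, w = τ i x := by
  classical
  obtain ⟨-, U, h0U, hU, -, H, hH⟩ := hcov ⟨0, Metric.mem_ball_self hR⟩
  obtain ⟨V, hV, rfl⟩ := isOpen_induced_iff.1 hU
  obtain ⟨ρ', hρ', hball⟩ := Metric.isOpen_iff.1 hV 0 h0U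
  have hRmem : ∀ {x}, x ∈ Metric.ball (0 : ℂ) (min ρ' R) → x ∈ Metric.ball (0 : ℂ) R := fun hx =>
    Metric.ball_subset_ball (min_le_right _ _) hx
  have hVmem : ∀ {x}, x ∈ Metric.ball (0 : ℂ) (min ρ' R) → x ∈ V := fun hx =>
    hball (Metric.ball_subset_ball (min_le_left _ _) hx)
  by_cases hY : Nonempty Y
  swap
  · refine ⟨R, hR, le_rfl, PEmpty, fun i => i.elim, fun i => i.elim, fun x _ => ⟨fun i => i.elim,
      fun w => (hY ⟨w⟩).elim⟩⟩
  let T : ∀ x ∈ Metric.ball (0 : ℂ) (min ρ' R), _ → ↥S := fun x hx i =>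
    (H.symm (⟨⟨x, hRmem hx⟩, hVmem hx⟩, i)).1
  have hT1 : ∀ x hx i, (T x hx i).1.1 = x := by
    intro x hx i
    have := hH (H.symm (⟨⟨x, hRmem hx⟩, hVmem hx⟩, i))
    rw [H.apply_symm_apply] at this
    exact (congrArg Subtype.val this).symm
  refine ⟨min ρ' R, lt_min hρ' hR, min_le_right _ _, _,
    fun i x => if hx : x ∈ Metric.ball (0 : ℂ) (min ρ' R) then (T x hx i).1.2 else
      Classical.arbitrary Y, fun i => ?_, fun x hx => ⟨fun i j hij => ?_, fun w => ⟨fun hw => ?_, ?_⟩⟩⟩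
  · rw [continuousOn_iff_continuous_domRestrict]
    have : Continuous fun x : ↥(Metric.ball (0 : ℂ) (min ρ' R)) => (T x.1 x.2 i).1.2 := by
      fun_prop
    refine this.congr fun x => ?_
    change _ = if hx : _ then _ else _
    rw [dif_pos x.2]
  · simp only [dif_pos hx] at hij
    have h1 : T x hx i = T x hx j := Subtype.ext (Prod.ext ((hT1 x hx i).trans (hT1 x hx j).symm) hij)
    exact (Prod.ext_iff.1 (H.symm.injective (Subtype.ext h1))).2
  · refine ⟨(H ⟨⟨(x, w), hw⟩, hVmem hx⟩).2, ?_⟩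
    simp only [dif_pos hx]
    have h1 : (H ⟨⟨(x, w), hw⟩, hVmem hx⟩).1 = ⟨⟨x, hRmem hx⟩, hVmem hx⟩ :=
      Subtype.ext (hH ⟨⟨(x, w), hw⟩, hVmem hx⟩)
    have h2 : T x hx (H ⟨⟨(x, w), hw⟩, hVmem hx⟩).2 = ⟨(x, w), hw⟩ := by
      change (H.symm (_, _)).1 = _
      rw [← h1, Prod.mk.eta, H.symm_apply_apply]
    rw [h2]
  · rintro ⟨i, rfl⟩
    simp only [dif_pos hx]
    have := (T x hx i).2
    have e : (T x hx i).1 = (x, (T x hx i).1.2) := Prod.ext (hT1 x hx i) rfl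
    rwa [e] at this

/-- Near the origin the projective closure of an asymptotic germ consists of the graphs of finitely
many continuous functions, and of one continuous branch through infinity. -/
theorem IsAsymptoticGerm.exists_branches {R : ℝ} {m n : ℕ} {C : Set (ℂ × ℂ)} (hn : 1 ≤ n)
    (h : IsAsymptoticGerm R (m + 1) n C) :
    ∃ ρ : ℝ, 0 < ρ ∧ ρ ≤ R ∧ ∃ (s : Fin m → ℂ → ℂ) (z : ℂ → ℂ),
      (∀ i, ContinuousOn (s i) (Metric.ball 0 ρ)) ∧ ContinuousOn z (Metric.ball 0 ρ) ∧ z 0 = 0 ∧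
      ∀ x ∈ Metric.ball (0 : ℂ) ρ, Function.Injective (fun i => s i x) ∧
        ∀ w, (x, w) ∈ projectiveClosure (Metric.ball 0 R) C ↔
          w = chartAtInfinity (z x) ∨ ∃ i, w = (s i x : OnePoint ℂ) := by
  obtain ⟨ρ₁, hρ₁, hρ₁R, I, τ, hτ, hτS⟩ := exists_local_sections h.radius_pos
    (S := projectiveClosure (Metric.ball 0 R) C) (fun p hp => hp.2) h.covering
  have h0 : (0 : ℂ) ∈ Metric.ball (0 : ℂ) ρ₁ := Metric.mem_ball_self hρ₁
  have hτ0 : ∀ i, ContinuousAt (τ i) 0 := fun i =>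
    (hτ i).continuousAt (Metric.isOpen_ball.mem_nhds h0)
  obtain ⟨hinj0, hmem0⟩ := hτS 0 h0
  -- Since `n ≥ 1`, the reduced equation vanishes at the point at infinity over `0`.
  have hinf : ((0 : ℂ), (OnePoint.infty : OnePoint ℂ)) ∈ projectiveClosure (Metric.ball 0 R) C := by
    obtain ⟨f, hf, hord⟩ := h.pole_order
    have h1 : f (0, 0) = 0 := by
      have han : AnalyticAt ℂ (fun t => f (t, 0)) 0 :=
        AnalyticAt.comp₂ (h := f) (f := fun t => t) (g := fun _ => 0) hf.1 analyticAt_id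
          analyticAt_const
      by_contra hne
      rw [(han.analyticOrderAt_eq_zero).2 hne] at hord
      have : (0 : ℕ) = n := by exact_mod_cast hord
      omega
    have h2 := hf.2.1.self_of_nhds.2 h1
    rwa [mem_ofPred_eq, chartAtInfinity_zero] at h2
  obtain ⟨i₀, hi₀⟩ := (hmem0 _).1 hinf
  have hrange : {w : OnePoint ℂ | ((0 : ℂ), w) ∈ projectiveClosure (Metric.ball 0 R) C} =
      range fun i => τ i 0 := by
    ext w
    rw [mem_ofPred_eq, hmem0, mem_range]
    simp only [eq_comm]
  obtain ⟨hfin, hcard⟩ := h.degree 0 (Metric.mem_ball_self h.radius_pos)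
  rw [hrange] at hfin hcard
  have e₀ := Equiv.ofInjective _ hinj0
  have : Finite ↥(range fun i => τ i 0) := hfin
  have : Finite I := Finite.of_equiv _ e₀.symm
  have hcardI : Nat.card I = m + 1 := by
    rw [Nat.card_congr e₀, Nat.card_coe_set_eq, hcard]
  obtain ⟨e, he⟩ : ∃ e : I ≃ Fin (m + 1), e i₀ = 0 :=
    ⟨(Finite.equivFinOfCardEq hcardI).trans (Equiv.swap (Finite.equivFinOfCardEq hcardI i₀) 0),
      by simp⟩
  have hτ_inf : ∀ j : Fin m, τ (e.symm j.succ) 0 ≠ OnePoint.infty := by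
    intro j h1
    have h2 : e.symm j.succ = i₀ := hinj0 (h1.trans hi₀)
    rw [← e.symm_apply_apply i₀, he] at h2
    exact Fin.succ_ne_zero j (e.symm.injective h2)
  -- By continuity the branches which are finite at `0` stay finite, and the one through infinity
  -- stays away from the origin, where the coordinate at infinity is defined.
  have hev : ∀ᶠ x in 𝓝 (0 : ℂ), (∀ j : Fin m, τ (e.symm j.succ) x ≠ OnePoint.infty) ∧
      τ i₀ x ≠ ((0 : ℂ) : OnePoint ℂ) := by
    refine (eventually_all.2 fun j => (hτ0 _).eventually_ne (hτ_inf j)).and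
      ((hτ0 i₀).eventually_ne ?_)
    rw [← hi₀]
    exact OnePoint.infty_ne_coe _
  obtain ⟨ρ₂, hρ₂, hball⟩ := Metric.eventually_nhds_iff_ball.1 hev
  have hsub : Metric.ball (0 : ℂ) (min ρ₁ ρ₂) ⊆ Metric.ball 0 ρ₁ :=
    Metric.ball_subset_ball (min_le_left _ _)
  have hball' : ∀ x ∈ Metric.ball (0 : ℂ) (min ρ₁ ρ₂), _ := fun x hx =>
    hball x (Metric.ball_subset_ball (min_le_right _ _) hx)
  have hs : ∀ j : Fin m, ∀ x ∈ Metric.ball (0 : ℂ) (min ρ₁ ρ₂),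
      ((affineCoord (τ (e.symm j.succ) x) : ℂ) : OnePoint ℂ) = τ (e.symm j.succ) x := by
    intro j x hx
    obtain ⟨y, hy⟩ := OnePoint.ne_infty_iff_exists.1 ((hball' x hx).1 j)
    rw [← hy, affineCoord_coe]
  refine ⟨min ρ₁ ρ₂, lt_min hρ₁ hρ₂, (min_le_left _ _).trans hρ₁R,
    fun j x => affineCoord (τ (e.symm j.succ) x), fun x => infinityCoord (τ i₀ x),
    fun j x hx => ?_, fun x hx => ?_, ?_, fun x hx => ⟨fun j j' hjj' => ?_, fun w => ?_⟩⟩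
  · have h1 := continuousAt_affineCoord (affineCoord (τ (e.symm j.succ) x))
    rw [hs j x hx] at h1
    exact h1.comp_continuousWithinAt ((hτ _).mono hsub x hx)
  · exact (continuousAt_infinityCoord (hball' x hx).2).comp_continuousWithinAt
      ((hτ _).mono hsub x hx)
  · change infinityCoord (τ i₀ 0) = 0
    rw [← hi₀]; rfl
  · have h1 : τ (e.symm j.succ) x = τ (e.symm j'.succ) x := by
      rw [← hs j x hx, ← hs j' x hx]
      exact congrArg _ hjj'
    exact Fin.succ_injective _ (e.symm.injective ((hτS x (hsub hx)).1 h1))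
  · rw [(hτS x (hsub hx)).2, chartAtInfinity_infinityCoord (hball' x hx).2,
      ← e.symm.exists_congr_right (q := fun i => w = τ i x), Fin.exists_fin_succ, ← he,
      e.symm_apply_apply]
    exact or_congr Iff.rfl (exists_congr fun j => by rw [hs j x hx])

theorem coe_eq_chartAtInfinity_iff {y z : ℂ} :
    (y : OnePoint ℂ) = chartAtInfinity z ↔ z * y = 1 := by
  by_cases hz : z = 0
  · simp [hz, chartAtInfinity_zero]
  · rw [chartAtInfinity_of_ne hz, OnePoint.coe_eq_coe, ← one_div, eq_div_iff hz, mul_comm]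

/-- A continuous function on a disc which does not vanish at the centre is, on a smaller disc, the
exponential of a function which is continuous in the plane. -/
theorem exists_continuous_exp_eq {w : ℂ → ℂ} {ρ : ℝ} (hρ : 0 < ρ)
    (hw : ContinuousOn w (Metric.ball 0 ρ)) (h0 : w 0 ≠ 0) :
    ∃ ρ' : ℝ, 0 < ρ' ∧ ρ' ≤ ρ ∧ ∃ ℓ : ℂ → ℂ, Continuous ℓ ∧
      ∀ x ∈ Metric.ball (0 : ℂ) ρ', Complex.exp (ℓ x) = w x := by
  have hw0 : ContinuousAt (fun x => w x / w 0) 0 :=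
    (hw.continuousAt (Metric.ball_mem_nhds 0 hρ)).div_const _
  have hev : ∀ᶠ x in 𝓝 (0 : ℂ), w x / w 0 ∈ Complex.slitPlane :=
    hw0.eventually_mem (by
      rw [div_self h0]; exact Complex.isOpen_slitPlane.mem_nhds Complex.one_mem_slitPlane)
  obtain ⟨δ, hδ, hball⟩ := Metric.eventually_nhds_iff_ball.1 hev
  set r := min δ ρ / 2 with hr
  have hrpos : 0 < r := half_pos (lt_min hδ hρ)
  have hlt : r < min δ ρ := half_lt_self (lt_min hδ hρ)
  have hrδ : r < δ := hlt.trans_le (min_le_left _ _)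
  have hrρ : r < ρ := hlt.trans_le (min_le_right _ _)
  -- The radial retraction of the plane onto the closed disc of radius `r`; composition with it
  -- makes the logarithm continuous on the whole plane.
  let cl : ℂ → ℂ := fun x => ((r / max r ‖x‖ : ℝ) : ℂ) * x
  have hmax : ∀ x : ℂ, 0 < max r ‖x‖ := fun x => hrpos.trans_le (le_max_left _ _)
  have hcl : Continuous cl := by
    have : Continuous fun x : ℂ => r / max r ‖x‖ :=
      continuous_const.div (by fun_prop) fun x => (hmax x).ne'
    exact (Complex.continuous_ofReal.comp this).mul continuous_id
  have hcln : ∀ x, ‖cl x‖ ≤ r := by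
    intro x
    rw [norm_mul, Complex.norm_real, Real.norm_of_nonneg (div_pos hrpos (hmax x)).le,
      div_mul_eq_mul_div, div_le_iff₀ (hmax x)]
    gcongr
    exact le_max_right _ _
  have hclmem : ∀ {t x}, r < t → cl x ∈ Metric.ball 0 t := fun ht => by
    rw [mem_ball_zero_iff]; exact (hcln _).trans_lt ht
  refine ⟨r, hrpos, hrρ.le, fun x => Complex.log (w (cl x) / w 0) + Complex.log (w 0), ?_,
    fun x hx => ?_⟩
  · refine Continuous.add (continuous_iff_continuousAt.2 fun x => ?_) continuous_const
    refine ContinuousAt.clog (ContinuousAt.div_const ?_ _) (hball _ (hclmem hrδ))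
    exact ContinuousAt.comp (g := w)
      (hw.continuousAt (Metric.isOpen_ball.mem_nhds (hclmem hrρ))) hcl.continuousAt
  · have hx' : ‖x‖ < r := by simpa using hx
    have e : cl x = x := by
      change ((r / max r ‖x‖ : ℝ) : ℂ) * x = x
      rw [max_eq_left hx'.le, div_self hrpos.ne', Complex.ofReal_one, one_mul]
    change Complex.exp (Complex.log (w (cl x) / w 0) + Complex.log (w 0)) = w x
    rw [e, Complex.exp_add, Complex.exp_log h0, Complex.exp_log, div_mul_cancel₀ _ h0]
    exact Complex.slitPlane_ne_zero (hball x (by simpa using hx'.trans hrδ))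

/-- Normal form of an asymptotic germ near the origin. -/
theorem IsAsymptoticGerm.exists_normalForm {R : ℝ} {m n : ℕ} {C : Set (ℂ × ℂ)} (hn : 1 ≤ n)
    (h : IsAsymptoticGerm R (m + 1) n C) :
    ∃ ρ : ℝ, 0 < ρ ∧ ρ ≤ R ∧ ∃ (s : Fin m → ℂ → ℂ) (ℓ : ℂ → ℂ), Continuous ℓ ∧
      (∀ i, ContinuousOn (s i) (Metric.ball 0 ρ)) ∧
      ∀ x ∈ Metric.ball (0 : ℂ) ρ, Function.Injective (fun i => s i x) ∧
        ∀ y, (x, y) ∈ C ↔ (∃ i, y = s i x) ∨ x ^ n * Complex.exp (ℓ x) * y = 1 := by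
  obtain ⟨ρ, hρ, hρR, s, z, hs, hz, hz0, hsz⟩ := h.exists_branches hn
  obtain ⟨f, hf, hord⟩ := h.pole_order
  have h0 : Metric.ball (0 : ℂ) ρ ∈ 𝓝 0 := Metric.ball_mem_nhds 0 hρ
  have hgraph : ∀ᶠ q in 𝓝 ((0 : ℂ), (0 : ℂ)),
      q ∈ {q : ℂ × ℂ | (q.1, chartAtInfinity q.2) ∈ projectiveClosure (Metric.ball 0 R) C} ↔
        q.2 = z q.1 := by
    -- The finite branches are bounded near `0`, so they do not come close to infinity, where the
    -- projective closure is therefore just the graph of `z`.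
    have h1 : ∀ j, ∀ᶠ q in 𝓝 ((0 : ℂ), (0 : ℂ)), ‖q.2 * s j q.1‖ < 1 := by
      intro j
      have hc : ContinuousAt (fun q : ℂ × ℂ => ‖q.2 * s j q.1‖) (0, 0) := by
        refine (continuousAt_snd.mul ?_).norm
        exact ContinuousAt.comp (g := s j) (f := Prod.fst) ((hs j).continuousAt h0)
          continuousAt_fst
      exact hc.eventually_lt continuousAt_const (by simp)
    filter_upwards [eventually_all.2 h1,
      (continuous_fst.tendsto' ((0 : ℂ), (0 : ℂ)) 0 rfl).eventually h0] with q h2 h3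
    rw [(hsz _ h3).2]
    constructor
    · rintro (h4 | ⟨j, h4⟩)
      · rw [← infinityCoord_chartAtInfinity q.2, h4, infinityCoord_chartAtInfinity]
      · have := coe_eq_chartAtInfinity_iff.1 h4.symm
        have h5 := h2 j
        rw [this] at h5
        simp at h5
    · intro h4
      rw [h4]
      exact Or.inl rfl
  obtain ⟨u, hu0, hu⟩ := hf.exists_tendsto_div_pow hord (hz.continuousAt h0) hz0 hgraph
  -- The quotient `z x / x ^ n`, completed by its nonzero limit at `0`, is the unit factor whose
  -- logarithm is `ℓ`.
  have hw : ContinuousOn (Function.update (fun x => z x / x ^ n) 0 u) (Metric.ball 0 ρ) := by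
    intro x hx
    refine ContinuousAt.continuousWithinAt ?_
    by_cases hx0 : x = 0
    · rw [hx0, continuousAt_update_same]
      exact hu
    · rw [continuousAt_update_of_ne hx0]
      exact (hz.continuousAt (Metric.isOpen_ball.mem_nhds hx)).div (by fun_prop)
        (pow_ne_zero _ hx0)
  obtain ⟨ρ', hρ', hρ'ρ, ℓ, hℓ, hexp⟩ := exists_continuous_exp_eq hρ hw (by simpa using hu0)
  have hsub := Metric.ball_subset_ball (x := (0 : ℂ)) hρ'ρ
  refine ⟨ρ', hρ', hρ'ρ.trans hρR, s, ℓ, hℓ, fun i => (hs i).mono hsub, fun x hx =>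
    ⟨(hsz x (hsub hx)).1, fun y => ?_⟩⟩
  have hzx : x ^ n * Complex.exp (ℓ x) = z x := by
    rw [hexp x hx]
    by_cases hx0 : x = 0
    · rw [hx0, hz0, zero_pow (by omega), zero_mul]
    · rw [Function.update_of_ne hx0, mul_div_cancel₀ _ (pow_ne_zero _ hx0)]
  rw [← coe_mem_projectiveClosure_iff h.curve (Metric.ball_subset_ball hρR (hsub hx)),
    (hsz x (hsub hx)).2, coe_eq_chartAtInfinity_iff, hzx, or_comm]
  simp only [OnePoint.coe_eq_coe]

end Branches

/-! ### Straightening the finite branches -/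

section Shear

variable {X : Type*} [TopologicalSpace X] {h : X → ℂ → ℂ}

theorem norm_sub_le_two_mul_of_lipschitz {k : ℂ → ℂ} (hk : LipschitzWith (1 / 2) k) (a b : ℂ) :
    ‖a - b‖ ≤ 2 * ‖a + k a - (b + k b)‖ := by
  have h1 := hk.norm_sub_le a b
  have h2 : ‖a - b‖ ≤ ‖a + k a - (b + k b)‖ + ‖k a - k b‖ := by
    have : a - b = (a + k a - (b + k b)) - (k a - k b) := by ring
    calc ‖a - b‖ = ‖(a + k a - (b + k b)) - (k a - k b)‖ := by rw [← this]
      _ ≤ _ := norm_sub_le _ _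
  push_cast at h1
  linarith

/-- A fixed point of this contraction is a solution `y` of `y + k y = v`; this inverts the shear. -/
theorem contractingWith_sub {k : ℂ → ℂ} (hk : LipschitzWith (1 / 2) k) (v : ℂ) :
    ContractingWith (1 / 2) fun y => v - k y := by
  refine ⟨by norm_num, LipschitzWith.of_dist_le_mul fun a b => ?_⟩
  rw [dist_sub_left]
  exact hk.dist_le_mul a b

/-- The homeomorphism `(x, y) ↦ (x, y + h x y)`, where `h` is contracting in `y`. -/
def shearHomeomorph (hc : Continuous fun p : X × ℂ => h p.1 p.2)
    (hL : ∀ x, LipschitzWith (1 / 2) (h x)) : X × ℂ ≃ₜ X × ℂ where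
  toFun p := (p.1, p.2 + h p.1 p.2)
  invFun p := (p.1, (contractingWith_sub (hL p.1) p.2).fixedPoint)
  left_inv p := Prod.ext rfl ((contractingWith_sub (hL p.1) _).fixedPoint_unique
    (add_sub_cancel_right _ _)).symm
  right_inv p := by
    refine Prod.ext rfl ?_
    have := (contractingWith_sub (hL p.1) p.2).fixedPoint_isFixedPt
    change _ + h p.1 _ = p.2
    exact eq_sub_iff_add_eq.1 this.symm
  continuous_toFun := by fun_prop
  continuous_invFun := by
    refine continuous_fst.prodMk (continuous_iff_continuousAt.2 fun p => ?_)
    let g : X × ℂ → ℂ := fun q => (contractingWith_sub (hL q.1) q.2).fixedPoint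
    have hg : ∀ q, g q + h q.1 (g q) = q.2 := fun q =>
      eq_sub_iff_add_eq.1 (contractingWith_sub (hL q.1) q.2).fixedPoint_isFixedPt.symm
    -- The distance of the solutions is controlled by the defect of the fixed value `g p` in the
    -- equation for `q`, which depends continuously on `q`.
    have h1 : ∀ q, ‖g q - g p‖ ≤ 2 * ‖q.2 - (g p + h q.1 (g p))‖ := by
      intro q
      have := norm_sub_le_two_mul_of_lipschitz (hL q.1) (g q) (g p)
      rwa [hg q] at this
    refine tendsto_iff_norm_sub_tendsto_zero.2 (squeeze_zero (fun _ => norm_nonneg _) h1 ?_)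
    have h2 : Continuous fun q : X × ℂ => 2 * ‖q.2 - (g p + h q.1 (g p))‖ := by
      have : Continuous fun q : X × ℂ => h q.1 (g p) :=
        hc.comp (continuous_fst.prodMk continuous_const)
      fun_prop
    refine h2.tendsto' _ _ ?_
    rw [hg p, sub_self, norm_zero, mul_zero]

/-- The complement over `B`, as a subspace of the product of `B` with the line. -/
def complementOverHomeomorph (B : Set ℂ) (C : Set (ℂ × ℂ)) :
    ↥(complementOver B C) ≃ₜ {q : ↥B × ℂ // ((q.1 : ℂ), q.2) ∉ C} where
  toFun p := ⟨(⟨p.1.1, p.2.1⟩, p.1.2), p.2.2⟩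
  invFun q := ⟨(q.1.1, q.1.2), q.1.1.2, q.2⟩
  left_inv _ := rfl
  right_inv _ := rfl
  continuous_toFun := by fun_prop
  continuous_invFun := by fun_prop

end Shear

section Straightening

variable {m : ℕ}

/-- The tent function of radius `d` about `c`. -/
def tent (d : ℝ) (c y : ℂ) : ℝ := max 0 (1 - ‖y - c‖ / d)

theorem tent_nonneg (d : ℝ) (c y : ℂ) : 0 ≤ tent d c y := le_max_left _ _

theorem tent_le_one {d : ℝ} (hd : 0 < d) (c y : ℂ) : tent d c y ≤ 1 :=
  max_le zero_le_one (sub_le_self _ (by positivity))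

theorem tent_self (d : ℝ) (c : ℂ) : tent d c c = 1 := by simp [tent]

theorem tent_eq_zero {d : ℝ} (hd : 0 < d) {c y : ℂ} (h : d ≤ ‖y - c‖) : tent d c y = 0 :=
  max_eq_left (sub_nonpos.2 ((one_le_div hd).2 h))

theorem abs_tent_sub_le {d : ℝ} (hd : 0 < d) (c y y' : ℂ) :
    |tent d c y - tent d c y'| ≤ ‖y - y'‖ / d := by
  refine (abs_max_sub_max_le_max ..).trans (max_le (by simp; positivity) ?_)
  have : 1 - ‖y - c‖ / d - (1 - ‖y' - c‖ / d) = (‖y' - c‖ - ‖y - c‖) / d := by ring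
  rw [this, abs_div, abs_of_pos hd]
  gcongr
  have := abs_norm_sub_norm_le (y' - c) (y - c)
  rwa [sub_sub_sub_cancel_right, norm_sub_rev y' y] at this

theorem continuous_tent (d : ℝ) (c : ℂ) : Continuous (tent d c) := by
  unfold tent; fun_prop

/-- The displacement which moves the points `c i` to the points `c i + v i`. -/
def displacement (d : ℝ) (c v : Fin m → ℂ) (y : ℂ) : ℂ := ∑ i, (tent d (c i) y : ℂ) * v i

variable {d η : ℝ} {c v : Fin m → ℂ}

theorem lipschitzWith_displacement (hd : 0 < d) (hv : ∀ i, ‖v i‖ ≤ η) (hη : m * η ≤ d / 2) :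
    LipschitzWith (1 / 2) (displacement d c v) := by
  refine LipschitzWith.of_dist_le_mul fun y y' => ?_
  rw [dist_eq_norm, dist_eq_norm, displacement, displacement, ← Finset.sum_sub_distrib]
  have h1 : ∀ i ∈ Finset.univ, ‖(tent d (c i) y : ℂ) * v i - (tent d (c i) y' : ℂ) * v i‖ ≤
      ‖y - y'‖ / d * η := by
    intro i _
    rw [← sub_mul, norm_mul, ← Complex.ofReal_sub, Complex.norm_real]
    exact mul_le_mul (abs_tent_sub_le hd ..) (hv i) (norm_nonneg _) (by positivity)
  refine (norm_sum_le_of_le _ h1).trans ?_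
  rw [Finset.sum_const, Finset.card_univ, Fintype.card_fin, nsmul_eq_mul]
  have : (m : ℝ) * (‖y - y'‖ / d * η) = ‖y - y'‖ / d * (m * η) := by ring
  rw [this]
  calc ‖y - y'‖ / d * (m * η) ≤ ‖y - y'‖ / d * (d / 2) := by gcongr
    _ = ((1 / 2 : NNReal) : ℝ) * ‖y - y'‖ := by push_cast; field_simp

theorem norm_displacement_le (hd : 0 < d) (hv : ∀ i, ‖v i‖ ≤ η) (hη : m * η ≤ d / 2) (y : ℂ) :
    ‖displacement d c v y‖ ≤ d / 2 := by
  have h1 : ∀ i ∈ Finset.univ, ‖(tent d (c i) y : ℂ) * v i‖ ≤ η := by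
    intro i _
    rw [norm_mul, Complex.norm_real, Real.norm_of_nonneg (tent_nonneg ..)]
    exact (mul_le_of_le_one_left (norm_nonneg _) (tent_le_one hd ..)).trans (hv i)
  refine (norm_sum_le_of_le _ h1).trans ?_
  rwa [Finset.sum_const, Finset.card_univ, Fintype.card_fin, nsmul_eq_mul]

theorem displacement_apply_self (hd : 0 < d) (hsep : ∀ i j, i ≠ j → d ≤ ‖c i - c j‖) (j : Fin m) :
    displacement d c v (c j) = v j := by
  rw [displacement, Finset.sum_eq_single j]
  · rw [tent_self, Complex.ofReal_one, one_mul]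
  · intro i _ hij
    rw [tent_eq_zero hd (hsep j i hij.symm), Complex.ofReal_zero, zero_mul]
  · simp

theorem displacement_eq_zero (hd : 0 < d) {M : ℝ} (hM : ∀ i, ‖c i‖ + d < M) {y : ℂ}
    (hy : M ≤ ‖y‖) : displacement d c v y = 0 := by
  refine Finset.sum_eq_zero fun i _ => ?_
  rw [tent_eq_zero hd, Complex.ofReal_zero, zero_mul]
  have := norm_sub_norm_le y (c i)
  have := hM i
  linarith

/-- A curve whose finite branches stay close to their values at the base point is presented by kites
about the punctures of the fibre. -/
theorem exists_hasKitePresentation_of_branches {n : ℕ} (hn : 1 ≤ n) {C : Set (ℂ × ℂ)}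
    {r d η M : ℝ} (hd : 0 < d) (hη : m * η ≤ d / 2) (hdM : d < M) {s : Fin m → ℂ → ℂ} {ℓ : ℂ → ℂ}
    (hℓ : Continuous ℓ) (hs : ∀ i, ContinuousOn (s i) (Metric.ball 0 r)) {x₀ : ℂ}
    (hx₀ : x₀ ∈ Metric.ball (0 : ℂ) r) (hne : x₀ ≠ 0)
    (hsep : ∀ i j, i ≠ j → d ≤ ‖s i x₀ - s j x₀‖) (hM : ∀ i, ‖s i x₀‖ + d < M)
    (hclose : ∀ x ∈ Metric.ball (0 : ℂ) r, ∀ i, ‖s i x - s i x₀‖ ≤ η)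
    (hsmall : ∀ x ∈ Metric.ball (0 : ℂ) r, ‖x ^ n * Complex.exp (ℓ x)‖ * (4 * M) < 1)
    (hC : ∀ x ∈ Metric.ball (0 : ℂ) r, ∀ y,
      (x, y) ∈ C ↔ (∃ i, y = s i x) ∨ x ^ n * Complex.exp (ℓ x) * y = 1) :
    ∃ σ : Equiv.Perm (Fin m), HasKitePresentation (Metric.ball 0 r) C x₀ hx₀
      (Fin.cons (x₀ ^ n * Complex.exp (ℓ x₀))⁻¹ fun i => s (σ i) x₀) n := by
  have hMpos : 0 < M := hd.trans hdM
  have hinj : Function.Injective fun i => s i x₀ := by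
    intro i j hij
    by_contra hne
    have := hsep i j hne
    have e : s i x₀ = s j x₀ := hij
    rw [e, sub_self, norm_zero] at this
    linarith
  obtain ⟨σ, hσ⟩ := exists_hasKitePresentation hn hMpos (c := fun i => s i x₀) hinj
    (fun i => by have := hM i; linarith) hℓ hsmall hx₀ hne
  refine ⟨σ, ?_⟩
  -- The displacement moves the points `s i x₀` to the points `s i x` and is zero far out, so the
  -- shear takes the constant branches to the branches of `C` and fixes the one going to infinity.
  let h : ↥(Metric.ball (0 : ℂ) r) → ℂ → ℂ := fun x =>
    displacement d (fun i => s i x₀) fun i => s i x - s i x₀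
  have hL : ∀ x, LipschitzWith (1 / 2) (h x) := fun x =>
    lipschitzWith_displacement hd (hclose x x.2) hη
  have hc : Continuous fun p : ↥(Metric.ball (0 : ℂ) r) × ℂ => h p.1 p.2 := by
    refine continuous_finsetSum _ fun i _ => ?_
    have h1 : Continuous fun x : ↥(Metric.ball (0 : ℂ) r) => s i x :=
      continuousOn_iff_continuous_domRestrict.1 (hs i)
    have h2 := continuous_tent d (s i x₀)
    exact (Complex.continuous_ofReal.comp (h2.comp continuous_snd)).mul
      ((h1.comp continuous_fst).sub continuous_const)
  have hcurve : ∀ (x : ↥(Metric.ball (0 : ℂ) r)) (y : ℂ),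
      (y ∈ range (fun i => s i x₀) ∨ (x : ℂ) ^ n * Complex.exp (ℓ x) * y = 1) ↔
        ((x : ℂ), y + h x y) ∈ C := by
    intro x y
    rw [hC x x.2]
    -- The branch to infinity stays in the region `|y| > 4M`, whereas the displacement is zero for
    -- `|y| ≥ M` and nowhere larger than `d / 2 < M`. So no point can enter or leave this branch
    -- under the shear.
    have hlarge : ∀ w, (x : ℂ) ^ n * Complex.exp (ℓ x) * w = 1 → 4 * M < ‖w‖ := by
      intro w hw
      by_contra! hle
      have h1 := hsmall x x.2
      have h2 : ‖(x : ℂ) ^ n * Complex.exp (ℓ x)‖ * ‖w‖ = 1 := by rw [← norm_mul, hw, norm_one]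
      have := mul_le_mul_of_nonneg_left hle (norm_nonneg ((x : ℂ) ^ n * Complex.exp (ℓ x)))
      linarith
    have hzero : M ≤ ‖y‖ → h x y = 0 := fun hy => displacement_eq_zero hd hM hy
    have hself : ∀ j, s j x₀ + h x (s j x₀) = s j x := fun j => by
      have : h x (s j x₀) = s j x - s j x₀ :=
        displacement_apply_self (c := fun i => s i x₀) hd hsep j
      rw [this]; ring
    refine or_congr ⟨?_, ?_⟩ ⟨fun hy => ?_, fun hy => ?_⟩
    · rintro ⟨j, rfl⟩
      exact ⟨j, hself j⟩
    · rintro ⟨j, hj⟩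
      refine ⟨j, ?_⟩
      have := norm_sub_le_two_mul_of_lipschitz (hL x) (s j x₀) y
      rw [hj, hself, sub_self, norm_zero, mul_zero] at this
      exact sub_eq_zero.1 (norm_le_zero_iff.1 this)
    · rw [hzero (by have := hlarge y hy; linarith), add_zero, hy]
    · have h1 := hlarge _ hy
      have h2 := norm_add_le y (h x y)
      have h3 : ‖h x y‖ ≤ d / 2 := norm_displacement_le hd (hclose x x.2) hη y
      rwa [hzero (by linarith), add_zero] at hy
  have hh0 : ∀ y, h ⟨x₀, hx₀⟩ y = 0 := fun y => Finset.sum_eq_zero fun i _ => by simp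
  let e := (complementOverHomeomorph (Metric.ball 0 r) {p | p.2 ∈ range (fun i => s i x₀) ∨
      p.1 ^ n * Complex.exp (ℓ p.1) * p.2 = 1}).trans
    (((shearHomeomorph hc hL).subtype fun q => not_congr (hcurve q.1 q.2)).trans
      (complementOverHomeomorph (Metric.ball 0 r) C).symm)
  have key := hσ.transfer (x₀' := x₀) (C' := C) hx₀ e one_ne_zero (fun y => ?_) fun y => ?_
  · simpa only [one_mul] using key
  · have := hcurve ⟨x₀, hx₀⟩ y
    rw [hh0, add_zero] at this
    rw [one_mul]
    exact this
  · refine Prod.ext rfl ?_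
    change (y : ℂ) + h ⟨x₀, hx₀⟩ y = 1 * y
    rw [hh0, add_zero, one_mul]

/-- The complement of an asymptotic germ over a small disc is presented by kites. -/
theorem IsAsymptoticGerm.exists_hasKitePresentation {R : ℝ} {n : ℕ} {C : Set (ℂ × ℂ)} (hn : 1 ≤ n)
    (h : IsAsymptoticGerm R (m + 1) n C) :
    ∃ ρ : ℝ, 0 < ρ ∧ ρ ≤ R ∧ ∀ r : ℝ, r ≤ ρ → ∀ (x₀ : ℂ) (hx₀ : x₀ ∈ Metric.ball (0 : ℂ) r),
      x₀ ≠ 0 → ∃ a : Fin (m + 1) → ℂ, HasKitePresentation (Metric.ball 0 r) C x₀ hx₀ a n ∧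
        OnBranchToInfinity C r x₀ (a 0) := by
  obtain ⟨ρ₁, hρ₁, hρ₁R, s, ℓ, hℓ, hs, hC⟩ := h.exists_normalForm hn
  have h0 : Metric.ball (0 : ℂ) ρ₁ ∈ 𝓝 0 := Metric.ball_mem_nhds 0 hρ₁
  have hinj := (hC 0 (Metric.mem_ball_self hρ₁)).1
  obtain ⟨d, hdsep, hd⟩ : ∃ d : ℝ, (∀ i j, i ≠ j → 2 * d ≤ ‖s i 0 - s j 0‖) ∧ 0 < d := by
    have : ∀ᶠ d : ℝ in 𝓝[>] 0, ∀ i j, i ≠ j → 2 * d ≤ ‖s i 0 - s j 0‖ := by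
      refine nhdsWithin_le_nhds (eventually_all.2 fun i => eventually_all.2 fun j => ?_)
      by_cases hij : i = j
      · simp [hij]
      · have hpos : 0 < ‖s i 0 - s j 0‖ := norm_pos_iff.2 (sub_ne_zero.2 fun e => hij (hinj e))
        have h2 : ∀ᶠ d : ℝ in 𝓝 0, 2 * d < ‖s i 0 - s j 0‖ :=
          (by fun_prop : Continuous fun d : ℝ => 2 * d).continuousAt.eventually_lt
            continuousAt_const (by simpa using hpos)
        filter_upwards [h2] with d hd _ using hd.le
    exact (this.and self_mem_nhdsWithin).exists
  -- With `m + 1` in place of `m` the bound gives both `m * η ≤ d / 2` and `η ≤ d / 2`, also for `m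
  -- = 0`. Branches within `η / 2` of their values at `0` are within `η` of their values at `x₀`,
  -- and remain `d` apart.
  set η : ℝ := d / (2 * (m + 1)) with hηdef
  have hη : 0 < η := by positivity
  have hηd : (m + 1) * η = d / 2 := by rw [hηdef]; field_simp
  have hm0 : (0 : ℝ) ≤ m := Nat.cast_nonneg m
  have hmη : m * η ≤ d / 2 := by nlinarith
  have hη2 : η ≤ d / 2 := by nlinarith
  set M : ℝ := ∑ j, ‖s j 0‖ + 2 * d with hM
  have hsum : ∀ i, ‖s i 0‖ ≤ ∑ j, ‖s j 0‖ := fun i =>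
    Finset.single_le_sum (f := fun j => ‖s j 0‖) (fun _ _ => norm_nonneg _) (Finset.mem_univ i)
  have hsum0 : 0 ≤ ∑ j, ‖s j 0‖ := Finset.sum_nonneg fun _ _ => norm_nonneg _
  have hq : Continuous fun x : ℂ => x ^ n * Complex.exp (ℓ x) := by fun_prop
  have hev : ∀ᶠ x in 𝓝 (0 : ℂ), (∀ i, ‖s i x - s i 0‖ < η / 2) ∧
      ‖x ^ n * Complex.exp (ℓ x)‖ * (4 * M) < 1 := by
    refine (eventually_all.2 fun i => ?_).and ?_
    · exact (((hs i).continuousAt h0).sub continuousAt_const).norm.eventually_lt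
        continuousAt_const (by simpa using hη)
    · exact (hq.norm.mul continuous_const).continuousAt.eventually_lt continuousAt_const
        (by simp [show n ≠ 0 by omega])
  obtain ⟨ρ₂, hρ₂, hball⟩ := Metric.eventually_nhds_iff_ball.1 hev
  refine ⟨min ρ₁ ρ₂, lt_min hρ₁ hρ₂, (min_le_left _ _).trans hρ₁R, fun r hr x₀ hx₀ hne => ?_⟩
  have hsub1 := Metric.ball_subset_ball (x := (0 : ℂ)) (hr.trans (min_le_left _ _))
  have hsub2 := Metric.ball_subset_ball (x := (0 : ℂ)) (hr.trans (min_le_right _ _))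
  have hsep : ∀ i j, i ≠ j → d ≤ ‖s i x₀ - s j x₀‖ := by
    intro i j hij
    have h1 := hdsep i j hij
    have h2 := (hball x₀ (hsub2 hx₀)).1 i
    have h3 := (hball x₀ (hsub2 hx₀)).1 j
    have e : s i 0 - s j 0 = (s i x₀ - s j x₀) - ((s i x₀ - s i 0) - (s j x₀ - s j 0)) := by ring
    rw [e] at h1
    have h4 := norm_sub_le (s i x₀ - s j x₀) ((s i x₀ - s i 0) - (s j x₀ - s j 0))
    have h5 := norm_sub_le (s i x₀ - s i 0) (s j x₀ - s j 0)
    linarith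
  have hlt : ∀ i, ‖s i x₀‖ + d < M := by
    intro i
    have h2 := (hball x₀ (hsub2 hx₀)).1 i
    have h3 := norm_sub_norm_le (s i x₀) (s i 0)
    have h4 := hsum i
    linarith
  have hclose : ∀ x ∈ Metric.ball (0 : ℂ) r, ∀ i, ‖s i x - s i x₀‖ ≤ η := by
    intro x hx i
    have h1 := (hball x (hsub2 hx)).1 i
    have h2 := (hball x₀ (hsub2 hx₀)).1 i
    have e : s i x - s i x₀ = (s i x - s i 0) - (s i x₀ - s i 0) := by ring
    rw [e]
    have := norm_sub_le (s i x - s i 0) (s i x₀ - s i 0)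
    linarith
  obtain ⟨σ, hσ⟩ := exists_hasKitePresentation_of_branches hn (C := C) (M := M) hd hmη
    (by linarith) hℓ (fun i => (hs i).mono hsub1) hx₀ hne hsep hlt hclose
    (fun x hx => (hball x (hsub2 hx)).2) fun x hx => (hC x (hsub1 hx)).2
  refine ⟨_, hσ, fun x => (x ^ n * Complex.exp (ℓ x))⁻¹, ?_, fun t ht => ?_, ?_, rfl⟩
  · exact hq.continuousOn.inv₀ fun x hx =>
      mul_ne_zero (pow_ne_zero _ hx.2) (Complex.exp_ne_zero _)
  · exact ((hC t (hsub1 ht.1)).2 _).2 (Or.inr (mul_inv_cancel₀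
      (mul_ne_zero (pow_ne_zero _ ht.2) (Complex.exp_ne_zero _))))
  · rw [← Metric.cobounded_eq_cocompact]
    refine tendsto_inv₀_nhdsNE_zero.comp (tendsto_nhdsWithin_iff.2 ⟨?_, ?_⟩)
    · exact (hq.tendsto' 0 0 (by simp [show n ≠ 0 by omega])).mono_left nhdsWithin_le_nhds
    · filter_upwards [self_mem_nhdsWithin] with x hx
      exact mul_ne_zero (pow_ne_zero _ hx) (Complex.exp_ne_zero _)

end Straightening

end AsymptoticGerm

end

/-! ### The proposition and the model case -/

theorem mainTheorem6 :
    (∀ (m n : ℕ) (R : ℝ) (C : Set (ℂ × ℂ)), 1 ≤ n →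
      AsymptoticGerm.IsAsymptoticGerm R (m + 1) n C →
      ∃ ρ : ℝ, 0 < ρ ∧ ρ ≤ R ∧ ∀ r : ℝ, 0 < r → r ≤ ρ →
        ∀ (x₀ : ℂ) (hx₀ : x₀ ∈ Metric.ball (0 : ℂ) r), x₀ ≠ 0 →
          ∃ (y₀ : ↥(AsymptoticGerm.fibre C x₀)ᶜ) (a : Fin (m + 1) → ℂ)
            (b : Fin (m + 1) → FundamentalGroup ↥(AsymptoticGerm.fibre C x₀)ᶜ y₀),
            AsymptoticGerm.IsGeometricBasis (AsymptoticGerm.fibre C x₀) y₀ a b ∧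
            AsymptoticGerm.OnBranchToInfinity C r x₀ (a 0) ∧
            AsymptoticGerm.IsPresentedBy (Metric.ball 0 r) C x₀ hx₀ y₀ b
              {AsymptoticGerm.asymptoticRelator m n}) ∧
    (∀ n : ℕ, 1 ≤ n → ∀ x₀ : ℂ, x₀ ≠ 0 →
      (∃ (y₀ : ↥(AsymptoticGerm.fibre (AsymptoticGerm.asymptoticCurve n) x₀)ᶜ)
        (b : Fin 2 →
          FundamentalGroup ↥(AsymptoticGerm.fibre (AsymptoticGerm.asymptoticCurve n) x₀)ᶜ y₀),
        AsymptoticGerm.IsGeometricBasis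
          (AsymptoticGerm.fibre (AsymptoticGerm.asymptoticCurve n) x₀) y₀ ![(x₀ ^ n)⁻¹, 0] b) ∧
      ∀ (y₀ : ↥(AsymptoticGerm.fibre (AsymptoticGerm.asymptoticCurve n) x₀)ᶜ)
        (b : Fin 2 →
          FundamentalGroup ↥(AsymptoticGerm.fibre (AsymptoticGerm.asymptoticCurve n) x₀)ᶜ y₀),
        AsymptoticGerm.IsGeometricBasis
          (AsymptoticGerm.fibre (AsymptoticGerm.asymptoticCurve n) x₀) y₀ ![(x₀ ^ n)⁻¹, 0] b →
        AsymptoticGerm.IsPresentedBy Set.univ (AsymptoticGerm.asymptoticCurve n) x₀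
          (Set.mem_univ x₀) y₀ b {AsymptoticGerm.modelRelator n}) := by
  refine ⟨fun m n R C hn hC => ?_, fun n hn x₀ hx₀ => ⟨?_, fun y₀ b hb =>
    (AsymptoticGerm.asymptoticCurve_hasKitePresentation hn hx₀).of_isGeometricBasis y₀ b hb⟩⟩
  · obtain ⟨ρ, hρ, hρR, h⟩ := hC.exists_hasKitePresentation hn
    refine ⟨ρ, hρ, hρR, fun r _ hr x₀ hx₀ hne => ?_⟩
    obtain ⟨a, ha, hbranch⟩ := h r hr x₀ hx₀ hne
    obtain ⟨y₀, b, hb, hpres⟩ := ha.exists_geometricBasis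
    exact ⟨y₀, a, b, hb, hbranch, hpres⟩
  · obtain ⟨y₀, b, hb, -⟩ :=
      (AsymptoticGerm.asymptoticCurve_hasKitePresentation hn hx₀).exists_geometricBasis
    exact ⟨y₀, b, hb⟩
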